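/- **Setting.** On $\mathbb R^5$ write $\widehat f(\xi)=\int e^{-ix\cdot\xi}f(x)\,dx$ (extended to tempered distributions), $\langle f,g\rangle=\int\bar f g$ (summed over components for pairs), $\phi_1(\xi)=|\xi|\sqrt{1+|\xi|^2}$. Let $n>1/4$ be real and let $W=(-\Delta)^nV$ be real-valued, i.e. $\widehat W(\xi)=|\xi|^{2n}\widehat V(\xi)$, with $|\widehat V(0)|=1$, $W\in W^{4,1}\cap H^4$ ($W$ is taken to be its $C^1$ representative) and $(1+|x|^4)V\in H^{4n+4}$. Let $\rho_0\ge 0$, and let $(X,P,\beta)$ be a solution on $[0,\infty)$, with $\beta$ continuous in time with values in the energy space $\{\Re\beta\in H^1,\ \Im\beta\in\dot H^1\}$, of $$i\partial_t\beta=-\Delta\beta+\Re\beta+\sqrt{\rho_0}\,W^{X(t)},\qquad \dot X=P,\qquad \dot P=\sqrt{\rho_0}\,\Re\langle\nabla_xW^{X(t)},\beta\rangle,\qquad W^X(x)=W(X-x).$$ Put $U(x)=W(-x)$ (so $U=W$ if $W$ is even), $\beta_0=\beta(0)$, $h_0(y)=\beta_0(y+X(0))$, $a=\widehat{\Re h_0}$,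 $b=\widehat{\Im h_0}$. For $\epsilon>0$, $p\in\mathbb R^5$ let $$H_\epsilon(p)=\begin{pmatrix}p\cdot\nabla-\epsilon&-\Delta\\ \Delta-1&p\cdot\nabla-\epsilon\end{pmatrix},\qquad H_\epsilon(t)=H_\epsilon(P(t)).$$ For functions $a,b$ and $D_1,D_2$ of $\xi$ write $$[a,b;D]=aD_1+\frac{b|\xi|}{i\sqrt{1+|\xi|^2}}D_1+aD_2-\frac{b|\xi|}{i\sqrt{1+|\xi|^2}}D_2 .$$ With $\sigma=+1$ for the index $1$ and $\sigma=-1$ for the index $2$, put $q_\sigma=\dfrac{e^{i\sigma t\phi_1(\xi)+i(X(t)-X(0))\cdot\xi}}{i\sigma\phi_1(\xi)+iP(t)\cdot\xi-\epsilon}$ and $$D^1=(i\sigma\phi_1+iP(0)\cdot\xi)\,q_\sigma,\quad D^{1,\epsilon}=-\epsilon\, q_\sigma,\quad D^2=q_\sigma\, i\!\int_0^t\!\dot P(s)\cdot\xi\,ds,\quad D^4=q_\sigma,$$ $$D^3=q_\sigma\, i\int_0^t\!\int_0^s\dot P(s)\cdot\xi\; e^{-i\sigma\tau\phi_1(\xi)-i(X(\tau)-X(0))\cdot\xi}\,d\tau\,ds,\qquad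 D^{2,\epsilon}=-\epsilon\,\frac{\int_0^te^{i(X(t)-X(s))\cdot\xi+i\sigma(t-s)\phi_1(\xi)}\,ds}{i\sigma\phi_1(\xi)+iP(t)\cdot\xi-\epsilon}.$$ Finally define the vectors with $j$-th components $$R_1=\tfrac{\sqrt{\rho_0}}{2(2\pi)^5}\Re\langle i\xi_j\widehat U,[a,b;D^1]\rangle,\quad R_2=\tfrac{\sqrt{\rho_0}}{2(2\pi)^5}\Re\langle i\xi_j\widehat U,[a,b;D^2]\rangle,\quad E_{1,\epsilon}=\tfrac{\sqrt{\rho_0}}{2(2\pi)^5}\Re\langle i\xi_j\widehat U,[a,b;D^{1,\epsilon}]\rangle,$$ $$R_3=-\tfrac{\rho_0}{2(2\pi)^5}\Re\langle i\xi_j\widehat U,[0,\widehat U;D^3]\rangle,\quad R_4=-\tfrac{\rho_0}{2(2\pi)^5}\Re\langle i\xi_j\widehat U,[0,\widehat U;D^4]\rangle,\quad E_{2,\epsilon}=-\tfrac{\rho_0}{2(2\pi)^5}\Re\langle i\xi_j\widehat U,[0,\widehat U;D^{2,\epsilon}]\rangle.$$ **Statement.** (1) For all $\epsilon>0$ and $p\in\mathbb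 R^5$ the equation $H_\epsilon(p)u=(0,U)$ has exactly one solution $u=H_\epsilon(p)^{-1}(0,U)$ in $L^2\times L^2$. (2) For all $\epsilon>0$ and $t\ge0$ all the $\xi$-integrals above converge absolutely, and $$\dot P(t)=\rho_0\,\Re\Big\langle\begin{pmatrix}\nabla U\\0\end{pmatrix},H_\epsilon^{-1}(t)\begin{pmatrix}0\\U\end{pmatrix}\Big\rangle+R_1+R_2+R_3+R_4+E_{1,\epsilon}+E_{2,\epsilon}.$$ (3) If moreover $W$ is radial, there is a function $\Lambda:\mathbb R\to\mathbb R$, depending only on $n$ and $W$, such that: $\Lambda=0$ on $(-\infty,1]$; for every $K$ there is $C_0>0$ with $\Lambda(r)\ge C_0(r-1)$ for $1<r\le K$; $\Lambda(r)/(r-1)$ has a finite positive limit as $r\to1^+$; for each $k\in\mathbb N\cup\{\infty\}$, $\Lambda$ is $C^k$ on $\mathbb R\setminus\{1\}$ if $\widehat V$ is $C^k$ on $\mathbb R^5\setminus\{0\}$; for all $p\in\mathbb R^5$ and all $\rho_0\ge0$ $$\lim_{\epsilon\to0^+}\rho_0\,\Re\Big\langle\begin{pmatrix}\nabla U\\0\end{pmatrix},H_\epsilon(p)^{-1}\begin{pmatrix}0\\U\end{pmatrix}\Big\rangle=-\rho_0\Lambda(|p|)(|p|-1)^{3+2n}\frac{p}{|p|}1_{\{|p|>1\}};$$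 and for every solution as above, all $t\ge0$ and all $\epsilon>0$, $$\dot P(t)=-\rho_0\Lambda(|P(t)|)(|P(t)|-1)^{3+2n}\frac{P(t)}{|P(t)|}1_{\{|P(t)|>1\}}+R_1+R_2+R_3+R_4+E_{1,\epsilon}+E_{2,\epsilon}+R_\epsilon,$$ where $$R_\epsilon=\rho_0\Lambda(|P(t)|)(|P(t)|-1)^{3+2n}\frac{P(t)}{|P(t)|}1_{\{|P(t)|>1\}}+\rho_0\,\Re\Big\langle\begin{pmatrix}\nabla U\\0\end{pmatrix},H_\epsilon^{-1}(t)\begin{pmatrix}0\\U\end{pmatrix}\Big\rangle\longrightarrow0\quad(\epsilon\to0^+).$$ -/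

import Mathlib

open scoped SchwartzMap Laplacian LineDeriv FourierTransform ENNReal ComplexConjugate

noncomputable section

namespace ParticleBose

open MeasureTheory Filter Topology

/-- The physical space `ℝ⁵` (also the space of frequencies). -/
abbrev E5 : Type := EuclideanSpace ℝ (Fin 5)

/-! ### Functions, tempered distributions, Fourier transform, function spaces -/

/-- The function `f` is (integrable against every Schwartz function and) a representative of the
tempered distribution `u`. -/
def Represents (u : 𝓢'(E5, ℂ)) (f : E5 → ℂ) : Prop :=
  ∀ ψ : 𝓢(E5, ℂ), Integrable (fun x => ψ x * f x) ∧ u ψ = ∫ x, ψ x * f x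

/-- Fourier transform of an integrable function, with the convention
`f̂(ξ) = ∫ exp(- i x · ξ) f(x) dx`. -/
def FT (f : E5 → ℝ) (ξ : E5) : ℂ :=
  ∫ x, Complex.exp (-(Complex.I * (inner ℝ x ξ : ℝ))) * (f x : ℂ)

/-- The function `g` is the Fourier transform of the tempered function `f`, for the convention
`f̂(ξ) = ∫ exp(- i x · ξ) f(x) dx`, in the sense of tempered distributions. Mathlib's `𝓕` has the
kernel `exp(- 2 π i x · ξ)`, whence the dilation. -/
def IsFourier (f g : E5 → ℂ) : Prop :=
  ∃ u : 𝓢'(E5, ℂ), Represents u f ∧ Represents (𝓕 u) (fun ξ => g ((2 * Real.pi) • ξ))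

open Classical in
/-- The Fourier transform of a tempered function whose Fourier transform is a function;
it is determined almost everywhere. -/
def hat (f : E5 → ℂ) : E5 → ℂ :=
  if h : ∃ g, IsFourier f g then h.choose else 0

/-- The Sobolev space `H^s`, `s` real. -/
def MemH (s : ℝ) (f : E5 → ℂ) : Prop :=
  ∃ u : 𝓢'(E5, ℂ), Represents u f ∧ TemperedDistribution.MemSobolev s 2 u

/-- The homogeneous Sobolev space `Ḣ¹`: tempered functions whose Fourier transform is a locally
integrable function `g` with `|ξ| g ∈ L²`. -/
def MemHdot1 (f : E5 → ℂ) : Prop :=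
  ∃ g, IsFourier f g ∧ LocallyIntegrable g ∧ MemLp (fun ξ => (‖ξ‖ : ℂ) * g ξ) 2

/-- The standard basis vectors of `ℝ⁵`. -/
def basisVec (j : Fin 5) : E5 := EuclideanSpace.single j 1

/-- The Sobolev space `W^{k,p}`, `k` a natural number, through distributional derivatives. -/
def MemW (p : ℝ≥0∞) [Fact (1 ≤ p)] : ℕ → 𝓢'(E5, ℂ) → Prop
  | 0, u => ∃ f : Lp ℂ p (volume : Measure E5), u = f
  | k + 1, u => (∃ f : Lp ℂ p (volume : Measure E5), u = f) ∧
      ∀ j : Fin 5, MemW p k (∂_{basisVec j} u)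

/-- The energy space: `Re f ∈ H¹` and `Im f ∈ Ḣ¹`. -/
def MemEnergy (f : E5 → ℂ) : Prop :=
  MemH 1 (fun x => ((f x).re : ℂ)) ∧ MemHdot1 (fun x => ((f x).im : ℂ))

/-- The norm `‖Re f‖_{H¹} + ‖Im f‖_{Ḣ¹}` of the energy space, computed in Fourier space
(up to the constant factor of Plancherel's theorem). -/
def energyNorm (f : E5 → ℂ) : ℝ≥0∞ :=
  eLpNorm (fun ξ => (Real.sqrt (1 + ‖ξ‖ ^ 2) : ℂ) * hat (fun x => ((f x).re : ℂ)) ξ) 2 volume +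
  eLpNorm (fun ξ => (‖ξ‖ : ℂ) * hat (fun x => ((f x).im : ℂ)) ξ) 2 volume

/-! ### Potentials and solutions -/

/-- `W = (-Δ)ⁿ V` belongs to the class of admissible potentials: `|V̂(0)| = 1`, `W ∈ W^{4,1}`,
`(1 + |x|⁴) V ∈ H^{4n+4}`, `W ∈ H⁴`. As `H⁴(ℝ⁵) ⊆ C¹`, the function `W` is taken to be the `C¹`
representative of its class. -/
structure IsPotential (n : ℝ) (V W : E5 → ℝ) : Prop where
  contDiff : ContDiff ℝ 1 W
  fourier_eq : ∀ ξ, FT W ξ = ((‖ξ‖ ^ (2 * n) : ℝ) : ℂ) * FT V ξ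
  normalized : ‖FT V 0‖ = 1
  memW41 : ∃ u : 𝓢'(E5, ℂ), Represents u (fun x => (W x : ℂ)) ∧ MemW 1 4 u
  weighted : MemH (4 * n + 4) (fun x => (((1 + ‖x‖ ^ 4) * V x : ℝ) : ℂ))
  memH4 : MemH 4 (fun x => (W x : ℂ))

/-- `W^X(x) = W(X - x)`. In particular `shifted W 0` is the reflected potential `x ↦ W(-x)`. -/
def shifted (W : E5 → ℝ) (X : E5) : E5 → ℝ := fun x => W (X - x)

/-- Classical partial derivative. -/
def pderiv (j : Fin 5) (f : E5 → ℝ) (x : E5) : ℝ := fderiv ℝ f x (basisVec j)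

/-- `(X, P, β)` is a global solution, continuous in time with values in `ℝ⁵ × ℝ⁵ ×` energy space, of
`i ∂ₜβ = -Δβ + Re β + √ρ₀ W^{X(t)}`, `Ẋ = P`, `Ṗ = √ρ₀ Re ⟨∇ₓ W^{X(t)}, β⟩`;
the field equation holds in the sense of (tempered) distributions in `x`. -/
structure IsSolution (ρ₀ : ℝ) (W : E5 → ℝ) (X P : ℝ → E5) (β : ℝ → E5 → ℂ) : Prop where
  energy : ∀ t, 0 ≤ t → MemEnergy (β t)
  continuous_energy : ∀ t, 0 ≤ t →
    Tendsto (fun s => energyNorm (fun x => β s x - β t x)) (𝓝[Set.Ici 0] t) (𝓝 0)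
  deriv_X : ∀ t, 0 ≤ t → HasDerivWithinAt X (P t) (Set.Ici 0) t
  deriv_P : ∀ t, 0 ≤ t → HasDerivWithinAt P
    (Real.sqrt ρ₀ •
      (WithLp.toLp 2 fun j => ∫ x, pderiv j (shifted W (X t)) x * (β t x).re : E5))
    (Set.Ici 0) t
  field : ∀ ψ : 𝓢(E5, ℂ), ∀ t, 0 ≤ t →
    HasDerivWithinAt (fun s => ∫ x, ψ x * β s x)
      (-Complex.I * (-(∫ x, (Δ ψ) x * β t x) + (∫ x, ψ x * ((β t x).re : ℂ)) +
        (Real.sqrt ρ₀ : ℂ) * ∫ x, ψ x * (shifted W (X t) x : ℂ)))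
      (Set.Ici 0) t

/-! ### The operator `H_ε` and the friction term -/

/-- The operator `H_ε = [[p·∇ - ε, -Δ], [Δ - 1, p·∇ - ε]]` on pairs of tempered distributions. -/
def Heps (ε : ℝ) (p : E5) (u : Fin 2 → 𝓢'(E5, ℂ)) : Fin 2 → 𝓢'(E5, ℂ) :=
  ![∂_{p} (u 0) - (ε : ℂ) • u 0 - Δ (u 1),
    Δ (u 0) - u 0 + ∂_{p} (u 1) - (ε : ℂ) • u 1]

/-- `u ∈ L² × L²` and `H_ε u = f`. -/
def IsHepsInv (ε : ℝ) (p : E5) (f u : Fin 2 → E5 → ℂ) : Prop :=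
  (∀ k, MemLp (u k) 2) ∧
  ∃ U F : Fin 2 → 𝓢'(E5, ℂ), (∀ k, Represents (U k) (u k)) ∧ (∀ k, Represents (F k) (f k)) ∧
    Heps ε p U = F

open Classical in
/-- `H_ε⁻¹ f`, the (almost everywhere unique) `u ∈ L² × L²` with `H_ε u = f`. -/
def HepsInv (ε : ℝ) (p : E5) (f : Fin 2 → E5 → ℂ) : Fin 2 → E5 → ℂ :=
  if h : ∃ u, IsHepsInv ε p f u then h.choose else 0

/-- The inner product `Re ∫ f̄ · g` of two pairs of functions. -/
def pairInner (f g : Fin 2 → E5 → ℂ) : ℝ :=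
  (∫ x, ∑ k, conj (f k x) * g k x).re

/-- The pair `(0, f)`. -/
def secondOnly (f : E5 → ℝ) : Fin 2 → E5 → ℂ := ![0, fun x => (f x : ℂ)]

/-- The friction term `ρ₀ Re ⟨(∇U, 0), H_ε⁻¹ (0, U)⟩`, where `p` is the velocity in `H_ε`. -/
def friction (ρ₀ : ℝ) (U : E5 → ℝ) (ε : ℝ) (p : E5) : E5 :=
  ρ₀ • WithLp.toLp 2 fun j =>
    pairInner ![fun x => (pderiv j U x : ℂ), 0] (HepsInv ε p (secondOnly U))

/-! ### The remainders and the regularization terms -/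

/-- `φ₁(ξ) = |ξ| √(1 + |ξ|²)`. -/
def phi1 (ξ : E5) : ℝ := ‖ξ‖ * Real.sqrt (1 + ‖ξ‖ ^ 2)

/-- `exp(σ i t φ₁(ξ) + i (X(t) - X(0)) · ξ)`. Here and below `σ = 1` for the quantities with
lower index `1` and `σ = -1` for those with lower index `2`. -/
def osc (X : ℝ → E5) (t σ : ℝ) (ξ : E5) : ℂ :=
  Complex.exp (Complex.I * ((σ * t * phi1 ξ + inner ℝ (X t - X 0) ξ : ℝ) : ℂ))

/-- `σ i φ₁(ξ) + i P(t) · ξ - ε`. -/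
def den (P : ℝ → E5) (ε t σ : ℝ) (ξ : E5) : ℂ :=
  Complex.I * ((σ * phi1 ξ + inner ℝ (P t) ξ : ℝ) : ℂ) - (ε : ℂ)

/-- The acceleration, at times `t ≥ 0`. -/
def accel (P : ℝ → E5) (t : ℝ) : E5 := derivWithin P (Set.Ici 0) t

def D1 (X P : ℝ → E5) (ε t σ : ℝ) (ξ : E5) : ℂ :=
  Complex.I * ((σ * phi1 ξ + inner ℝ (P 0) ξ : ℝ) : ℂ) * osc X t σ ξ / den P ε t σ ξ

def DE1 (X P : ℝ → E5) (ε t σ : ℝ) (ξ : E5) : ℂ :=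
  -(ε : ℂ) * (osc X t σ ξ / den P ε t σ ξ)

def D2 (X P : ℝ → E5) (ε t σ : ℝ) (ξ : E5) : ℂ :=
  osc X t σ ξ / den P ε t σ ξ *
    (Complex.I * ((∫ s in (0 : ℝ)..t, inner ℝ (accel P s) ξ : ℝ) : ℂ))

def D3 (X P : ℝ → E5) (ε t σ : ℝ) (ξ : E5) : ℂ :=
  osc X t σ ξ / den P ε t σ ξ *
    (Complex.I * ∫ s in (0 : ℝ)..t, ∫ τ in (0 : ℝ)..s,
      ((inner ℝ (accel P s) ξ : ℝ) : ℂ) *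
        Complex.exp (-(Complex.I * ((σ * τ * phi1 ξ + inner ℝ (X τ - X 0) ξ : ℝ) : ℂ))))

def D4 (X P : ℝ → E5) (ε t σ : ℝ) (ξ : E5) : ℂ :=
  osc X t σ ξ / den P ε t σ ξ

def DE2 (X P : ℝ → E5) (ε t σ : ℝ) (ξ : E5) : ℂ :=
  -(ε : ℂ) * ((∫ s in (0 : ℝ)..t,
    Complex.exp (Complex.I * ((inner ℝ (X t - X s) ξ + σ * (t - s) * phi1 ξ : ℝ) : ℂ))) /
      den P ε t σ ξ)

/-- `a D₁ + b |ξ| / (i √(1+|ξ|²)) D₁ + a D₂ - b |ξ| / (i √(1+|ξ|²)) D₂`. -/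
def combine (a b : E5 → ℂ) (D : ℝ → E5 → ℂ) (ξ : E5) : ℂ :=
  a ξ * D 1 ξ + b ξ * (‖ξ‖ : ℂ) / (Complex.I * (Real.sqrt (1 + ‖ξ‖ ^ 2) : ℂ)) * D 1 ξ +
  a ξ * D (-1) ξ - b ξ * (‖ξ‖ : ℂ) / (Complex.I * (Real.sqrt (1 + ‖ξ‖ ^ 2) : ℂ)) * D (-1) ξ

/-- The integrand of `⟨i ξ_j Û, G⟩`. -/
def bracketFun (U : E5 → ℝ) (G : E5 → ℂ) (j : Fin 5) (ξ : E5) : ℂ :=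
  conj (Complex.I * (ξ j : ℂ) * FT U ξ) * G ξ

/-- The vector of the `Re ⟨i ξ_j Û, G⟩`, `j = 1, …, 5`. -/
def bracket (U : E5 → ℝ) (G : E5 → ℂ) : E5 :=
  WithLp.toLp 2 fun j => (∫ ξ, bracketFun U G j ξ).re

/-- The two real components of the initial field, in the frame of the particle. -/
def reField0 (X : ℝ → E5) (β : ℝ → E5 → ℂ) (y : E5) : ℂ := ((β 0 (y + X 0)).re : ℂ)

def imField0 (X : ℝ → E5) (β : ℝ → E5 → ℂ) (y : E5) : ℂ := ((β 0 (y + X 0)).im : ℂ)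

/-- The functions of `ξ` on the right of the brackets in `R₁`, `R₂`, `R₃`, `R₄`, `E₁`, `E₂`;
`U` is the reflected potential. -/
def gR1 (X P : ℝ → E5) (β : ℝ → E5 → ℂ) (ε t : ℝ) : E5 → ℂ :=
  combine (hat (reField0 X β)) (hat (imField0 X β)) (D1 X P ε t)

def gE1 (X P : ℝ → E5) (β : ℝ → E5 → ℂ) (ε t : ℝ) : E5 → ℂ :=
  combine (hat (reField0 X β)) (hat (imField0 X β)) (DE1 X P ε t)

def gR2 (X P : ℝ → E5) (β : ℝ → E5 → ℂ) (ε t : ℝ) : E5 → ℂ :=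
  combine (hat (reField0 X β)) (hat (imField0 X β)) (D2 X P ε t)

def gR3 (U : E5 → ℝ) (X P : ℝ → E5) (ε t : ℝ) : E5 → ℂ := combine 0 (FT U) (D3 X P ε t)

def gR4 (U : E5 → ℝ) (X P : ℝ → E5) (ε t : ℝ) : E5 → ℂ := combine 0 (FT U) (D4 X P ε t)

def gE2 (U : E5 → ℝ) (X P : ℝ → E5) (ε t : ℝ) : E5 → ℂ := combine 0 (FT U) (DE2 X P ε t)

def R1 (ρ₀ : ℝ) (U : E5 → ℝ) (X P : ℝ → E5) (β : ℝ → E5 → ℂ) (ε t : ℝ) : E5 :=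
  (Real.sqrt ρ₀ / (2 * (2 * Real.pi) ^ 5)) • bracket U (gR1 X P β ε t)

def E1 (ρ₀ : ℝ) (U : E5 → ℝ) (X P : ℝ → E5) (β : ℝ → E5 → ℂ) (ε t : ℝ) : E5 :=
  (Real.sqrt ρ₀ / (2 * (2 * Real.pi) ^ 5)) • bracket U (gE1 X P β ε t)

def R2 (ρ₀ : ℝ) (U : E5 → ℝ) (X P : ℝ → E5) (β : ℝ → E5 → ℂ) (ε t : ℝ) : E5 :=
  (Real.sqrt ρ₀ / (2 * (2 * Real.pi) ^ 5)) • bracket U (gR2 X P β ε t)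

def R3 (ρ₀ : ℝ) (U : E5 → ℝ) (X P : ℝ → E5) (ε t : ℝ) : E5 :=
  -(ρ₀ / (2 * (2 * Real.pi) ^ 5)) • bracket U (gR3 U X P ε t)

def R4 (ρ₀ : ℝ) (U : E5 → ℝ) (X P : ℝ → E5) (ε t : ℝ) : E5 :=
  -(ρ₀ / (2 * (2 * Real.pi) ^ 5)) • bracket U (gR4 U X P ε t)

def E2 (ρ₀ : ℝ) (U : E5 → ℝ) (X P : ℝ → E5) (ε t : ℝ) : E5 :=
  -(ρ₀ / (2 * (2 * Real.pi) ^ 5)) • bracket U (gE2 U X P ε t)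

/-- `Λ(|p|) (|p| - 1)^{3+2n} (p / |p|) 1_{|p| > 1}`. -/
def golden (Λ : ℝ → ℝ) (n : ℝ) (p : E5) : E5 :=
  Set.indicator {q : E5 | 1 < ‖q‖}
    (fun q => (Λ ‖q‖ * (‖q‖ - 1) ^ (3 + 2 * n)) • (‖q‖⁻¹ • q)) p

/-- `R_ε`: friction term plus `ρ₀ Λ(|p|) (|p| - 1)^{3+2n} (p / |p|) 1_{|p| > 1}`. -/
def Reps (ρ₀ : ℝ) (U : E5 → ℝ) (Λ : ℝ → ℝ) (n ε : ℝ) (p : E5) : E5 :=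
  ρ₀ • golden Λ n p + friction ρ₀ U ε p

end ParticleBose

end

noncomputable section

namespace ParticleBose

open MeasureTheory Filter Topology

/-! ### Representatives of tempered distributions -/

/-! Everything becomes algebra in Fourier variables. The symbol of `H_ε(p)` is a 2×2 matrix with
determinant `(ip·ξ - ε)² + φ₁²`, which factors as `(i(φ₁ + p·ξ) - ε)(i(-φ₁ + p·ξ) - ε)` and so has
no zero for `ε > 0`. Cramer's rule gives the only possible solution, and the multipliers are bounded
by `1/ε`, so it lies in L² (`heps_iff`, `IsHepsInv.isFourier`, `memLp_hepsHat`).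

For the equation of motion, put `r = |ξ|/⟨ξ⟩`. The combinations `Re β̂ - iσ r Im β̂`, `σ = ±1`,
diagonalize the free field: each rotates with phase `e^{iσtφ₁}`, and the particle enters as a source
(`duhamel`). The force pairs `Re β̂`, half the sum of the two combinations, with the potential. The
phase of the initial data is split by writing `1` as the denominator `iσφ₁ + iP(t)·ξ - ε` over
itself, which yields `D1`, `D2` and `DE1`. The time integral of the source phase is integrated by
parts (`D3_eq`): the endpoint `s = t` produces `-1/(iσφ₁ + iP(t)·ξ - ε)`, and the two signs together
reassemble the resolvent of `H_ε(P(t))` (`friction_eq_branch`). The rest is `D3`, `D4` and `DE2`.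
The field equation is only known weakly and in the energy space, so the differentiation in time is
done for suitably weighted curves in L² (`duhamel_curves`).

For radial `W` the friction integral is rotated to the axis of `p` and pushed forward to the two
variables `x = ξ₀`, `r = |ξ|`, whose joint density is a constant times `r(r² - x²)` on `|x| < r`
(`map_axis`). There the kernel is a difference of two Cauchy densities of width `ε/|p|` centred at
`x = ±φ₁/|p|` (`axis_kernel`). As `ε → 0` they become point masses on the resonance `|p| x =
±φ₁(r)`. It meets `|x| < r` exactly when `√(1+r²) < |p|`, hence only for speeds above 1. What
remains is the integral of `r⁵ |Û|² (|p|² - 1 - r²)` over `0 < r < √(|p|² - 1)`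
(`tendsto_axis_integral`). Scaling `r = √(|p|² - 1) u` extracts the power `(|p|² - 1)^{4+2n}`, one
factor `|p| - 1` of which is put into `Λ`; the other factors of `Λ` are continuous and positive
because `|V̂(0)| = 1`. -/

lemma exists_schwartz_eq_one (R : ℝ) : ∃ ψ : 𝓢(E5, ℂ), ∀ x ∈ Metric.closedBall (0 : E5) R, ψ x = 1 := by
  let b : ContDiffBump (0 : E5) := ⟨max R 1, max R 1 + 1, by positivity, by linarith⟩
  have h1 : HasCompactSupport (Complex.ofRealCLM ∘ b) := b.hasCompactSupport.comp_left rfl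
  have h2 : ContDiff ℝ (⊤ : ℕ∞) (Complex.ofRealCLM ∘ b) := by
    have := b.contDiff (n := (⊤ : ℕ∞))
    fun_prop
  refine ⟨h1.toSchwartzMap h2, fun x hx => ?_⟩
  have : b x = 1 := b.one_of_mem_closedBall
    (Metric.closedBall_subset_closedBall (le_max_left _ _) hx)
  simp [this]

lemma locallyIntegrable_of_schwartz {f : E5 → ℂ}
    (h : ∀ ψ : 𝓢(E5, ℂ), Integrable (fun x => ψ x * f x)) : LocallyIntegrable f := by
  refine (locallyIntegrable_iff).2 fun K hK => ?_
  obtain ⟨R, hR⟩ := hK.isBounded.subset_closedBall (0 : E5)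
  obtain ⟨ψ, hψ⟩ := exists_schwartz_eq_one R
  have : IntegrableOn f (Metric.closedBall 0 R) := by
    refine ((h ψ).integrableOn).congr_fun (fun x hx => ?_) measurableSet_closedBall
    simp [hψ x hx]
  exact this.mono_set hR

/-- Compactly supported smooth functions are Schwartz and already separate locally integrable
functions; a cutoff equal to 1 on a ball supplies the local integrability. -/
lemma ae_eq_of_schwartz {f g : E5 → ℂ}
    (hf : ∀ ψ : 𝓢(E5, ℂ), Integrable (fun x => ψ x * f x))
    (hg : ∀ ψ : 𝓢(E5, ℂ), Integrable (fun x => ψ x * g x))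
    (h : ∀ ψ : 𝓢(E5, ℂ), ∫ x, ψ x * f x = ∫ x, ψ x * g x) : f =ᵐ[volume] g := by
  refine ae_eq_of_integral_contDiff_smul_eq (locallyIntegrable_of_schwartz hf)
    (locallyIntegrable_of_schwartz hg) fun φ h1 h2 => ?_
  have h3 : HasCompactSupport (Complex.ofRealCLM ∘ φ) := h2.comp_left rfl
  have h4 : ContDiff ℝ (⊤ : ℕ∞) (Complex.ofRealCLM ∘ φ) := by fun_prop
  simpa using h (h3.toSchwartzMap h4)

namespace Represents

variable {u v : 𝓢'(E5, ℂ)} {f g : E5 → ℂ}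

lemma congr_ae (h : Represents u f) (hfg : f =ᵐ[volume] g) : Represents u g := fun ψ => by
  have : (fun x => ψ x * f x) =ᵐ[volume] fun x => ψ x * g x := by
    filter_upwards [hfg] with x hx
    rw [hx]
  exact ⟨(h ψ).1.congr this, by rw [(h ψ).2, integral_congr_ae this]⟩

lemma add (h : Represents u f) (h' : Represents v g) : Represents (u + v) (fun x => f x + g x) :=
  fun ψ => by
    simp only [mul_add]
    refine ⟨(h ψ).1.add (h' ψ).1, ?_⟩
    rw [integral_add (h ψ).1 (h' ψ).1, ← (h ψ).2, ← (h' ψ).2]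
    rfl

lemma const_smul (c : ℂ) (h : Represents u f) : Represents (c • u) (fun x => c * f x) :=
  fun ψ => by
    simp only [mul_left_comm _ c]
    refine ⟨(h ψ).1.const_mul c, ?_⟩
    rw [integral_const_mul, ← (h ψ).2]
    rfl

end Represents

lemma represents_zero : Represents 0 (0 : E5 → ℂ) := fun ψ => by simp

lemma represents_Lp {p : ℝ≥0∞} [hp : Fact (1 ≤ p)] (f : Lp ℂ p (volume : Measure E5)) :
    Represents (f : 𝓢'(E5, ℂ)) f := fun ψ => by
  refine ⟨?_, by simp⟩
  -- This form of the conjugate exponent also covers `p = 1` and `p = ∞`.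
  have : ENNReal.HolderConjugate (1 - p⁻¹)⁻¹ p :=
    (ENNReal.HolderConjugate.inv_one_sub_inv' hp.out).symm
  exact MemLp.integrable_mul (p := (1 - p⁻¹)⁻¹) (q := p) (ψ.memLp _) (Lp.memLp f)

lemma represents_of_memLp {p : ℝ≥0∞} [Fact (1 ≤ p)] {f : E5 → ℂ} (hf : MemLp f p) :
    Represents (hf.toLp f : 𝓢'(E5, ℂ)) f :=
  (represents_Lp _).congr_ae hf.coeFn_toLp

lemma represents_smulLeft {u : 𝓢'(E5, ℂ)} {f m : E5 → ℂ} (h : Represents u f)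
    (hm : m.HasTemperateGrowth) :
    Represents (TemperedDistribution.smulLeftCLM ℂ m u) (fun x => m x * f x) := fun ψ => by
  have h1 := h (SchwartzMap.smulLeftCLM ℂ m ψ)
  have h2 : ∀ x, (SchwartzMap.smulLeftCLM ℂ m ψ) x * f x = ψ x * (m x * f x) := fun x => by
    rw [SchwartzMap.smulLeftCLM_apply_apply hm, smul_eq_mul]; ring
  simp only [h2] at h1
  exact ⟨h1.1, h1.2⟩

/-! ### The Fourier transform of Schwartz functions with kernel `exp(- i x · ξ)` -/

lemma two_pi_ne : (2 * Real.pi : ℝ) ≠ 0 := by positivity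

/-- The dilation by `2π`. -/
def dil : E5 ≃L[ℝ] E5 := ContinuousLinearEquiv.smulLeft (Units.mk0 (2 * Real.pi) two_pi_ne)

@[simp] lemma dil_apply (x : E5) : dil x = (2 * Real.pi) • x := rfl

lemma integral_dil (f : E5 → ℂ) :
    ∫ x, f x = ((2 * Real.pi) ^ 5 : ℂ) * ∫ x, f ((2 * Real.pi) • x) := by
  rw [Measure.integral_comp_smul]
  have h1 : (0 : ℝ) < (2 * Real.pi) ^ 5 := by positivity
  simp only [finrank_euclideanSpace, Fintype.card_fin]
  rw [abs_of_pos (by positivity), Complex.real_smul, ← mul_assoc]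
  push_cast
  rw [mul_inv_cancel₀, one_mul]
  exact_mod_cast h1.ne'

/-- The Schwartz function `x ↦ ∫ exp(- i x · ξ) χ(ξ) dξ`. -/
def FS : 𝓢(E5, ℂ) →ₗ[ℂ] 𝓢(E5, ℂ) where
  toFun χ := ((2 * Real.pi) ^ 5 : ℂ) • 𝓕 (SchwartzMap.compCLMOfContinuousLinearEquiv ℂ dil χ)
  map_add' χ η := by rw [map_add, FourierTransform.fourier_add, smul_add]
  map_smul' c χ := by
    rw [map_smul, FourierTransform.fourier_smul, smul_comm]; rfl

lemma FS_apply (χ : 𝓢(E5, ℂ)) :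
    FS χ = ((2 * Real.pi) ^ 5 : ℂ) • 𝓕 (SchwartzMap.compCLMOfContinuousLinearEquiv ℂ dil χ) := rfl

/-- Thanks to this, testing against all `FS χ` is testing against all Schwartz functions, so
identities of distributions can be checked on the Fourier side. -/
lemma FS_surjective : Function.Surjective FS := fun ψ => by
  refine ⟨((2 * Real.pi) ^ 5 : ℂ)⁻¹ •
    SchwartzMap.compCLMOfContinuousLinearEquiv ℂ dil.symm (𝓕⁻ ψ), ?_⟩
  have h : SchwartzMap.compCLMOfContinuousLinearEquiv ℂ dil
      (SchwartzMap.compCLMOfContinuousLinearEquiv ℂ dil.symm (𝓕⁻ ψ)) = 𝓕⁻ ψ := by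
    ext x; simp only [SchwartzMap.compCLMOfContinuousLinearEquiv_apply, Function.comp_apply, ContinuousLinearEquiv.symm_apply_apply]
  rw [map_smul, FS_apply, h, FourierTransform.fourier_fourierInv_eq, smul_smul,
    inv_mul_cancel₀, one_smul]
  have : (2 * Real.pi : ℝ) ^ 5 ≠ 0 := by positivity
  exact_mod_cast this

lemma lineDeriv_FS (χ : 𝓢(E5, ℂ)) (m : E5) :
    ∂_{m} (FS χ) =
      FS (SchwartzMap.smulLeftCLM ℂ (fun ξ => -(Complex.I * (inner ℝ ξ m : ℝ))) χ) := by
  have h1 : (fun x : E5 => (inner ℝ x m : ℝ)).HasTemperateGrowth := by fun_prop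
  have h2 : (fun ξ : E5 => -(Complex.I * ((inner ℝ ξ m : ℝ) : ℂ))).HasTemperateGrowth := by fun_prop
  rw [FS_apply, LineDeriv.lineDerivOp_smul, SchwartzMap.lineDerivOp_fourier_eq, FS_apply]
  congr 2
  ext x
  simp only [SchwartzMap.compCLMOfContinuousLinearEquiv_apply, Function.comp_apply,
    SchwartzMap.smulLeftCLM_apply_apply h2, smul_apply,
    SchwartzMap.smulLeftCLM_apply_apply h1, dil_apply, inner_smul_left]
  simp
  ring

lemma laplacian_FS (χ : 𝓢(E5, ℂ)) :
    Δ (FS χ) = FS (SchwartzMap.smulLeftCLM ℂ (fun ξ => -((‖ξ‖ ^ 2 : ℝ) : ℂ)) χ) := by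
  have h3 : (fun ξ : E5 => -((‖ξ‖ ^ 2 : ℝ) : ℂ)).HasTemperateGrowth := by fun_prop
  have e : ∀ (i : Fin 5) (η : 𝓢(E5, ℂ)) (x : E5), (SchwartzMap.smulLeftCLM ℂ
      (fun ξ : E5 => -(Complex.I * ((inner ℝ ξ (EuclideanSpace.basisFun (Fin 5) ℝ i) : ℝ) : ℂ))) η) x
        = -(Complex.I * (x i : ℂ)) * η x := fun i η x => by
    rw [SchwartzMap.smulLeftCLM_apply_apply (by fun_prop)]
    simp [EuclideanSpace.inner_single_right]
  rw [SchwartzMap.laplacian_eq_sum (EuclideanSpace.basisFun (Fin 5) ℝ)]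
  simp only [lineDeriv_FS, ← map_sum]
  congr 1
  ext x
  rw [SchwartzMap.smulLeftCLM_apply_apply h3]
  simp only [Fin.sum_univ_five, add_apply, e, EuclideanSpace.norm_sq_eq]
  simp
  linear_combination ((x 0)^2 + (x 1)^2 + (x 2)^2 + (x 3)^2 + (x 4)^2 : ℂ) * χ x * Complex.I_sq

/-! ### Functions with a Fourier transform that is a function -/

lemma integrable_dil_iff {f : E5 → ℂ} :
    Integrable (fun x => f ((2 * Real.pi) • x)) ↔ Integrable f :=
  integrable_comp_smul_iff volume f two_pi_ne

lemma tendsto_ae_smul {c : ℝ} (hc : c ≠ 0) :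
    Tendsto (fun x : E5 => c • x) (ae volume) (ae volume) := by
  have : Measure.QuasiMeasurePreserving (fun x : E5 => c • x) volume volume := by
    refine ⟨measurable_const_smul c, ?_⟩
    rw [Measure.map_addHaar_smul _ hc]
    exact Measure.smul_absolutelyContinuous
  exact this.tendsto_ae

lemma ae_eq_of_dil {f g : E5 → ℂ}
    (h : (fun x => f ((2 * Real.pi) • x)) =ᵐ[volume] fun x => g ((2 * Real.pi) • x)) :
    f =ᵐ[volume] g := by
  filter_upwards [(tendsto_ae_smul (inv_ne_zero two_pi_ne)).eventually h] with x hx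
  simpa only [smul_smul, mul_inv_cancel₀ two_pi_ne, one_smul] using hx

lemma memLp_smul {f : E5 → ℂ} {c : ℝ} (hc : c ≠ 0) (hf : MemLp f 2) :
    MemLp (fun x => f (c • x)) 2 := by
  have h1 : MemLp f 2 (Measure.map (fun x : E5 => c • x) volume) := by
    rw [Measure.map_addHaar_smul _ hc]
    exact hf.smul_measure (by simp)
  exact (memLp_map_measure_iff h1.1 (measurable_const_smul c).aemeasurable).1 h1

namespace IsFourier

variable {f f' g g' : E5 → ℂ}

lemma integrable_left (h : IsFourier f g) (ψ : 𝓢(E5, ℂ)) : Integrable (fun x => ψ x * f x) := by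
  obtain ⟨u, hu, -⟩ := h
  exact (hu ψ).1

lemma integrable_right (h : IsFourier f g) (χ : 𝓢(E5, ℂ)) : Integrable (fun x => χ x * g x) := by
  obtain ⟨u, -, hu⟩ := h
  have := (hu (SchwartzMap.compCLMOfContinuousLinearEquiv ℂ dil χ)).1
  exact (integrable_dil_iff (f := fun x => χ x * g x)).1 this

lemma integral_eq (h : IsFourier f g) (χ : 𝓢(E5, ℂ)) : ∫ x, χ x * g x = ∫ x, FS χ x * f x := by
  obtain ⟨u, hu, hu'⟩ := h
  have h1 := (hu' (SchwartzMap.compCLMOfContinuousLinearEquiv ℂ dil χ)).2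
  have h2 := (hu (FS χ)).2
  rw [FS_apply, map_smul, smul_eq_mul] at h2
  rw [TemperedDistribution.fourier_apply] at h1
  rw [FS_apply χ, ← h2, h1, integral_dil]
  rfl

/-- The dilation by `2π` in `IsFourier` is absorbed here once and for all; later only pairings with
`FS χ` occur. -/
lemma of_represents {u : 𝓢'(E5, ℂ)} (hu : Represents u f)
    (h : ∀ χ : 𝓢(E5, ℂ), Integrable (fun x => χ x * g x))
    (h' : ∀ χ : 𝓢(E5, ℂ), u (FS χ) = ∫ x, χ x * g x) : IsFourier f g := by
  refine ⟨u, hu, fun ψ => ?_⟩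
  set χ := SchwartzMap.compCLMOfContinuousLinearEquiv ℂ dil.symm ψ with hχ
  have h0 : SchwartzMap.compCLMOfContinuousLinearEquiv ℂ dil χ = ψ := by
    ext x; simp only [hχ, SchwartzMap.compCLMOfContinuousLinearEquiv_apply, Function.comp_apply,
      ContinuousLinearEquiv.symm_apply_apply]
  have h1 : ∀ x, χ ((2 * Real.pi) • x) = ψ x := fun x => by rw [← h0]; rfl
  have h2 : Integrable fun x => ψ x * g ((2 * Real.pi) • x) := by
    have := (integrable_dil_iff (f := fun x => χ x * g x)).2 (h χ)
    simpa only [h1] using this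
  refine ⟨h2, ?_⟩
  have h3 := h' χ
  rw [integral_dil, FS_apply, map_smul, h0, smul_eq_mul] at h3
  simp only [h1] at h3
  refine mul_left_cancel₀ ?_ h3
  have : (2 * Real.pi : ℝ) ^ 5 ≠ 0 := by positivity
  exact_mod_cast this

lemma represents_ne (h : IsFourier f g) : ∃ u, Represents u f := ⟨h.choose, h.choose_spec.1⟩

lemma congr_ae (h : IsFourier f g) (hf : f =ᵐ[volume] f') (hg : g =ᵐ[volume] g') :
    IsFourier f' g' := by
  obtain ⟨u, hu⟩ := h.represents_ne
  have e : ∀ χ : 𝓢(E5, ℂ), (fun x => χ x * g x) =ᵐ[volume] fun x => χ x * g' x := fun χ => by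
    filter_upwards [hg] with x hx
    rw [hx]
  refine of_represents (hu.congr_ae hf) (fun χ => (h.integrable_right χ).congr (e χ)) fun χ => ?_
  rw [(hu (FS χ)).2, ← h.integral_eq, integral_congr_ae (e χ)]

lemma unique (h : IsFourier f g) (h' : IsFourier f' g') (hf : f =ᵐ[volume] f') :
    g =ᵐ[volume] g' := by
  refine ae_eq_of_schwartz h.integrable_right h'.integrable_right fun χ => ?_
  rw [h.integral_eq, h'.integral_eq]
  refine integral_congr_ae ?_
  filter_upwards [hf] with x hx
  rw [hx]

lemma add (h : IsFourier f g) (h' : IsFourier f' g') :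
    IsFourier (fun x => f x + f' x) (fun x => g x + g' x) := by
  obtain ⟨u, hu⟩ := h.represents_ne
  obtain ⟨v, hv⟩ := h'.represents_ne
  refine of_represents (hu.add hv) (fun χ => ?_) fun χ => ?_
  · simp only [mul_add]
    exact (h.integrable_right χ).add (h'.integrable_right χ)
  · simp only [mul_add]
    rw [integral_add (h.integrable_right χ) (h'.integrable_right χ), h.integral_eq, h'.integral_eq,
      ← (hu _).2, ← (hv _).2]
    rfl

lemma const_mul (c : ℂ) (h : IsFourier f g) :
    IsFourier (fun x => c * f x) (fun x => c * g x) := by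
  obtain ⟨u, hu⟩ := h.represents_ne
  refine of_represents (hu.const_smul c) (fun χ => ?_) fun χ => ?_
  · simp only [mul_left_comm _ c]
    exact (h.integrable_right χ).const_mul c
  · simp only [mul_left_comm _ c]
    rw [integral_const_mul, h.integral_eq, ← (hu _).2]
    rfl

lemma sub (h : IsFourier f g) (h' : IsFourier f' g') :
    IsFourier (fun x => f x - f' x) (fun x => g x - g' x) := by
  have := h.add (h'.const_mul (-1))
  simpa [sub_eq_add_neg] using this

lemma aestronglyMeasurable_right (h : IsFourier f g) : AEStronglyMeasurable g volume :=
  (locallyIntegrable_of_schwartz h.integrable_right).aestronglyMeasurable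

lemma hat_spec (h : IsFourier f g) : IsFourier f (hat f) := by
  have : ∃ g, IsFourier f g := ⟨g, h⟩
  rw [hat, dif_pos this]
  exact this.choose_spec

lemma hat_ae (h : IsFourier f g) : hat f =ᵐ[volume] g := h.hat_spec.unique h (ae_eq_refl f)

end IsFourier

/-! ### Plancherel -/

lemma isFourier_Lp (f : Lp ℂ 2 (volume : Measure E5)) :
    IsFourier f (fun ξ => (𝓕 f : Lp ℂ 2 (volume : Measure E5)) ((2 * Real.pi)⁻¹ • ξ)) := by
  refine ⟨f, represents_Lp f, ?_⟩
  rw [Lp.fourier_toTemperedDistribution_eq]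
  simpa only [smul_smul, inv_mul_cancel₀ two_pi_ne, one_smul] using represents_Lp (𝓕 f)

lemma memLp_inv_dil {g : E5 → ℂ} (hg : MemLp g 2) :
    MemLp (fun ξ => g ((2 * Real.pi)⁻¹ • ξ)) 2 := memLp_smul (inv_ne_zero two_pi_ne) hg

lemma exists_isFourier_of_memLp {f : E5 → ℂ} (hf : MemLp f 2) :
    ∃ g, MemLp g 2 ∧ IsFourier f g :=
  ⟨_, memLp_inv_dil (Lp.memLp (𝓕 (hf.toLp f))),
    (isFourier_Lp (hf.toLp f)).congr_ae hf.coeFn_toLp (ae_eq_refl _)⟩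

lemma exists_isFourier_of_memLp_right {g : E5 → ℂ} (hg : MemLp g 2) :
    ∃ f, MemLp f 2 ∧ IsFourier f g := by
  have hg' := memLp_smul two_pi_ne hg
  refine ⟨(𝓕⁻ (hg'.toLp _) : Lp ℂ 2 (volume : Measure E5)), Lp.memLp _, ?_⟩
  refine (isFourier_Lp _).congr_ae (ae_eq_refl _) ?_
  rw [FourierTransform.fourier_fourierInv_eq]
  apply ae_eq_of_dil
  simp only [smul_smul, inv_mul_cancel₀ two_pi_ne, one_smul]
  exact hg'.coeFn_toLp

/-- Injectivity of the Fourier transform, from the surjectivity of its transpose `FS`. -/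
lemma IsFourier.unique_left {f f' g g' : E5 → ℂ} (h : IsFourier f g) (h' : IsFourier f' g')
    (hg : g =ᵐ[volume] g') : f =ᵐ[volume] f' := by
  refine ae_eq_of_schwartz h.integrable_left h'.integrable_left fun ψ => ?_
  obtain ⟨χ, rfl⟩ := FS_surjective ψ
  rw [← h.integral_eq, ← h'.integral_eq]
  refine integral_congr_ae ?_
  filter_upwards [hg] with x hx
  rw [hx]

lemma IsFourier.memLp_left {f g : E5 → ℂ} (h : IsFourier f g) (hg : MemLp g 2) : MemLp f 2 := by
  obtain ⟨f', hf', h'⟩ := exists_isFourier_of_memLp_right hg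
  exact (memLp_congr_ae (h.unique_left h' (ae_eq_refl _))).2 hf'

/-- Parseval's identity. -/
lemma IsFourier.parseval {f₁ f₂ g₁ g₂ : E5 → ℂ} (h₁ : IsFourier f₁ g₁) (h₂ : IsFourier f₂ g₂)
    (hf₁ : MemLp f₁ 2) (hf₂ : MemLp f₂ 2) :
    ∫ ξ, conj (g₁ ξ) * g₂ ξ = ((2 * Real.pi) ^ 5 : ℂ) * ∫ x, conj (f₁ x) * f₂ x := by
  have key : ∀ {f g : E5 → ℂ} (_ : IsFourier f g) (hf : MemLp f 2),
      (𝓕 (hf.toLp f) : Lp ℂ 2 (volume : Measure E5)) =ᵐ[volume]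
        fun ξ => g ((2 * Real.pi) • ξ) := fun {f g} h hf => by
    have h1 := h.unique (isFourier_Lp (hf.toLp f)) hf.coeFn_toLp.symm
    have h2 := (tendsto_ae_smul two_pi_ne).eventually h1
    filter_upwards [h2] with x hx
    simpa only [smul_smul, inv_mul_cancel₀ two_pi_ne, one_smul] using hx.symm
  have h := Lp.inner_fourier_eq (hf₁.toLp f₁) (hf₂.toLp f₂)
  rw [L2.inner_def, L2.inner_def] at h
  rw [integral_dil]
  congr 1
  convert h using 1
  · refine integral_congr_ae ?_
    filter_upwards [key h₁ hf₁, key h₂ hf₂] with x hx hy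
    rw [hx, hy]
    simp [mul_comm]
  · refine integral_congr_ae ?_
    filter_upwards [hf₁.coeFn_toLp, hf₂.coeFn_toLp] with x hx hy
    rw [hx, hy]
    simp [mul_comm]

/-- Every derivative of `x ↦ e^{ix}` on the line has modulus 1, and the character is its composition
with a linear form. -/
lemma hasTemperateGrowth_exp (c : E5) :
    (fun ξ : E5 => Complex.exp (Complex.I * (inner ℝ c ξ : ℝ))).HasTemperateGrowth := by
  have h : (fun x : ℝ => Complex.exp (Complex.I * x)).HasTemperateGrowth := by
    have h1 : ∀ n : ℕ, iteratedDeriv n (fun x : ℝ => Complex.exp (Complex.I * x)) =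
        fun x : ℝ => Complex.I ^ n * Complex.exp (Complex.I * x) := fun n => by
      induction n with
      | zero => simp
      | succ n ih =>
        rw [iteratedDeriv_succ, ih]
        ext x
        have h2 : HasDerivAt (fun x : ℝ => Complex.exp (Complex.I * x))
            (Complex.exp (Complex.I * x) * (Complex.I * 1)) x :=
          (((hasDerivAt_id (x : ℂ)).const_mul Complex.I).cexp).comp_ofReal
        rw [(h2.const_mul _).deriv]
        ring
    refine ⟨?_, fun n => ⟨0, 1, fun x => ?_⟩⟩
    · have : ContDiff ℝ (⊤ : ℕ∞) (fun x : ℝ => (x : ℂ)) := Complex.ofRealCLM.contDiff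
      fun_prop
    · rw [norm_iteratedFDeriv_eq_norm_iteratedDeriv, h1]
      simp [mul_comm Complex.I, Complex.norm_exp_ofReal_mul_I]
  exact h.comp (by fun_prop : (fun ξ : E5 => (inner ℝ c ξ : ℝ)).HasTemperateGrowth)

/-- Translations. -/
lemma IsFourier.translate {f g : E5 → ℂ} (h : IsFourier f g) (c : E5) :
    IsFourier (fun x => f (x + c)) (fun ξ => Complex.exp (Complex.I * (inner ℝ c ξ : ℝ)) * g ξ) := by
  obtain ⟨u, hu⟩ := h.represents_ne
  -- Duality: multiplying the test function by the character translates its transform, which moves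
  -- the translation from the distribution to `FS`.
  have ht : ∀ ψ : 𝓢(E5, ℂ), ∃ η : 𝓢(E5, ℂ),
      FS η = SchwartzMap.compSubConstCLM ℂ c (FS ψ) ∧
        ∀ ξ, η ξ = Complex.exp (Complex.I * (inner ℝ c ξ : ℝ)) * ψ ξ := by
    intro ψ
    refine ⟨SchwartzMap.smulLeftCLM ℂ _ ψ, ?_, fun ξ => by
      rw [SchwartzMap.smulLeftCLM_apply_apply (hasTemperateGrowth_exp c), smul_eq_mul]⟩
    ext x
    rw [SchwartzMap.compSubConstCLM_apply, FS_apply, FS_apply, smul_apply, smul_apply,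
      SchwartzMap.fourier_coe, SchwartzMap.fourier_coe, Real.fourier_eq, Real.fourier_eq]
    congr 1
    refine integral_congr_ae (ae_of_all _ fun v => ?_)
    simp only [SchwartzMap.compCLMOfContinuousLinearEquiv_apply, Function.comp_apply, dil_apply,
      SchwartzMap.smulLeftCLM_apply_apply (hasTemperateGrowth_exp c), smul_eq_mul,
      Circle.smul_def, Real.fourierChar_apply, ← mul_assoc, ← Complex.exp_add, inner_smul_right,
      inner_sub_right, real_inner_comm v]
    congr 2
    push_cast
    ring
  refine IsFourier.of_represents (u := PointwiseConvergenceCLM.precomp ℂ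
    (SchwartzMap.compSubConstCLM ℂ c) u) (fun ψ => ?_) (fun χ => ?_) fun χ => ?_
  · have h1 := hu (SchwartzMap.compSubConstCLM ℂ c ψ)
    simp only [SchwartzMap.compSubConstCLM_apply] at h1
    constructor
    · have := h1.1.comp_add_right c
      simpa using this
    · refine h1.2.trans ?_
      rw [← integral_add_right_eq_self _ c]
      simp
  · obtain ⟨η, -, hη⟩ := ht χ
    have := h.integrable_right η
    refine this.congr (ae_of_all _ fun ξ => ?_)
    simp only [hη]; ring
  · obtain ⟨η, hη, hη'⟩ := ht χ
    change u (SchwartzMap.compSubConstCLM ℂ c (FS χ)) = _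
    rw [← hη, (hu _).2, ← h.integral_eq]
    refine integral_congr_ae (ae_of_all _ fun ξ => ?_)
    simp only [hη']; ring

/-! ### Sobolev spaces in Fourier variables -/

/-- The Bessel weight never vanishes, so the transform is an L² function divided by it. The weight
is then compared with its dilate by `2π`. -/
lemma MemH.exists_isFourier {s : ℝ} (hs : 0 ≤ s) {f : E5 → ℂ} (h : MemH s f) :
    ∃ g, IsFourier f g ∧ MemLp (fun ξ => (((1 + ‖ξ‖ ^ 2) ^ (s / 2) : ℝ) : ℂ) * g ξ) 2 := by
  obtain ⟨u, hu, hs2⟩ := h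
  obtain ⟨f', hf'⟩ := TemperedDistribution.memSobolev_iff_exists_smulLeftCLM_fourier.1 hs2
  have t1 : (fun x : E5 => (((1 + ‖x‖ ^ 2) ^ (s / 2) : ℝ) : ℂ)).HasTemperateGrowth := by fun_prop
  have t2 : (fun x : E5 => (((1 + ‖x‖ ^ 2) ^ (-(s / 2)) : ℝ) : ℂ)).HasTemperateGrowth := by fun_prop
  have h1 : 𝓕 u = TemperedDistribution.smulLeftCLM ℂ
      (fun x : E5 => (((1 + ‖x‖ ^ 2) ^ (-(s / 2)) : ℝ) : ℂ)) f' := by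
    rw [← hf', TemperedDistribution.smulLeftCLM_smulLeftCLM_apply t1 t2]
    convert! (TemperedDistribution.smulLeftCLM_const 1 (𝓕 u)).symm using 1
    · simp
    · congr
      ext x
      rw [Pi.mul_apply, ← Complex.ofReal_mul, ← Real.rpow_add (by positivity)]
      simp
  have h2 := represents_smulLeft (represents_Lp f') t2
  rw [← h1] at h2
  refine ⟨fun ξ => (((1 + ‖(2 * Real.pi)⁻¹ • ξ‖ ^ 2) ^ (-(s / 2)) : ℝ) : ℂ) *
    f' ((2 * Real.pi)⁻¹ • ξ), ⟨u, hu, ?_⟩, ?_⟩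
  · simpa only [smul_smul, inv_mul_cancel₀ two_pi_ne, one_smul] using h2
  · have h3 : MemLp (fun ξ => f' ((2 * Real.pi)⁻¹ • ξ)) 2 := memLp_inv_dil (Lp.memLp f')
    -- The constant comes from `1 + |ξ|² ≤ (1 + (2π)²)(1 + |ξ/2π|²)`.
    refine MemLp.of_le (h3.const_mul (((1 + (2 * Real.pi) ^ 2) ^ (s / 2) : ℝ) : ℂ)) ?_ ?_
    · refine (Continuous.aestronglyMeasurable ?_).mul
        ((Continuous.aestronglyMeasurable ?_).mul h3.aestronglyMeasurable)
      · exact t1.1.continuous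
      · have := t2.1.continuous
        exact this.comp (continuous_const_smul ((2 * Real.pi)⁻¹))
    · refine ae_of_all _ fun ξ => ?_
      have hp : (0 : ℝ) < 2 * Real.pi := by positivity
      rw [norm_mul, norm_mul, norm_mul, ← mul_assoc]
      refine mul_le_mul_of_nonneg_right ?_ (norm_nonneg _)
      simp only [Complex.norm_real, Real.norm_eq_abs]
      rw [abs_of_pos (by positivity), abs_of_pos (by positivity), abs_of_pos (by positivity),
        Real.rpow_neg (by positivity), ← div_eq_mul_inv, div_le_iff₀ (by positivity),
        ← Real.mul_rpow (by positivity) (by positivity)]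
      refine Real.rpow_le_rpow (by positivity) ?_ (by positivity)
      rw [norm_smul, mul_pow, Real.norm_eq_abs, abs_of_pos (by positivity)]
      have : (2 * Real.pi)⁻¹ ^ 2 * (2 * Real.pi) ^ 2 = 1 := by
        rw [← mul_pow, inv_mul_cancel₀ two_pi_ne, one_pow]
      nlinarith [sq_nonneg ‖ξ‖, sq_nonneg (2 * Real.pi), sq_nonneg ((2 * Real.pi)⁻¹ * ‖ξ‖)]

/-! ### The Fourier transform of integrable functions -/

lemma norm_exp_neg (x ξ : E5) : ‖Complex.exp (-(Complex.I * (inner ℝ x ξ : ℝ)))‖ = 1 := by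
  rw [Complex.norm_exp]; simp

lemma norm_exp_I (r : ℝ) : ‖Complex.exp (Complex.I * (r : ℂ))‖ = 1 := by
  rw [Complex.norm_exp]; simp

lemma continuous_FT {f : E5 → ℝ} (hf : Integrable f) : Continuous (FT f) := by
  refine continuous_of_dominated (bound := fun x => ‖f x‖) (fun ξ => ?_) (fun ξ => ?_) hf.norm ?_
  · refine (Continuous.aestronglyMeasurable (by fun_prop)).mul ?_
    exact hf.ofReal.aestronglyMeasurable
  · exact ae_of_all _ fun x => by rw [norm_mul, norm_exp_neg, one_mul]; simp
  · exact ae_of_all _ fun x => by fun_prop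

lemma norm_FT_le (f : E5 → ℝ) (ξ : E5) : ‖FT f ξ‖ ≤ ∫ x, ‖f x‖ := by
  refine (norm_integral_le_integral_norm _).trans (le_of_eq ?_)
  refine integral_congr_ae (ae_of_all _ fun x => ?_)
  simp only [norm_mul, norm_exp_neg, one_mul, Complex.norm_real]

lemma integrable_of_FT_ne_zero {f : E5 → ℝ} {ξ : E5} (h : FT f ξ ≠ 0) : Integrable f := by
  have h1 : Integrable fun x => Complex.exp (-(Complex.I * (inner ℝ x ξ : ℝ))) * (f x : ℂ) := by
    by_contra hc
    exact h (integral_undef hc)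
  have h2 : Integrable fun x => Complex.exp (Complex.I * (inner ℝ x ξ : ℝ)) *
      (Complex.exp (-(Complex.I * (inner ℝ x ξ : ℝ))) * (f x : ℂ)) :=
    h1.bdd_mul (c := 1) (Continuous.aestronglyMeasurable (by fun_prop))
      (ae_of_all _ fun x => (norm_exp_I _).le)
  have h3 : Integrable fun x => (f x : ℂ) := by
    refine h2.congr (ae_of_all _ fun x => ?_)
    simp only [← mul_assoc, ← Complex.exp_add, add_neg_cancel, Complex.exp_zero, one_mul]
  simpa using h3.re

lemma FS_eq_integral (χ : 𝓢(E5, ℂ)) (x : E5) :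
    FS χ x = ∫ ξ, Complex.exp (-(Complex.I * (inner ℝ x ξ : ℝ))) * χ ξ := by
  rw [integral_dil, FS_apply, smul_apply, SchwartzMap.fourier_coe, Real.fourier_eq, smul_eq_mul]
  congr 1
  refine integral_congr_ae (ae_of_all _ fun v => ?_)
  simp only [SchwartzMap.compCLMOfContinuousLinearEquiv_apply, Function.comp_apply, dil_apply,
    Circle.smul_def, Real.fourierChar_apply, smul_eq_mul, inner_smul_right, real_inner_comm v]
  congr 2
  push_cast
  ring

lemma isFourier_FT {f : E5 → ℝ} (hf : Integrable f) : IsFourier (fun x => (f x : ℂ)) (FT f) := by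
  have hfc : Integrable fun x => (f x : ℂ) := hf.ofReal
  have hr := represents_of_memLp (memLp_one_iff_integrable.2 hfc)
  refine IsFourier.of_represents hr (fun χ => ?_) fun χ => ?_
  · exact χ.integrable.mul_bdd (continuous_FT hf).aestronglyMeasurable
      (ae_of_all _ (norm_FT_le f))
  · rw [(hr _).2]
    have h1 : ∀ x, FS χ x * (f x : ℂ) =
        ∫ ξ, Complex.exp (-(Complex.I * (inner ℝ x ξ : ℝ))) * (f x * χ ξ) := fun x => by
      rw [FS_eq_integral, ← integral_mul_const]
      congr 1; ext ξ; ring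
    have h2 : ∀ ξ, χ ξ * FT f ξ =
        ∫ x, Complex.exp (-(Complex.I * (inner ℝ x ξ : ℝ))) * (f x * χ ξ) := fun ξ => by
      rw [FT, ← integral_const_mul]
      congr 1; ext x; ring
    simp only [h1, h2]
    refine integral_integral_swap ?_
    refine (hfc.mul_prod χ.integrable).bdd_mul (c := 1)
      (Continuous.aestronglyMeasurable (by fun_prop)) (ae_of_all _ fun z => (norm_exp_neg _ _).le)

lemma FT_shifted (W : E5 → ℝ) (X ξ : E5) :
    FT (shifted W X) ξ = Complex.exp (-(Complex.I * (inner ℝ X ξ : ℝ))) * FT (shifted W 0) ξ := by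
  unfold FT shifted
  rw [← integral_const_mul, ← integral_add_right_eq_self _ X]
  refine integral_congr_ae (ae_of_all _ fun x => ?_)
  simp only [← mul_assoc, ← Complex.exp_add, inner_add_left]
  congr 2
  · push_cast; ring
  · congr 1; abel

lemma FT_conj (f : E5 → ℝ) (ξ : E5) : conj (FT f ξ) = FT f (-ξ) := by
  unfold FT
  rw [← integral_conj]
  refine integral_congr_ae (ae_of_all _ fun x => ?_)
  simp [← Complex.exp_conj]

lemma FT_reflect (W : E5 → ℝ) (ξ : E5) : FT (shifted W 0) ξ = conj (FT W ξ) := by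
  rw [FT_conj]
  unfold FT shifted
  rw [← integral_neg_eq_self]
  refine integral_congr_ae (ae_of_all _ fun x => ?_)
  simp

/-! ### Derivatives -/

/-- Plancherel provides an L² function with the desired transform. Integration by parts against
compactly supported smooth functions identifies it with the classical derivative. -/
lemma pderiv_fourier {f : E5 → ℝ} (hf : ContDiff ℝ 1 f) (hi : Integrable f)
    {j : Fin 5} (h2 : MemLp (fun ξ => Complex.I * (ξ j : ℂ) * FT f ξ) 2) :
    IsFourier (fun x => (pderiv j f x : ℂ)) (fun ξ => Complex.I * (ξ j : ℂ) * FT f ξ) ∧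
      MemLp (fun x => (pderiv j f x : ℂ)) 2 := by
  obtain ⟨F, hF, hF'⟩ := exists_isFourier_of_memLp_right h2
  have hc : Continuous (pderiv j f) := by
    have := hf.continuous_fderiv one_ne_zero
    unfold pderiv
    fun_prop
  have hcc : Continuous fun x => (pderiv j f x : ℂ) := by fun_prop
  have e : F =ᵐ[volume] fun x => (pderiv j f x : ℂ) := by
    refine ae_eq_of_integral_contDiff_smul_eq (hF.locallyIntegrable (by norm_num))
      (hcc.locallyIntegrable) fun φ h1 hs => ?_
    have h3 : HasCompactSupport (Complex.ofRealCLM ∘ φ) := hs.comp_left rfl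
    have h4 : ContDiff ℝ (⊤ : ℕ∞) (Complex.ofRealCLM ∘ φ) := by fun_prop
    obtain ⟨χ, hχ⟩ := FS_surjective (h3.toSchwartzMap h4)
    have a1 : ∀ x, FS χ x = (φ x : ℂ) := fun x => by rw [hχ]; simp
    have hm : (fun ξ : E5 => -(Complex.I * ((inner ℝ ξ (basisVec j) : ℝ) : ℂ))).HasTemperateGrowth :=
      by fun_prop
    have a2 := lineDeriv_FS χ (basisVec j)
    set χ' := SchwartzMap.smulLeftCLM ℂ
      (fun ξ : E5 => -(Complex.I * ((inner ℝ ξ (basisVec j) : ℝ) : ℂ))) χ with hχ'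
    have a3 : ∀ x, FS χ' x = ((fderiv ℝ φ x (basisVec j) : ℝ) : ℂ) := fun x => by
      rw [← a2, SchwartzMap.lineDerivOp_apply_eq_fderiv]
      have : (FS χ : E5 → ℂ) = Complex.ofRealCLM ∘ φ := by ext x; rw [a1]; simp
      rw [this, fderiv_comp _ Complex.ofRealCLM.differentiableAt
        (h1.differentiable (by simp)).differentiableAt]
      simp
    have b1 : ∫ x, φ x • F x = -∫ x, ((fderiv ℝ φ x (basisVec j) : ℝ) : ℂ) * f x := by
      have c1 := hF'.integral_eq χ
      have c2 := (isFourier_FT hi).integral_eq χ'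
      simp only [a1] at c1
      simp only [a3] at c2
      simp only [Complex.real_smul]
      rw [← c1, ← c2, ← integral_neg]
      refine integral_congr_ae (ae_of_all _ fun ξ => ?_)
      simp only [hχ']
      rw [SchwartzMap.smulLeftCLM_apply_apply hm]
      simp only [smul_eq_mul, basisVec, EuclideanSpace.inner_single_right]
      simp; ring
    rw [b1]
    have hcd : Continuous fun x => fderiv ℝ φ x (basisVec j) := by
      have := h1.continuous_fderiv (by simp)
      fun_prop
    have hsd : HasCompactSupport fun x => fderiv ℝ φ x (basisVec j) := by
      have := hs.fderiv (𝕜 := ℝ)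
      exact this.comp_left (g := fun L : E5 →L[ℝ] ℝ => L (basisVec j)) (by simp)
    have b2 : ∫ x, φ x * fderiv ℝ f x (basisVec j) = -∫ x, fderiv ℝ φ x (basisVec j) * f x := by
      refine integral_mul_fderiv_eq_neg_fderiv_mul_of_integrable ?_ ?_ ?_ ?_ ?_
      · exact (hcd.mul hf.continuous).integrable_of_hasCompactSupport hsd.mul_right
      · exact (h1.continuous.mul hc).integrable_of_hasCompactSupport hs.mul_right
      · exact (h1.continuous.mul hf.continuous).integrable_of_hasCompactSupport hs.mul_right
      · exact fun x _ => (h1.differentiable (by simp)).differentiableAt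
      · exact fun x _ => (hf.differentiable one_ne_zero).differentiableAt
    have b3 := congrArg (Complex.ofReal) b2
    rw [Complex.ofReal_neg, ← integral_complex_ofReal, ← integral_complex_ofReal] at b3
    simp only [Complex.ofReal_mul] at b3
    rw [← b3]
    simp only [pderiv, Complex.real_smul]
  exact ⟨hF'.congr_ae e (ae_eq_refl _), (memLp_congr_ae e).1 hF⟩

/-! ### Admissible potentials -/

namespace IsPotential

variable {n : ℝ} {V W : E5 → ℝ}

lemma integrable_V (h : IsPotential n V W) : Integrable V := by
  refine integrable_of_FT_ne_zero (ξ := 0) fun h0 => ?_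
  have := h.normalized
  rw [h0] at this
  simp at this

/-- The frequency must be nonzero because the factor `|ξ|^{2n}` kills `Ŵ` at the origin; continuity
of `V̂` moves away from it. -/
lemma exists_FT_ne_zero (h : IsPotential n V W) : ∃ ξ : E5, ξ ≠ 0 ∧ FT V ξ ≠ 0 := by
  have hc := continuous_FT h.integrable_V
  have h0 : FT V 0 ≠ 0 := fun h0 => by
    have := h.normalized
    rw [h0] at this
    simp at this
  have h1 : ∀ᶠ ξ in 𝓝 (0 : E5), FT V ξ ≠ 0 := hc.continuousAt.eventually_ne h0
  have h2 : ∃ᶠ ξ in 𝓝[≠] (0 : E5), True := by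
    have : NeBot (𝓝[≠] (0 : E5)) := inferInstance
    exact Filter.Eventually.frequently (by simp)
  have h3 : ∀ᶠ ξ in 𝓝[≠] (0 : E5), FT V ξ ≠ 0 := h1.filter_mono nhdsWithin_le_nhds
  obtain ⟨ξ, hξ⟩ := (h3.and self_mem_nhdsWithin).exists
  exact ⟨ξ, hξ.2, hξ.1⟩

lemma integrable_W (h : IsPotential n V W) : Integrable W := by
  obtain ⟨ξ, h1, h2⟩ := h.exists_FT_ne_zero
  refine integrable_of_FT_ne_zero (ξ := ξ) ?_
  rw [h.fourier_eq]
  refine mul_ne_zero ?_ h2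
  have : (0 : ℝ) < ‖ξ‖ ^ (2 * n) := Real.rpow_pos_of_pos (norm_pos_iff.2 h1) _
  exact_mod_cast this.ne'

lemma integrable_shifted (h : IsPotential n V W) (X : E5) : Integrable (shifted W X) := by
  have := h.integrable_W
  exact this.comp_sub_left X

lemma memLp_FT (h : IsPotential n V W) :
    MemLp (fun ξ => (((1 + ‖ξ‖ ^ 2) ^ 2 : ℝ) : ℂ) * FT (shifted W 0) ξ) 2 := by
  obtain ⟨g, hg, hg2⟩ := h.memH4.exists_isFourier (by norm_num)
  have e := hg.unique (isFourier_FT h.integrable_W) (ae_eq_refl _)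
  have hc := continuous_FT (h.integrable_shifted 0)
  refine hg2.of_le (Continuous.aestronglyMeasurable (by fun_prop)) ?_
  filter_upwards [e] with ξ hξ
  rw [hξ, FT_reflect, norm_mul, norm_mul, RCLike.norm_conj]
  norm_num

/-- The form in which `W ∈ H⁴` is used: multipliers of growth up to `|ξ|⁴` keep `Û` in L². -/
lemma memLp_of_le (h : IsPotential n V W) {m : E5 → ℂ} (hm : AEStronglyMeasurable m volume)
    (C : ℝ) (hb : ∀ ξ, ‖m ξ‖ ≤ C * (1 + ‖ξ‖ ^ 2) ^ 2) :
    MemLp (fun ξ => m ξ * FT (shifted W 0) ξ) 2 := by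
  have hc := continuous_FT (h.integrable_shifted 0)
  refine (h.memLp_FT.const_mul (C : ℂ)).of_le (hm.mul hc.aestronglyMeasurable)
    (ae_of_all _ fun ξ => ?_)
  rw [norm_mul, norm_mul, norm_mul, ← mul_assoc]
  refine mul_le_mul_of_nonneg_right ?_ (norm_nonneg _)
  refine (hb ξ).trans ?_
  rw [Complex.norm_real, Complex.norm_real, Real.norm_eq_abs, Real.norm_eq_abs,
    abs_of_nonneg (by positivity : (0 : ℝ) ≤ (1 + ‖ξ‖ ^ 2) ^ 2)]
  exact mul_le_mul_of_nonneg_right (le_abs_self C) (by positivity)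

lemma contDiff_shifted (h : IsPotential n V W) (X : E5) : ContDiff ℝ 1 (shifted W X) := by
  have := h.contDiff
  unfold shifted
  fun_prop

end IsPotential

lemma abs_coord_le (ξ : E5) (j : Fin 5) : |ξ j| ≤ ‖ξ‖ := by
  have := PiLp.norm_apply_le ξ j
  simpa using this

lemma IsPotential.pderiv_shifted {n : ℝ} {V W : E5 → ℝ} (h : IsPotential n V W) (X : E5)
    (j : Fin 5) :
    IsFourier (fun x => (pderiv j (shifted W X) x : ℂ))
      (fun ξ => Complex.I * (ξ j : ℂ) *
        (Complex.exp (-(Complex.I * (inner ℝ X ξ : ℝ))) * FT (shifted W 0) ξ)) ∧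
      MemLp (fun x => (pderiv j (shifted W X) x : ℂ)) 2 := by
  have h1 : (fun ξ : E5 => Complex.I * (ξ j : ℂ) * FT (shifted W X) ξ) = fun ξ =>
      Complex.I * (ξ j : ℂ) *
        (Complex.exp (-(Complex.I * (inner ℝ X ξ : ℝ))) * FT (shifted W 0) ξ) := by
    ext ξ; rw [FT_shifted]
  rw [← h1]
  refine pderiv_fourier (h.contDiff_shifted X) (h.integrable_shifted X) ?_
  rw [h1]
  have := h.memLp_of_le
    (m := fun ξ => Complex.I * (ξ j : ℂ) * Complex.exp (-(Complex.I * (inner ℝ X ξ : ℝ))))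
    (Continuous.aestronglyMeasurable (by fun_prop)) 1 (fun ξ => ?_)
  · simpa only [mul_assoc] using this
  · rw [norm_mul, norm_exp_neg, norm_mul, Complex.norm_I, Complex.norm_real, Real.norm_eq_abs,
      one_mul, mul_one, one_mul]
    nlinarith [abs_coord_le ξ j, norm_nonneg ξ, sq_nonneg (‖ξ‖ - 1), sq_nonneg (‖ξ‖ ^ 2)]

/-! ### The operator `H_ε` in Fourier variables -/

lemma IsFourier.lineDeriv {u : 𝓢'(E5, ℂ)} {f g : E5 → ℂ} (hu : Represents u f)
    (h : IsFourier f g) (p : E5) (χ : 𝓢(E5, ℂ)) :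
    Integrable (fun ξ => χ ξ * (Complex.I * (inner ℝ p ξ : ℝ) * g ξ)) ∧
      (∂_{p} u) (FS χ) = ∫ ξ, χ ξ * (Complex.I * (inner ℝ p ξ : ℝ) * g ξ) := by
  have hm : (fun ξ : E5 => -(Complex.I * ((inner ℝ ξ p : ℝ) : ℂ))).HasTemperateGrowth := by fun_prop
  set χ' := SchwartzMap.smulLeftCLM ℂ (fun ξ : E5 => -(Complex.I * ((inner ℝ ξ p : ℝ) : ℂ))) χ
    with hχ'
  have e : ∀ ξ, χ ξ * (Complex.I * (inner ℝ p ξ : ℝ) * g ξ) = -(χ' ξ * g ξ) := fun ξ => by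
    rw [hχ', SchwartzMap.smulLeftCLM_apply_apply hm, smul_eq_mul, real_inner_comm]; ring
  simp only [e]
  refine ⟨(h.integrable_right χ').neg, ?_⟩
  rw [TemperedDistribution.lineDerivOp_apply_apply, lineDeriv_FS, map_neg, (hu _).2, integral_neg,
    h.integral_eq]

lemma IsFourier.laplacian {u : 𝓢'(E5, ℂ)} {f g : E5 → ℂ} (hu : Represents u f)
    (h : IsFourier f g) (χ : 𝓢(E5, ℂ)) :
    Integrable (fun ξ => χ ξ * (((‖ξ‖ ^ 2 : ℝ) : ℂ) * g ξ)) ∧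
      (Δ u) (FS χ) = -∫ ξ, χ ξ * (((‖ξ‖ ^ 2 : ℝ) : ℂ) * g ξ) := by
  have hm : (fun ξ : E5 => -((‖ξ‖ ^ 2 : ℝ) : ℂ)).HasTemperateGrowth := by fun_prop
  set χ' := SchwartzMap.smulLeftCLM ℂ (fun ξ : E5 => -((‖ξ‖ ^ 2 : ℝ) : ℂ)) χ with hχ'
  have e : ∀ ξ, χ ξ * (((‖ξ‖ ^ 2 : ℝ) : ℂ) * g ξ) = -(χ' ξ * g ξ) := fun ξ => by
    rw [hχ', SchwartzMap.smulLeftCLM_apply_apply hm, smul_eq_mul]; ring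
  simp only [e]
  refine ⟨(h.integrable_right χ').neg, ?_⟩
  rw [TemperedDistribution.laplacian_apply_apply, laplacian_FS, (hu _).2, integral_neg,
    h.integral_eq, neg_neg]

/-- The symbol of `p · ∇ - ε`. -/
def zsym (ε : ℝ) (p ξ : E5) : ℂ := Complex.I * (inner ℝ p ξ : ℝ) - ε

/-- The determinant of the symbol of `H_ε`. -/
def detsym (ε : ℝ) (p ξ : E5) : ℂ := zsym ε p ξ ^ 2 + (phi1 ξ ^ 2 : ℝ)

lemma phi1_sq (ξ : E5) : phi1 ξ ^ 2 = ‖ξ‖ ^ 2 * (1 + ‖ξ‖ ^ 2) := by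
  rw [phi1, mul_pow, Real.sq_sqrt (by positivity)]

lemma phi1_nonneg (ξ : E5) : 0 ≤ phi1 ξ := by unfold phi1; positivity

lemma continuous_phi1 : Continuous phi1 := by unfold phi1; fun_prop

lemma norm_sq_le_phi1 (ξ : E5) : ‖ξ‖ ^ 2 ≤ phi1 ξ := by
  have := phi1_sq ξ
  nlinarith [phi1_nonneg ξ, sq_nonneg ‖ξ‖]

lemma phi1_le (ξ : E5) : phi1 ξ ≤ 1 + ‖ξ‖ ^ 2 := by
  have := phi1_sq ξ
  nlinarith [phi1_nonneg ξ, sq_nonneg ‖ξ‖]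

lemma norm_zsym_sq (ε : ℝ) (p ξ : E5) : ‖zsym ε p ξ‖ ^ 2 = (inner ℝ p ξ : ℝ) ^ 2 + ε ^ 2 := by
  rw [← Complex.normSq_eq_norm_sq, Complex.normSq_apply]
  simp [zsym]; ring

/-- With `z` the symbol of `p·∇ - ε`, the determinant is `(z - iφ₁)(z + iφ₁)`. These two factors are
the Lorentzian denominators of the friction kernel. -/
lemma norm_detsym_sq (ε : ℝ) (p ξ : E5) : ‖detsym ε p ξ‖ ^ 2 =
    ((phi1 ξ - inner ℝ p ξ) ^ 2 + ε ^ 2) * ((phi1 ξ + inner ℝ p ξ) ^ 2 + ε ^ 2) := by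
  rw [← Complex.normSq_eq_norm_sq, Complex.normSq_apply]
  simp [detsym, zsym, sq]; ring

/-- Of the product of the two factors `A + ε²` and `B + ε²` only `ε²(A + B) + ε⁴` is kept, and `A +
B = 2(φ₁² + (p·ξ)²)`. -/
lemma norm_detsym_ge (ε : ℝ) (p ξ : E5) :
    ε ^ 2 * (phi1 ξ ^ 2 + (inner ℝ p ξ : ℝ) ^ 2 + ε ^ 2) ≤ ‖detsym ε p ξ‖ ^ 2 := by
  rw [norm_detsym_sq]
  nlinarith [mul_nonneg (sq_nonneg (phi1 ξ - inner ℝ p ξ))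
      (by positivity : 0 ≤ (phi1 ξ + inner ℝ p ξ) ^ 2 + ε ^ 2),
    mul_nonneg (sq_nonneg (phi1 ξ + inner ℝ p ξ))
      (by positivity : 0 ≤ (phi1 ξ - inner ℝ p ξ) ^ 2 + ε ^ 2)]

lemma detsym_ne {ε : ℝ} (hε : 0 < ε) (p ξ : E5) : detsym ε p ξ ≠ 0 := fun h => by
  have := norm_detsym_ge ε p ξ
  rw [h, norm_zero] at this
  have h2 : 0 < ε ^ 2 * (phi1 ξ ^ 2 + (inner ℝ p ξ : ℝ) ^ 2 + ε ^ 2) := by positivity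
  norm_num at this
  linarith

lemma continuous_zsym (ε : ℝ) (p : E5) : Continuous (zsym ε p) := by unfold zsym; fun_prop

lemma continuous_detsym (ε : ℝ) (p : E5) : Continuous (detsym ε p) := by
  have := continuous_zsym ε p
  have := continuous_phi1
  unfold detsym; fun_prop

lemma phi1_le_norm_detsym (ε : ℝ) (p ξ : E5) :
    ε * phi1 ξ ≤ ‖detsym ε p ξ‖ := by
  refine abs_le_of_sq_le_sq' ?_ (norm_nonneg _) |>.2
  have := norm_detsym_ge ε p ξ
  nlinarith [sq_nonneg (ε * inner ℝ p ξ), sq_nonneg (ε * ε)]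

lemma norm_zsym_le_norm_detsym (ε : ℝ) (p ξ : E5) :
    ε * ‖zsym ε p ξ‖ ≤ ‖detsym ε p ξ‖ := by
  refine abs_le_of_sq_le_sq' ?_ (norm_nonneg _) |>.2
  have := norm_detsym_ge ε p ξ
  rw [mul_pow, norm_zsym_sq]
  nlinarith [sq_nonneg (ε * phi1 ξ)]

/-- Testing with `FS χ` turns derivatives into multiplications, so the differential system becomes a
linear 2×2 system at almost every frequency. -/
lemma heps_iff {ε : ℝ} {p : E5} {U F : Fin 2 → 𝓢'(E5, ℂ)} {u f g h : Fin 2 → E5 → ℂ}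
    (hU : ∀ k, Represents (U k) (u k)) (hF : ∀ k, Represents (F k) (f k))
    (hu : ∀ k, IsFourier (u k) (g k)) (hf : ∀ k, IsFourier (f k) (h k)) :
    Heps ε p U = F ↔
      (fun ξ => zsym ε p ξ * g 0 ξ + ((‖ξ‖ ^ 2 : ℝ) : ℂ) * g 1 ξ) =ᵐ[volume] h 0 ∧
      (fun ξ => -(((‖ξ‖ ^ 2 : ℝ) : ℂ) * g 0 ξ + g 0 ξ) + zsym ε p ξ * g 1 ξ) =ᵐ[volume] h 1 := by
  have eF : ∀ k χ, F k (FS χ) = ∫ ξ, χ ξ * h k ξ := fun k χ => by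
    rw [(hF k _).2, ← (hf k).integral_eq]
  have eU : ∀ k χ, U k (FS χ) = ∫ ξ, χ ξ * g k ξ := fun k χ => by
    rw [(hU k _).2, ← (hu k).integral_eq]
  have dU := fun k => IsFourier.lineDeriv (hU k) (hu k) p
  have lU := fun k => IsFourier.laplacian (hU k) (hu k)
  have i0 : ∀ k (χ : 𝓢(E5, ℂ)), Integrable fun ξ => χ ξ * (zsym ε p ξ * g k ξ) := fun k χ => by
    refine (((dU k χ).1.sub (((hu k).integrable_right χ).const_mul (ε : ℂ)))).congr
      (ae_of_all _ fun ξ => ?_)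
    simp only [zsym, Pi.sub_apply]; ring
  have e0 : ∀ k (χ : 𝓢(E5, ℂ)), (∂_{p} (U k)) (FS χ) - (ε : ℂ) * U k (FS χ) =
      ∫ ξ, χ ξ * (zsym ε p ξ * g k ξ) := fun k χ => by
    rw [(dU k χ).2, eU, ← integral_const_mul, ← integral_sub (dU k χ).1
      (((hu k).integrable_right χ).const_mul (ε : ℂ))]
    refine integral_congr_ae (ae_of_all _ fun ξ => ?_)
    simp only [zsym]; ring
  have j1 : ∀ χ : 𝓢(E5, ℂ), Integrable fun ξ =>
      χ ξ * (zsym ε p ξ * g 0 ξ + ((‖ξ‖ ^ 2 : ℝ) : ℂ) * g 1 ξ) := fun χ => by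
    simp only [mul_add]
    exact (i0 0 χ).add (lU 1 χ).1
  have k1 : ∀ χ : 𝓢(E5, ℂ), Heps ε p U 0 (FS χ) =
      ∫ ξ, χ ξ * (zsym ε p ξ * g 0 ξ + ((‖ξ‖ ^ 2 : ℝ) : ℂ) * g 1 ξ) := fun χ => by
    have : Heps ε p U 0 (FS χ) = ((∂_{p} (U 0)) (FS χ) - (ε : ℂ) * U 0 (FS χ)) - (Δ (U 1)) (FS χ) :=
      rfl
    rw [this, e0, (lU 1 χ).2, sub_neg_eq_add, ← integral_add (i0 0 χ) (lU 1 χ).1]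
    simp only [mul_add]
  have j2 : ∀ χ : 𝓢(E5, ℂ), Integrable fun ξ =>
      χ ξ * (-(((‖ξ‖ ^ 2 : ℝ) : ℂ) * g 0 ξ + g 0 ξ) + zsym ε p ξ * g 1 ξ) := fun χ => by
    simp only [mul_add, mul_neg]
    exact ((lU 0 χ).1.add ((hu 0).integrable_right χ)).neg.add (i0 1 χ)
  have k2 : ∀ χ : 𝓢(E5, ℂ), Heps ε p U 1 (FS χ) =
      ∫ ξ, χ ξ * (-(((‖ξ‖ ^ 2 : ℝ) : ℂ) * g 0 ξ + g 0 ξ) + zsym ε p ξ * g 1 ξ) := fun χ => by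
    have : Heps ε p U 1 (FS χ) = (Δ (U 0)) (FS χ) - U 0 (FS χ) +
      ((∂_{p} (U 1)) (FS χ)) - (ε : ℂ) * U 1 (FS χ) := rfl
    rw [this, add_sub_assoc, e0, (lU 0 χ).2, eU, ← neg_add',
      ← integral_add (lU 0 χ).1 ((hu 0).integrable_right χ), ← integral_neg]
    refine (integral_add ((lU 0 χ).1.add ((hu 0).integrable_right χ)).neg (i0 1 χ)).symm.trans ?_
    simp only [mul_add, mul_neg, Pi.add_apply, Pi.neg_apply]
  constructor
  · intro H
    refine ⟨ae_eq_of_schwartz j1 (hf 0).integrable_right fun χ => ?_,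
      ae_eq_of_schwartz j2 (hf 1).integrable_right fun χ => ?_⟩
    · rw [← k1, H, eF]
    · rw [← k2, H, eF]
  · rintro ⟨H1, H2⟩
    ext k ψ
    obtain ⟨χ, rfl⟩ := FS_surjective ψ
    fin_cases k
    · change Heps ε p U 0 (FS χ) = F 0 (FS χ)
      rw [k1, eF]
      refine integral_congr_ae ?_
      filter_upwards [H1] with ξ hξ
      rw [hξ]
    · change Heps ε p U 1 (FS χ) = F 1 (FS χ)
      rw [k2, eF]
      refine integral_congr_ae ?_
      filter_upwards [H2] with ξ hξ
      rw [hξ]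

/-- The Fourier transform of the solution of `H_ε u = (0, f)`. -/
def hepsHat (ε : ℝ) (p : E5) (f : E5 → ℝ) : Fin 2 → E5 → ℂ :=
  ![fun ξ => -((‖ξ‖ ^ 2 : ℝ) : ℂ) / detsym ε p ξ * FT f ξ,
    fun ξ => zsym ε p ξ / detsym ε p ξ * FT f ξ]

lemma isFourier_zero : IsFourier (0 : E5 → ℂ) 0 :=
  IsFourier.of_represents represents_zero (fun χ => by simp) fun χ => by simp

lemma isFourier_secondOnly {f : E5 → ℝ} (hf : Integrable f) (k : Fin 2) :
    IsFourier (secondOnly f k) ((![0, FT f] : Fin 2 → E5 → ℂ) k) := by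
  fin_cases k
  · exact isFourier_zero
  · exact isFourier_FT hf

/-- Cramer's rule: the two equations are combined with the entries of the adjugate matrix. As the
result does not depend on the solution, it contains uniqueness. -/
lemma IsHepsInv.isFourier {ε : ℝ} (hε : 0 < ε) {p : E5} {f : E5 → ℝ} (hf : Integrable f)
    {u : Fin 2 → E5 → ℂ} (h : IsHepsInv ε p (secondOnly f) u) (k : Fin 2) :
    IsFourier (u k) (hepsHat ε p f k) := by
  obtain ⟨h2, U, F, hU, hF, H⟩ := h
  choose g hg2 hg using fun k => exists_isFourier_of_memLp (h2 k)
  obtain ⟨H1, H2⟩ := (heps_iff hU hF hg (isFourier_secondOnly hf)).1 H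
  refine (hg k).congr_ae (ae_eq_refl _) ?_
  filter_upwards [H1, H2] with ξ h1 h2
  have hd := detsym_ne hε p ξ
  have hφ : ((phi1 ξ ^ 2 : ℝ) : ℂ) = (‖ξ‖ : ℂ) ^ 2 * (1 + (‖ξ‖ : ℂ) ^ 2) := by
    rw [phi1_sq]; push_cast; ring
  simp only [Matrix.cons_val_zero, Matrix.cons_val_one, Pi.zero_apply] at h1 h2
  push_cast at h1 h2
  fin_cases k
  · simp only [hepsHat, Fin.zero_eta, Matrix.cons_val_zero]
    rw [div_mul_eq_mul_div, eq_div_iff hd, detsym, hφ]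
    push_cast
    linear_combination zsym ε p ξ * h1 - (‖ξ‖ : ℂ) ^ 2 * h2
  · change g 1 ξ = zsym ε p ξ / detsym ε p ξ * FT f ξ
    rw [div_mul_eq_mul_div, eq_div_iff hd, detsym, hφ]
    linear_combination (1 + (‖ξ‖ : ℂ) ^ 2) * h1 + zsym ε p ξ * h2

namespace IsPotential

variable {n : ℝ} {V W : E5 → ℝ}

lemma memLp_hepsHat (h : IsPotential n V W) {ε : ℝ} (hε : 0 < ε) (p : E5) (k : Fin 2) :
    MemLp (hepsHat ε p (shifted W 0) k) 2 := by
  have hc := continuous_detsym ε p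
  have hz := continuous_zsym ε p
  have hb : ∀ ξ : E5, 1 / ε ≤ 1 / ε * (1 + ‖ξ‖ ^ 2) ^ 2 := fun ξ => by
    refine le_mul_of_one_le_right (by positivity) ?_
    nlinarith [sq_nonneg ‖ξ‖, sq_nonneg (‖ξ‖ ^ 2)]
  have hpos : ∀ ξ, 0 < ‖detsym ε p ξ‖ := fun ξ => norm_pos_iff.2 (detsym_ne hε p ξ)
  fin_cases k
  · refine h.memLp_of_le (m := fun ξ => -((‖ξ‖ ^ 2 : ℝ) : ℂ) / detsym ε p ξ)
      (Continuous.aestronglyMeasurable ?_) (1 / ε) fun ξ => (?_ : _ ≤ 1 / ε).trans (hb ξ)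
    · exact Continuous.div (by fun_prop) hc (detsym_ne hε p)
    · rw [norm_div, div_le_div_iff₀ (hpos ξ) hε, norm_neg, Complex.norm_real, Real.norm_eq_abs,
        abs_of_nonneg (by positivity)]
      nlinarith [phi1_le_norm_detsym ε p ξ, norm_sq_le_phi1 ξ]
  · refine h.memLp_of_le (m := fun ξ => zsym ε p ξ / detsym ε p ξ)
      (Continuous.aestronglyMeasurable ?_) (1 / ε) fun ξ => (?_ : _ ≤ 1 / ε).trans (hb ξ)
    · exact Continuous.div hz hc (detsym_ne hε p)
    · rw [norm_div, div_le_div_iff₀ (hpos ξ) hε]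
      nlinarith [norm_zsym_le_norm_detsym ε p ξ]

lemma exists_isHepsInv (h : IsPotential n V W) {ε : ℝ} (hε : 0 < ε) (p : E5) :
    ∃ u, IsHepsInv ε p (secondOnly (shifted W 0)) u := by
  have hi := h.integrable_shifted 0
  choose u hu2 hu using fun k => exists_isFourier_of_memLp_right (h.memLp_hepsHat hε p k)
  have hf := isFourier_secondOnly hi
  choose F hF using fun k => (hf k).represents_ne
  refine ⟨u, hu2, fun k => ((hu2 k).toLp (u k) : Lp ℂ 2 (volume : Measure E5)), F,
    fun k => represents_of_memLp (hu2 k), hF, ?_⟩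
  refine (heps_iff (fun k => represents_of_memLp (hu2 k)) hF hu hf).2 ⟨?_, ?_⟩
  · refine ae_of_all _ fun ξ => ?_
    have hd := detsym_ne hε p ξ
    simp only [hepsHat, Matrix.cons_val_zero, Matrix.cons_val_one, Pi.zero_apply]
    field_simp
    ring
  · refine ae_of_all _ fun ξ => ?_
    have hd := detsym_ne hε p ξ
    have hφ : ((phi1 ξ ^ 2 : ℝ) : ℂ) = (‖ξ‖ : ℂ) ^ 2 * (1 + (‖ξ‖ : ℂ) ^ 2) := by
      rw [phi1_sq]; push_cast; ring
    simp only [hepsHat, Matrix.cons_val_zero, Matrix.cons_val_one]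
    field_simp
    rw [detsym, hφ]
    push_cast
    ring

lemma isHepsInv_unique (h : IsPotential n V W) {ε : ℝ} (hε : 0 < ε) {p : E5}
    {u v : Fin 2 → E5 → ℂ} (hu : IsHepsInv ε p (secondOnly (shifted W 0)) u)
    (hv : IsHepsInv ε p (secondOnly (shifted W 0)) v) (k : Fin 2) : u k =ᵐ[volume] v k :=
  (hu.isFourier hε (h.integrable_shifted 0) k).unique_left
    (hv.isFourier hε (h.integrable_shifted 0) k) (ae_eq_refl _)

/-- Parseval; only the first component of the solution is seen, since the pair on the left is `(∇U,
0)`. -/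
lemma friction_apply (h : IsPotential n V W) {ε : ℝ} (hε : 0 < ε) (ρ₀ : ℝ) (p : E5) (j : Fin 5) :
    friction ρ₀ (shifted W 0) ε p j = ρ₀ / (2 * Real.pi) ^ 5 *
      (∫ ξ, conj (Complex.I * (ξ j : ℂ) * FT (shifted W 0) ξ) *
        (-((‖ξ‖ ^ 2 : ℝ) : ℂ) / detsym ε p ξ * FT (shifted W 0) ξ)).re := by
  have hex := h.exists_isHepsInv hε p
  have hu : IsHepsInv ε p (secondOnly (shifted W 0)) (HepsInv ε p (secondOnly (shifted W 0))) := by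
    rw [HepsInv, dif_pos hex]
    exact hex.choose_spec
  obtain ⟨d1, d2⟩ := h.pderiv_shifted 0 j
  have key := d1.parseval (hu.isFourier hε (h.integrable_shifted 0) 0) d2 (hu.1 0)
  simp only [inner_zero_left, Complex.ofReal_zero, mul_zero, neg_zero, Complex.exp_zero, one_mul,
    hepsHat, Matrix.cons_val_zero] at key
  rw [key]
  have hp : ((2 * Real.pi) ^ 5 : ℂ) = (((2 * Real.pi) ^ 5 : ℝ) : ℂ) := by push_cast; ring
  have hp0 : ((2 * Real.pi) ^ 5 : ℝ) ≠ 0 := by positivity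
  rw [hp, Complex.re_ofReal_mul, ← mul_assoc, div_mul_cancel₀ _ hp0]
  simp [friction, pairInner]

end IsPotential

/-! ### Curves in a Hilbert space with a weak derivative -/

/-- The weak equation integrates to `u(s) = u(0) + ∫₀ˢ w` when tested with `D`. As `D` separates
points this holds in `H`, and the right side is strongly differentiable because `w` is continuous.
-/
lemma hasDerivWithinAt_of_weak {H : Type*} [NormedAddCommGroup H] [InnerProductSpace ℂ H]
    [NormedSpace ℝ H] [CompleteSpace H] {u w : ℝ → H} (hu : Continuous u) (hw : Continuous w) {D : Set H}
    (hD : ∀ x, (∀ d ∈ D, inner ℂ d x = 0) → x = 0)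
    (h : ∀ d ∈ D, ∀ t, 0 ≤ t →
      HasDerivWithinAt (fun s => inner ℂ d (u s)) (inner ℂ d (w t)) (Set.Ici 0) t)
    (t : ℝ) (ht : 0 ≤ t) : HasDerivWithinAt u (w t) (Set.Ici 0) t := by
  have key : ∀ s, 0 ≤ s → u s = u 0 + ∫ r in (0 : ℝ)..s, w r := fun s hs => by
    rw [← sub_eq_iff_eq_add', ← sub_eq_zero]
    refine hD _ fun d hd => ?_
    have h1 : ∫ r in (0 : ℝ)..s, inner ℂ d (w r) = inner ℂ d (u s) - inner ℂ d (u 0) := by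
      refine intervalIntegral.integral_eq_sub_of_hasDeriv_right_of_le
        (f := fun r => (inner ℂ d (u r) : ℂ)) (f' := fun r => (inner ℂ d (w r) : ℂ)) hs ?_ (fun x hx => ?_) ?_
      · fun_prop
      · exact (h d hd x hx.1.le).mono (fun y hy => (hx.1.trans hy).le)
      · exact Continuous.intervalIntegrable (by fun_prop) _ _
    have h2 : ∫ r in (0 : ℝ)..s, inner ℂ d (w r) = inner ℂ d (∫ r in (0 : ℝ)..s, w r) :=
      (innerSL ℂ d).intervalIntegral_comp_comm (hw.intervalIntegrable _ _)
    rw [inner_sub_right, inner_sub_right, ← h1, h2, sub_self]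
  have h3 : HasDerivAt (fun s => u 0 + ∫ r in (0 : ℝ)..s, w r) (w t) t :=
    (hw.integral_hasStrictDerivAt 0 t).hasDerivAt.const_add (u 0)
  exact h3.hasDerivWithinAt.congr (fun s hs => key s hs) (key t ht)

/-! ### Continuous and differentiable curves in L² -/

/-- A continuous curve in `L²`. -/
structure ContL2 (f : ℝ → E5 → ℂ) : Prop where
  memLp : ∀ s, MemLp (f s) 2
  cont : ∀ t, Tendsto (fun s => eLpNorm (f s - f t) 2 volume) (𝓝 t) (𝓝 0)

namespace ContL2

variable {f g : ℝ → E5 → ℂ}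

lemma continuous (h : ContL2 f) : Continuous fun s => (h.memLp s).toLp (f s) :=
  continuous_iff_continuousAt.2 fun t =>
    (Lp.tendsto_Lp_iff_tendsto_eLpNorm'' f h.memLp (f t) (h.memLp t)).2 (h.cont t)

lemma mul_bdd (h : ContL2 f) {m : E5 → ℂ} (hm : AEStronglyMeasurable m volume) {C : ℝ}
    (hC : ∀ ξ, ‖m ξ‖ ≤ C) : ContL2 fun s ξ => m ξ * f s ξ := by
  refine ⟨fun s => ?_, fun t => ?_⟩
  · refine ((h.memLp s).const_mul (C : ℂ)).of_le (hm.mul (h.memLp s).aestronglyMeasurable)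
      (ae_of_all _ fun ξ => ?_)
    rw [norm_mul, norm_mul, Complex.norm_real, Real.norm_eq_abs]
    exact mul_le_mul_of_nonneg_right ((hC ξ).trans (le_abs_self C)) (norm_nonneg _)
  · have h1 : ∀ s, eLpNorm ((fun ξ => m ξ * f s ξ) - fun ξ => m ξ * f t ξ) 2 volume ≤
        ENNReal.ofReal C * eLpNorm (f s - f t) 2 volume := fun s => by
      refine eLpNorm_le_mul_eLpNorm_of_ae_le_mul (ae_of_all _ fun ξ => ?_) 2
      simp only [Pi.sub_apply, ← mul_sub, norm_mul]
      exact mul_le_mul_of_nonneg_right (hC ξ) (norm_nonneg _)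
    have h2 := ENNReal.Tendsto.const_mul (a := ENNReal.ofReal C) (h.cont t)
      (Or.inr ENNReal.ofReal_ne_top)
    rw [mul_zero] at h2
    exact tendsto_of_tendsto_of_tendsto_of_le_of_le tendsto_const_nhds h2 (fun _ => zero_le)
      h1

lemma add (h : ContL2 f) (h' : ContL2 g) : ContL2 fun s ξ => f s ξ + g s ξ := by
  refine ⟨fun s => (h.memLp s).add (h'.memLp s), fun t => ?_⟩
  have h2 := (h.cont t).add (h'.cont t)
  rw [add_zero] at h2
  refine tendsto_of_tendsto_of_tendsto_of_le_of_le tendsto_const_nhds h2 (fun _ => zero_le)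
    fun s => ?_
  have : ((fun ξ => f s ξ + g s ξ) - fun ξ => f t ξ + g t ξ) = (f s - f t) + (g s - g t) := by
    ext ξ; simp only [Pi.sub_apply, Pi.add_apply]; ring
  simp only [this]
  exact eLpNorm_add_le ((h.memLp s).sub (h.memLp t)).aestronglyMeasurable
    ((h'.memLp s).sub (h'.memLp t)).aestronglyMeasurable (by norm_num)

/-- Dominated convergence with bound `(2|G|)²`; no uniformity of the phases in `ξ` is needed. -/
lemma of_phase {G : E5 → ℂ} (hG : MemLp G 2) {θ : ℝ → E5 → ℝ} (h1 : ∀ s, Continuous (θ s))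
    (h2 : ∀ ξ, Continuous fun s => θ s ξ) :
    ContL2 fun s ξ => Complex.exp (Complex.I * (θ s ξ : ℝ)) * G ξ := by
  have hm : ∀ s, AEStronglyMeasurable (fun ξ => Complex.exp (Complex.I * (θ s ξ : ℝ)) * G ξ)
      volume := fun s => by
    have := h1 s
    exact (Continuous.aestronglyMeasurable (by fun_prop)).mul hG.aestronglyMeasurable
  have hmem : ∀ s, MemLp (fun ξ => Complex.exp (Complex.I * (θ s ξ : ℝ)) * G ξ) 2 := fun s =>
    hG.of_le (hm s) (ae_of_all _ fun ξ => by rw [norm_mul, norm_exp_I, one_mul])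
  refine ⟨hmem, fun t => ?_⟩
  have hlim : Tendsto (fun s => ∫⁻ ξ, ‖Complex.exp (Complex.I * (θ s ξ : ℝ)) * G ξ -
      Complex.exp (Complex.I * (θ t ξ : ℝ)) * G ξ‖ₑ ^ (2 : ℝ)) (𝓝 t) (𝓝 (∫⁻ _ : E5, 0)) := by
    refine tendsto_lintegral_filter_of_dominated_convergence'
      (fun ξ => (2 * ‖G ξ‖ₑ) ^ (2 : ℝ)) ?_ ?_ ?_ ?_
    · exact Eventually.of_forall fun s => (((hm s).sub (hm t)).enorm).pow_const _
    · refine Eventually.of_forall fun s => ae_of_all _ fun ξ => ?_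
      refine ENNReal.rpow_le_rpow ?_ (by norm_num)
      refine (enorm_sub_le).trans (le_of_eq ?_)
      rw [enorm_mul, enorm_mul, two_mul]
      congr 1 <;> rw [← ofReal_norm, norm_exp_I] <;> simp
    · have := (hG.const_mul (2 : ℂ)).2
      rw [eLpNorm_lt_top_iff_lintegral_rpow_enorm_lt_top (by norm_num) (by norm_num)] at this
      refine ne_of_lt ?_
      convert this using 4 with ξ
      · rw [enorm_mul]; congr 1; rw [← ofReal_norm]; simp
      · simp
    · refine ae_of_all _ fun ξ => ?_
      have hc : Continuous fun s => ‖Complex.exp (Complex.I * (θ s ξ : ℝ)) * G ξ -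
          Complex.exp (Complex.I * (θ t ξ : ℝ)) * G ξ‖ₑ ^ (2 : ℝ) := by
        have := h2 ξ
        refine ENNReal.continuous_rpow_const.comp (continuous_enorm.comp ?_)
        fun_prop
      have := hc.tendsto t
      simpa using this
  simp only [lintegral_zero] at hlim
  have h3 := (ENNReal.continuous_rpow_const (y := 1 / 2)).tendsto _ |>.comp hlim
  rw [ENNReal.zero_rpow_of_pos (by norm_num)] at h3
  refine h3.congr fun s => ?_
  rw [eLpNorm_eq_lintegral_rpow_enorm_toReal (by norm_num) (by norm_num)]
  simp

end ContL2

lemma inner_toLp {f g : E5 → ℂ} (hf : MemLp f 2) (hg : MemLp g 2) :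
    inner ℂ (hf.toLp f) (hg.toLp g) = ∫ ξ, conj (f ξ) * g ξ := by
  rw [L2.inner_def]
  refine integral_congr_ae ?_
  filter_upwards [hf.coeFn_toLp, hg.coeFn_toLp] with x hx hy
  rw [hx, hy]
  simp [mul_comm]

lemma memLp_conj {f : E5 → ℂ} (hf : MemLp f 2) : MemLp (fun ξ => conj (f ξ)) 2 :=
  hf.of_le (Complex.continuous_conj.comp_aestronglyMeasurable hf.aestronglyMeasurable)
    (ae_of_all _ fun ξ => by rw [RCLike.norm_conj])

/-- The Hilbert space principle for bilinear pairings; the conjugates of the test functions serve as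
the separating set. -/
lemma ContL2.hasDerivWithinAt_of_weak {f f' : ℝ → E5 → ℂ} (hf : ContL2 f) (hf' : ContL2 f')
    {T : Set (E5 → ℂ)} (hT : ∀ d ∈ T, MemLp d 2)
    (hT' : ∀ x : E5 → ℂ, MemLp x 2 → (∀ d ∈ T, ∫ ξ, d ξ * x ξ = 0) → x =ᵐ[volume] 0)
    (h : ∀ d ∈ T, ∀ t, 0 ≤ t → HasDerivWithinAt (fun s => ∫ ξ, d ξ * f s ξ) (∫ ξ, d ξ * f' t ξ)
      (Set.Ici 0) t) (t : ℝ) (ht : 0 ≤ t) :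
    HasDerivWithinAt (fun s => (hf.memLp s).toLp (f s)) ((hf'.memLp t).toLp (f' t))
      (Set.Ici 0) t := by
  refine ParticleBose.hasDerivWithinAt_of_weak (w := fun t => (hf'.memLp t).toLp (f' t))
    hf.continuous hf'.continuous
    (D := {x | ∃ d, ∃ hd : d ∈ T, x = (memLp_conj (hT d hd)).toLp _}) ?_ ?_ t ht
  · intro x hx
    have h1 : x =ᵐ[volume] (0 : E5 → ℂ) := by
      refine hT' x (Lp.memLp x) fun d hd => ?_
      have := hx _ ⟨d, hd, rfl⟩
      rw [← Lp.toLp_coeFn x (Lp.memLp x), inner_toLp] at this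
      simpa using this
    rw [Lp.eq_zero_iff_ae_eq_zero]
    exact h1
  · rintro _ ⟨d, hd, rfl⟩ s hs
    simp only [inner_toLp, Complex.conj_conj]
    exact h d hd s hs

lemma ContL2.hasDerivWithinAt_pairing {f f' g g' : ℝ → E5 → ℂ} (hf : ContL2 f) (hf' : ContL2 f')
    (hg : ContL2 g) (hg' : ContL2 g') {t : ℝ}
    (h : HasDerivWithinAt (fun s => (hf.memLp s).toLp (f s)) ((hf'.memLp t).toLp (f' t))
      (Set.Ici 0) t)
    (h' : HasDerivWithinAt (fun s => (hg.memLp s).toLp (g s)) ((hg'.memLp t).toLp (g' t))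
      (Set.Ici 0) t) :
    HasDerivWithinAt (fun s => ∫ ξ, conj (f s ξ) * g s ξ)
      ((∫ ξ, conj (f t ξ) * g' t ξ) + ∫ ξ, conj (f' t ξ) * g t ξ) (Set.Ici 0) t := by
  have := h.inner ℂ h'
  simpa only [inner_toLp] using this

lemma ContL2.continuous_pairing {f g : ℝ → E5 → ℂ} (hf : ContL2 f) (hg : ContL2 g) :
    Continuous fun s => ∫ ξ, conj (f s ξ) * g s ξ := by
  have := hf.continuous.inner (𝕜 := ℂ) hg.continuous
  simpa only [inner_toLp] using this

/-- Oscillating curves in `L²` are differentiable. -/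
lemma hasDerivWithinAt_osc {K : E5 → ℂ} {φ : E5 → ℝ}
    (hφK : MemLp (fun ξ => Complex.I * (φ ξ : ℂ) * K ξ) 2)
    (h1 : ContL2 fun s ξ => Complex.exp (Complex.I * ((s * φ ξ : ℝ) : ℂ)) * K ξ)
    (h2 : ContL2 fun s ξ =>
      Complex.exp (Complex.I * ((s * φ ξ : ℝ) : ℂ)) * (Complex.I * (φ ξ : ℂ) * K ξ))
    (t : ℝ) (ht : 0 ≤ t) :
    HasDerivWithinAt (fun s => (h1.memLp s).toLp _) ((h2.memLp t).toLp _) (Set.Ici 0) t := by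
  refine h1.hasDerivWithinAt_of_weak h2 (T := {d | MemLp d 2 volume}) (fun d hd => hd) ?_ ?_ t ht
  · intro x hx h
    have h3 := h (fun ξ => conj (x ξ)) (memLp_conj hx)
    rw [← inner_toLp hx hx, inner_self_eq_zero, Lp.eq_zero_iff_ae_eq_zero] at h3
    exact hx.coeFn_toLp.symm.trans h3
  · intro d hd s _
    refine (hasDerivAt_integral_of_dominated_loc_of_deriv_le
      (F := fun s ξ => d ξ * (Complex.exp (Complex.I * ((s * φ ξ : ℝ) : ℂ)) * K ξ))
      (F' := fun s ξ => d ξ * (Complex.exp (Complex.I * ((s * φ ξ : ℝ) : ℂ)) *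
        (Complex.I * (φ ξ : ℂ) * K ξ)))
      (bound := fun ξ => ‖d ξ * (Complex.I * (φ ξ : ℂ) * K ξ)‖) univ_mem
      ?_ ?_ ?_ ?_ ?_ ?_).2.hasDerivWithinAt
    · exact Eventually.of_forall fun r =>
        (MemLp.integrable_mul hd (h1.memLp r)).aestronglyMeasurable
    · exact MemLp.integrable_mul hd (h1.memLp s)
    · exact (MemLp.integrable_mul hd (h2.memLp s)).aestronglyMeasurable
    · refine ae_of_all _ fun ξ r _ => le_of_eq ?_
      rw [norm_mul, norm_mul (Complex.exp _), norm_exp_I, one_mul, norm_mul (d ξ)]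
    · exact (MemLp.integrable_mul hd hφK).norm
    · refine ae_of_all _ fun ξ r _ => ?_
      have h3 : HasDerivAt (fun r : ℝ => Complex.exp (Complex.I * ((r * φ ξ : ℝ) : ℂ)))
          (Complex.exp (Complex.I * ((r * φ ξ : ℝ) : ℂ)) * (Complex.I * ((1 * φ ξ : ℝ) : ℂ))) r :=
        ((((hasDerivAt_id r).mul_const (φ ξ)).ofReal_comp).const_mul Complex.I).cexp
      refine ((h3.mul_const (K ξ)).const_mul (d ξ)).congr_deriv ?_
      push_cast; ring

/-! ### The field in Fourier variables -/

/-- The bracket `⟨ξ⟩ = √(1 + |ξ|²)`. -/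
def jb (ξ : E5) : ℝ := Real.sqrt (1 + ‖ξ‖ ^ 2)

lemma jb_sq (ξ : E5) : jb ξ ^ 2 = 1 + ‖ξ‖ ^ 2 := Real.sq_sqrt (by positivity)

lemma jb_pos (ξ : E5) : 0 < jb ξ := Real.sqrt_pos.2 (by positivity)

lemma one_le_jb (ξ : E5) : 1 ≤ jb ξ := by nlinarith [jb_sq ξ, jb_pos ξ, sq_nonneg ‖ξ‖]

lemma norm_le_jb (ξ : E5) : ‖ξ‖ ≤ jb ξ := by nlinarith [jb_sq ξ, jb_pos ξ, norm_nonneg ξ]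

lemma continuous_jb : Continuous jb := by unfold jb; fun_prop

lemma phi1_eq (ξ : E5) : phi1 ξ = ‖ξ‖ * jb ξ := rfl

/-- The Fourier transform of the real part of the field. -/
def reHat (β : ℝ → E5 → ℂ) (t : ℝ) : E5 → ℂ := hat fun x => ((β t x).re : ℂ)

/-- The Fourier transform of the imaginary part of the field. -/
def imHat (β : ℝ → E5 → ℂ) (t : ℝ) : E5 → ℂ := hat fun x => ((β t x).im : ℂ)

lemma MemEnergy.re_fourier {f : E5 → ℂ} (h : MemEnergy f) :
    IsFourier (fun x => ((f x).re : ℂ)) (hat fun x => ((f x).re : ℂ)) ∧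
      MemLp (fun ξ => (jb ξ : ℂ) * hat (fun x => ((f x).re : ℂ)) ξ) 2 := by
  obtain ⟨g, hg, hg2⟩ := h.1.exists_isFourier zero_le_one
  refine ⟨hg.hat_spec, (memLp_congr_ae ?_).2 hg2⟩
  filter_upwards [hg.hat_ae] with ξ hξ
  rw [hξ, jb, Real.sqrt_eq_rpow]

lemma MemEnergy.im_fourier {f : E5 → ℂ} (h : MemEnergy f) :
    IsFourier (fun x => ((f x).im : ℂ)) (hat fun x => ((f x).im : ℂ)) ∧
      MemLp (fun ξ => (‖ξ‖ : ℂ) * hat (fun x => ((f x).im : ℂ)) ξ) 2 := by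
  obtain ⟨g, hg, -, hg2⟩ := h.2
  refine ⟨hg.hat_spec, (memLp_congr_ae ?_).2 hg2⟩
  filter_upwards [hg.hat_ae] with ξ hξ
  rw [hξ]

lemma MemEnergy.re_memLp {f : E5 → ℂ} (h : MemEnergy f) : MemLp (fun x => ((f x).re : ℂ)) 2 := by
  obtain ⟨h1, h2⟩ := h.re_fourier
  refine h1.memLp_left (h2.of_le h1.aestronglyMeasurable_right (ae_of_all _ fun ξ => ?_))
  rw [norm_mul, Complex.norm_real, Real.norm_eq_abs, abs_of_pos (jb_pos ξ)]
  exact le_mul_of_one_le_left (norm_nonneg _) (one_le_jb ξ)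

/-- `hat` is defined by choice, hence linear only almost everywhere; this turns continuity in the
energy norm into continuity of weighted transforms in L². -/
lemma MemEnergy.energyNorm_sub {f g : E5 → ℂ} (hf : MemEnergy f) (hg : MemEnergy g) :
    energyNorm (fun x => f x - g x) =
      eLpNorm ((fun ξ => (jb ξ : ℂ) * hat (fun x => ((f x).re : ℂ)) ξ) -
        fun ξ => (jb ξ : ℂ) * hat (fun x => ((g x).re : ℂ)) ξ) 2 volume +
      eLpNorm ((fun ξ => (‖ξ‖ : ℂ) * hat (fun x => ((f x).im : ℂ)) ξ) -
        fun ξ => (‖ξ‖ : ℂ) * hat (fun x => ((g x).im : ℂ)) ξ) 2 volume := by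
  have h1 := (hf.re_fourier.1.sub hg.re_fourier.1).hat_ae
  have h2 := (hf.im_fourier.1.sub hg.im_fourier.1).hat_ae
  unfold energyNorm
  simp only [Complex.sub_re, Complex.sub_im, Complex.ofReal_sub]
  congr 1
  · refine eLpNorm_congr_ae ?_
    filter_upwards [h1] with ξ hξ
    rw [hξ, Pi.sub_apply, mul_sub]; rfl
  · refine eLpNorm_congr_ae ?_
    filter_upwards [h2] with ξ hξ
    rw [hξ, Pi.sub_apply, mul_sub]

namespace IsSolution

variable {ρ₀ : ℝ} {W : E5 → ℝ} {X P : ℝ → E5} {β : ℝ → E5 → ℂ}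

lemma continuous_X (h : IsSolution ρ₀ W X P β) : Continuous fun s => X (max s 0) := by
  have h1 : ContinuousOn X (Set.Ici 0) := fun t ht => (h.deriv_X t ht).continuousWithinAt
  exact h1.comp_continuous (by fun_prop) fun s => le_max_right s 0

/-- Time is clamped to `max s 0` so that the curves are defined and continuous on the whole line,
whereas the solution is controlled on `[0, ∞)` only. -/
lemma contL2_aux (h : IsSolution ρ₀ W X P β) :
    ContL2 (fun s ξ => (jb ξ : ℂ) * reHat β (max s 0) ξ) ∧
      ContL2 (fun s ξ => (‖ξ‖ : ℂ) * imHat β (max s 0) ξ) := by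
  have h0 : ∀ s : ℝ, 0 ≤ max s 0 := fun s => le_max_right s 0
  have h1 : ∀ t : ℝ, Tendsto (fun s => energyNorm (fun x => β (max s 0) x - β (max t 0) x))
      (𝓝 t) (𝓝 0) := fun t => by
    refine (h.continuous_energy _ (h0 t)).comp (tendsto_nhdsWithin_iff.2 ⟨?_, ?_⟩)
    · exact (continuous_id.max continuous_const).tendsto t
    · exact Eventually.of_forall fun s => h0 s
  have h2 := fun s t : ℝ => (h.energy _ (h0 s)).energyNorm_sub (h.energy _ (h0 t))
  constructor
  · refine ⟨fun s => (h.energy _ (h0 s)).re_fourier.2, fun t => ?_⟩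
    refine tendsto_of_tendsto_of_tendsto_of_le_of_le tendsto_const_nhds (h1 t)
      (fun _ => zero_le) fun s => ?_
    simp only [h2]
    exact le_self_add
  · refine ⟨fun s => (h.energy _ (h0 s)).im_fourier.2, fun t => ?_⟩
    refine tendsto_of_tendsto_of_tendsto_of_le_of_le tendsto_const_nhds (h1 t)
      (fun _ => zero_le) fun s => ?_
    simp only [h2]
    exact le_add_self

/-- Test functions are complex, so real and imaginary parts of the field cannot be read off one
equation. Conjugating the equation tested with `conj ψ` gives the one for `conj β` tested with `ψ`;
half the sum and the difference over `2i` separate the parts. -/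
lemma field_aux (h : IsSolution ρ₀ W X P β) (ψ : 𝓢(E5, ℂ)) (t : ℝ) (ht : 0 ≤ t) :
    HasDerivWithinAt (fun s => ∫ x, ψ x * ((β s x).re : ℂ)) (-∫ x, (Δ ψ) x * ((β t x).im : ℂ))
      (Set.Ici 0) t ∧
    HasDerivWithinAt (fun s => ∫ x, ψ x * ((β s x).im : ℂ))
      ((∫ x, (Δ ψ) x * ((β t x).re : ℂ)) - (∫ x, ψ x * ((β t x).re : ℂ)) -
        (Real.sqrt ρ₀ : ℂ) * ∫ x, ψ x * (shifted W (X t) x : ℂ)) (Set.Ici 0) t := by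
  have iR : ∀ s, 0 ≤ s → ∀ η : 𝓢(E5, ℂ), Integrable fun x => η x * ((β s x).re : ℂ) :=
    fun s hs η => (h.energy s hs).re_fourier.1.integrable_left η
  have iI : ∀ s, 0 ≤ s → ∀ η : 𝓢(E5, ℂ), Integrable fun x => η x * ((β s x).im : ℂ) :=
    fun s hs η => (h.energy s hs).im_fourier.1.integrable_left η
  have split : ∀ s, 0 ≤ s → ∀ η : 𝓢(E5, ℂ), ∫ x, η x * β s x =
      (∫ x, η x * ((β s x).re : ℂ)) + Complex.I * ∫ x, η x * ((β s x).im : ℂ) := fun s hs η => by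
    rw [← integral_const_mul, ← integral_add (iR s hs η) ((iI s hs η).const_mul _)]
    refine integral_congr_ae (ae_of_all _ fun x => ?_)
    simp only
    conv_lhs => rw [← Complex.re_add_im (β s x)]
    ring
  set ψc : 𝓢(E5, ℂ) := ψ.postcompCLM (Complex.conjCLE : ℂ →L[ℝ] ℂ) with hψc
  have c0 : ∀ x, ψc x = conj (ψ x) := fun x => by simp [hψc]
  have c1 : ∀ x, (Δ ψc) x = conj ((Δ ψ) x) := fun x => by
    rw [SchwartzMap.laplacian_apply, SchwartzMap.laplacian_apply]
    have h1 : (ψc : E5 → ℂ) = (Complex.conjCLE : ℂ →L[ℝ] ℂ) ∘ ψ := by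
      ext x; rw [c0]; simp
    rw [h1, ContDiffAt.laplacian_CLM_comp_left (ψ.contDiffAt 2)]
    simp
  have conj_int : ∀ (m : E5 → ℂ) (f : E5 → ℝ),
      conj (∫ x, conj (m x) * (f x : ℂ)) = ∫ x, m x * (f x : ℂ) := fun m f => by
    rw [← integral_conj]; simp
  have f1 := h.field ψ t ht
  have f2 := (h.field ψc t ht).star
  simp only [split t ht, c0, c1, Complex.star_def, map_mul, map_add, map_neg, Complex.conj_I,
    conj_int, Complex.conj_ofReal] at f1 f2
  have e1 : ∀ s, 0 ≤ s → conj (∫ x, conj (ψ x) * β s x) =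
      (∫ x, ψ x * ((β s x).re : ℂ)) - Complex.I * ∫ x, ψ x * ((β s x).im : ℂ) := fun s hs => by
    have := split s hs ψc
    simp only [c0] at this
    rw [this, map_add, map_mul, conj_int, conj_int, Complex.conj_I]
    ring
  have e2 : conj (∫ x, conj ((Δ ψ) x) * β t x) =
      (∫ x, (Δ ψ) x * ((β t x).re : ℂ)) - Complex.I * ∫ x, (Δ ψ) x * ((β t x).im : ℂ) := by
    have := split t ht (Δ ψc)
    simp only [c1] at this
    rw [this, map_add, map_mul, conj_int, conj_int, Complex.conj_I]
    ring
  simp only [e2] at f2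
  constructor
  · refine (((f1.add f2).const_mul (1 / 2 : ℂ)).congr (fun s hs => ?_) ?_).congr_deriv ?_
    · simp only [Pi.add_apply, split s hs, e1 s hs]; ring
    · simp only [Pi.add_apply, split t ht, e1 t ht]; ring
    · linear_combination (∫ x, (Δ ψ) x * ((β t x).im : ℂ)) * Complex.I_sq
  · refine (((f1.sub f2).const_mul (-Complex.I / 2 : ℂ)).congr (fun s hs => ?_) ?_).congr_deriv ?_
    · simp only [Pi.sub_apply, split s hs, e1 s hs]
      linear_combination (∫ x, ψ x * ((β s x).im : ℂ)) * Complex.I_sq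
    · simp only [Pi.sub_apply, split t ht, e1 t ht]
      linear_combination (∫ x, ψ x * ((β t x).im : ℂ)) * Complex.I_sq
    · linear_combination (-(∫ x, (Δ ψ) x * ((β t x).re : ℂ)) + (∫ x, ψ x * ((β t x).re : ℂ)) +
        (Real.sqrt ρ₀ : ℂ) * ∫ x, ψ x * (shifted W (X t) x : ℂ)) * Complex.I_sq

lemma weak_fourier (h : IsSolution ρ₀ W X P β) (hW : Integrable W) (χ : 𝓢(E5, ℂ)) (t : ℝ)
    (ht : 0 ≤ t) :
    HasDerivWithinAt (fun s => ∫ ξ, χ ξ * reHat β s ξ)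
      (∫ ξ, χ ξ * (((‖ξ‖ ^ 2 : ℝ) : ℂ) * imHat β t ξ)) (Set.Ici 0) t ∧
    HasDerivWithinAt (fun s => ∫ ξ, χ ξ * imHat β s ξ)
      (∫ ξ, χ ξ * (-(((jb ξ ^ 2 : ℝ) : ℂ) * reHat β t ξ) -
        (Real.sqrt ρ₀ : ℂ) * (Complex.exp (-(Complex.I * (inner ℝ (X t) ξ : ℝ))) *
          FT (shifted W 0) ξ))) (Set.Ici 0) t := by
  obtain ⟨f1, f2⟩ := h.field_aux (FS χ) t ht
  have hm : (fun ξ : E5 => -((‖ξ‖ ^ 2 : ℝ) : ℂ)).HasTemperateGrowth := by fun_prop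
  set χ' := SchwartzMap.smulLeftCLM ℂ (fun ξ : E5 => -((‖ξ‖ ^ 2 : ℝ) : ℂ)) χ with hχ'
  have eχ : ∀ ξ, χ' ξ = -((‖ξ‖ ^ 2 : ℝ) : ℂ) * χ ξ := fun ξ => by
    rw [hχ', SchwartzMap.smulLeftCLM_apply_apply hm, smul_eq_mul]
  rw [laplacian_FS] at f1 f2
  have aR := fun s hs => (h.energy s hs).re_fourier.1
  have aI := fun s hs => (h.energy s hs).im_fourier.1
  have hWX : IsFourier (fun x => (shifted W (X t) x : ℂ)) (FT (shifted W (X t))) :=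
    isFourier_FT (hW.comp_sub_left _)
  constructor
  · refine (f1.congr (fun s hs => (aR s hs).integral_eq χ)
      ((aR t ht).integral_eq χ)).congr_deriv ?_
    rw [← (aI t ht).integral_eq, ← integral_neg]
    refine integral_congr_ae (ae_of_all _ fun ξ => ?_)
    simp only [← hχ', eχ, imHat]; ring
  · refine (f2.congr (fun s hs => (aI s hs).integral_eq χ)
      ((aI t ht).integral_eq χ)).congr_deriv ?_
    rw [← (aR t ht).integral_eq, ← (aR t ht).integral_eq, ← hWX.integral_eq, ← integral_const_mul,
      ← integral_sub ((aR t ht).integrable_right _) ((aR t ht).integrable_right _)]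
    refine (integral_sub (((aR t ht).integrable_right _).sub ((aR t ht).integrable_right _))
      ((hWX.integrable_right _).const_mul _)).symm.trans ?_
    refine integral_congr_ae (ae_of_all _ fun ξ => ?_)
    simp only [Pi.sub_apply, ← hχ', eχ, reHat, FT_shifted W (X t), jb_sq]
    push_cast
    ring

end IsSolution

/-! ### Duhamel's formula -/

lemma memLp_weight {m : E5 → ℂ} (hm : Continuous m) {C : ℝ}
    (hb : ∀ ξ, ‖m ξ‖ ≤ C * (1 + ‖ξ‖ ^ 2) ^ 2) (χ : 𝓢(E5, ℂ)) : MemLp (fun ξ => m ξ * χ ξ) 2 := by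
  have hg : (fun ξ : E5 => (((1 + ‖ξ‖ ^ 2) ^ 2 : ℝ) : ℂ)).HasTemperateGrowth := by fun_prop
  have h1 := (SchwartzMap.memLp (SchwartzMap.smulLeftCLM ℂ
    (fun ξ : E5 => (((1 + ‖ξ‖ ^ 2) ^ 2 : ℝ) : ℂ)) χ) 2 volume).const_mul (C : ℂ)
  refine h1.of_le (hm.mul χ.continuous).aestronglyMeasurable (ae_of_all _ fun ξ => ?_)
  rw [SchwartzMap.smulLeftCLM_apply_apply hg, smul_eq_mul, norm_mul, norm_mul, norm_mul, ← mul_assoc]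
  refine mul_le_mul_of_nonneg_right ((hb ξ).trans ?_) (norm_nonneg _)
  rw [Complex.norm_real, Complex.norm_real, Real.norm_eq_abs, Real.norm_eq_abs,
    abs_of_nonneg (by positivity : (0 : ℝ) ≤ (1 + ‖ξ‖ ^ 2) ^ 2)]
  exact mul_le_mul_of_nonneg_right (le_abs_self C) (by positivity)

/-- Weighted Schwartz functions still separate points of L² when the weight vanishes only at the
origin, a null set. This permits the non-smooth weight `|ξ|`. -/
lemma ae_eq_zero_of_weight {m : E5 → ℂ} (hm : Continuous m) {C : ℝ}
    (hb : ∀ ξ, ‖m ξ‖ ≤ C * (1 + ‖ξ‖ ^ 2) ^ 2) (h0 : ∀ ξ, ξ ≠ 0 → m ξ ≠ 0) {x : E5 → ℂ}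
    (hx : MemLp x 2) (h : ∀ χ : 𝓢(E5, ℂ), ∫ ξ, m ξ * χ ξ * x ξ = 0) : x =ᵐ[volume] 0 := by
  have h1 : (fun ξ => m ξ * x ξ) =ᵐ[volume] fun _ => 0 := by
    refine ae_eq_of_schwartz (fun ψ => ?_) (fun ψ => by simp) fun ψ => ?_
    · refine ((memLp_weight hm hb ψ).integrable_mul hx).congr (ae_of_all _ fun ξ => ?_)
      simp only [Pi.mul_apply]; ring
    · rw [← (by simpa using h ψ : ∫ ξ, m ξ * ψ ξ * x ξ = ∫ ξ, ψ ξ * (0 : ℂ))]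
      exact integral_congr_ae (ae_of_all _ fun ξ => by simp only; ring)
  have h2 : ∀ᵐ ξ : E5, ξ ≠ 0 := compl_mem_ae_iff.2 (measure_singleton 0)
  filter_upwards [h1, h2] with ξ a1 a2
  exact (mul_eq_zero.1 a1).resolve_left (h0 ξ a2)

/-- The ratio `|ξ| / ⟨ξ⟩`. -/
def ratio (ξ : E5) : ℝ := ‖ξ‖ / jb ξ

lemma continuous_ratio : Continuous ratio :=
  continuous_norm.div continuous_jb fun ξ => (jb_pos ξ).ne'

lemma ratio_nonneg (ξ : E5) : 0 ≤ ratio ξ := div_nonneg (norm_nonneg _) (jb_pos ξ).le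

lemma ratio_le_one (ξ : E5) : ratio ξ ≤ 1 := div_le_one_of_le₀ (norm_le_jb ξ) (jb_pos ξ).le

lemma norm_ratio_le (ξ : E5) : ‖(ratio ξ : ℂ)‖ ≤ 1 := by
  rw [Complex.norm_real, Real.norm_eq_abs, abs_of_nonneg (ratio_nonneg ξ)]; exact ratio_le_one ξ

lemma norm_inv_jb_sq_le (ξ : E5) : ‖((jb ξ : ℂ) ^ 2)⁻¹‖ ≤ 1 := by
  rw [norm_inv, norm_pow, Complex.norm_real, Real.norm_eq_abs, abs_of_pos (jb_pos ξ)]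
  exact inv_le_one_of_one_le₀ (one_le_pow₀ (one_le_jb ξ))

lemma continuous_inv_jb_sq : Continuous fun ξ => ((jb ξ : ℂ) ^ 2)⁻¹ := by
  have := continuous_jb
  exact Continuous.inv₀ (by fun_prop) fun ξ => pow_ne_zero _ (by exact_mod_cast (jb_pos ξ).ne')

lemma IsPotential.memLp_coord {n : ℝ} {V W : E5 → ℝ} (h : IsPotential n V W) (j : Fin 5) :
    MemLp (fun ξ => conj (Complex.I * (ξ j : ℂ) * FT (shifted W 0) ξ)) 2 := by
  refine memLp_conj (h.memLp_of_le (Continuous.aestronglyMeasurable (by fun_prop)) 1 fun ξ => ?_)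
  rw [norm_mul, Complex.norm_I, Complex.norm_real, Real.norm_eq_abs]
  nlinarith [abs_coord_le ξ j, norm_nonneg ξ, sq_nonneg (‖ξ‖ - 1), sq_nonneg (‖ξ‖ ^ 2)]

lemma IsPotential.integrable_coord {n : ℝ} {V W : E5 → ℝ} (h : IsPotential n V W) (j : Fin 5)
    {m : E5 → ℂ} (hm : AEStronglyMeasurable m volume) (C : ℝ)
    (hb : ∀ ξ, ‖m ξ‖ ≤ C * (1 + ‖ξ‖ ^ 2) ^ 2) :
    Integrable fun ξ => conj (Complex.I * (ξ j : ℂ) * FT (shifted W 0) ξ) *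
      (m ξ * FT (shifted W 0) ξ) :=
  (h.memLp_coord j).integrable_mul (h.memLp_of_le hm C hb)

namespace IsSolution

variable {n ρ₀ : ℝ} {V W : E5 → ℝ} {X P : ℝ → E5} {β : ℝ → E5 → ℂ}

/-- The Fourier transform of the source, divided by `⟨ξ⟩² / |ξ|`. -/
lemma contL2_source (h : IsSolution ρ₀ W X P β) (hW : IsPotential n V W) :
    ContL2 fun s ξ => Complex.exp (Complex.I * (-(inner ℝ (X (max s 0)) ξ) : ℝ)) *
      ((Real.sqrt ρ₀ : ℂ) * (‖ξ‖ : ℂ) * ((jb ξ : ℂ) ^ 2)⁻¹ * FT (shifted W 0) ξ) := by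
  have hX := h.continuous_X
  have hj := continuous_inv_jb_sq
  refine ContL2.of_phase (θ := fun s ξ => -(inner ℝ (X (max s 0)) ξ)) (hW.memLp_of_le
    (Continuous.aestronglyMeasurable (by fun_prop)) (Real.sqrt ρ₀) fun ξ => ?_)
    (fun s => by fun_prop) (fun ξ => (hX.inner continuous_const).neg)
  rw [norm_mul, norm_mul, Complex.norm_real, Complex.norm_real, Real.norm_eq_abs,
    abs_of_nonneg (Real.sqrt_nonneg _), norm_norm, mul_assoc]
  refine mul_le_mul_of_nonneg_left ?_ (Real.sqrt_nonneg _)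
  refine (mul_le_of_le_one_right (norm_nonneg _) (norm_inv_jb_sq_le ξ)).trans ?_
  nlinarith [norm_nonneg ξ, sq_nonneg (‖ξ‖ - 1), sq_nonneg (‖ξ‖ ^ 2)]

/-- The energy space controls `⟨ξ⟩ Re β̂` and `|ξ| Im β̂`, whereas the equation loses two
derivatives. Dividing by `⟨ξ⟩²` gives curves `Re β̂/⟨ξ⟩` and `|ξ| Im β̂/⟨ξ⟩²` that are continuous in
L² together with their formal derivatives; the weak equation makes these genuine. -/
lemma duhamel_curves (h : IsSolution ρ₀ W X P β) (hW : IsPotential n V W) :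
    ∃ (hU : ContL2 fun s ξ => ((jb ξ : ℂ) ^ 2)⁻¹ * ((jb ξ : ℂ) * reHat β (max s 0) ξ))
      (hU' : ContL2 fun s ξ => (ratio ξ : ℂ) * ((‖ξ‖ : ℂ) * imHat β (max s 0) ξ))
      (hV : ContL2 fun s ξ => ((jb ξ : ℂ) ^ 2)⁻¹ * ((‖ξ‖ : ℂ) * imHat β (max s 0) ξ))
      (hV' : ContL2 fun s ξ => -(ratio ξ : ℂ) * ((jb ξ : ℂ) * reHat β (max s 0) ξ) +
        -1 * (Complex.exp (Complex.I * (-(inner ℝ (X (max s 0)) ξ) : ℝ)) *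
        ((Real.sqrt ρ₀ : ℂ) * (‖ξ‖ : ℂ) * ((jb ξ : ℂ) ^ 2)⁻¹ * FT (shifted W 0) ξ))),
      ∀ t, 0 ≤ t →
        HasDerivWithinAt (fun s => (hU.memLp s).toLp _) ((hU'.memLp t).toLp _) (Set.Ici 0) t ∧
        HasDerivWithinAt (fun s => (hV.memLp s).toLp _) ((hV'.memLp t).toLp _) (Set.Ici 0) t := by
  obtain ⟨hA, hB⟩ := h.contL2_aux
  have hr := continuous_ratio
  have hj := continuous_jb
  have hrm : AEStronglyMeasurable (fun ξ => (ratio ξ : ℂ)) volume :=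
    Continuous.aestronglyMeasurable (by fun_prop)
  have hU := hA.mul_bdd continuous_inv_jb_sq.aestronglyMeasurable norm_inv_jb_sq_le
  have hV := hB.mul_bdd continuous_inv_jb_sq.aestronglyMeasurable norm_inv_jb_sq_le
  have hU' := hB.mul_bdd hrm norm_ratio_le
  have hV' := (hA.mul_bdd (m := fun ξ => -(ratio ξ : ℂ)) hrm.neg
    (fun ξ => (norm_neg _).trans_le (norm_ratio_le ξ))).add
    ((h.contL2_source hW).mul_bdd (m := fun _ => -1) aestronglyMeasurable_const (C := 1)
      (fun ξ => by simp))
  have hjc : ∀ ξ, (jb ξ : ℂ) ≠ 0 := fun ξ => by exact_mod_cast (jb_pos ξ).ne'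
  have hjb : ∀ ξ, ‖(jb ξ : ℂ)‖ ≤ 1 * (1 + ‖ξ‖ ^ 2) ^ 2 := fun ξ => by
    rw [Complex.norm_real, Real.norm_eq_abs, abs_of_pos (jb_pos ξ), ← jb_sq]
    nlinarith [one_le_jb ξ, one_le_pow₀ (n := 3) (one_le_jb ξ)]
  have hjb' : ∀ ξ, ‖(jb ξ : ℂ) ^ 2 * (‖ξ‖ : ℂ)‖ ≤ 1 * (1 + ‖ξ‖ ^ 2) ^ 2 := fun ξ => by
    rw [norm_mul, norm_pow, Complex.norm_real, Complex.norm_real, norm_norm, Real.norm_eq_abs,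
      abs_of_pos (jb_pos ξ), ← jb_sq, one_mul, sq (jb ξ ^ 2)]
    refine mul_le_mul_of_nonneg_left ((norm_le_jb ξ).trans ?_) (by positivity)
    nlinarith [one_le_jb ξ]
  refine ⟨hU, hU', hV, hV', fun t ht => ⟨?_, ?_⟩⟩
  · refine hU.hasDerivWithinAt_of_weak hU'
      (T := {d | ∃ χ : 𝓢(E5, ℂ), d = fun ξ => (jb ξ : ℂ) * χ ξ}) ?_ ?_ ?_ t ht
    · rintro _ ⟨χ, rfl⟩
      exact memLp_weight (by fun_prop) hjb χ
    · intro x hx hd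
      exact ae_eq_zero_of_weight (m := fun ξ => (jb ξ : ℂ)) (by fun_prop) hjb (fun ξ _ => hjc ξ) hx
        fun χ => hd _ ⟨χ, rfl⟩
    · rintro _ ⟨χ, rfl⟩ s hs
      refine ((h.weak_fourier hW.integrable_W χ s hs).1.congr (fun r hr => ?_) ?_).congr_deriv ?_
      · refine integral_congr_ae (ae_of_all _ fun ξ => ?_)
        have := hjc ξ
        simp only [max_eq_left (Set.mem_Ici.1 hr)]; field_simp
      · refine integral_congr_ae (ae_of_all _ fun ξ => ?_)
        have := hjc ξ
        simp only [max_eq_left hs]; field_simp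
      · refine integral_congr_ae (ae_of_all _ fun ξ => ?_)
        have := hjc ξ
        simp only [max_eq_left hs, ratio]; push_cast; field_simp
  · refine hV.hasDerivWithinAt_of_weak hV'
      -- The extra factor `|ξ|` is deliberate: against the weight `|ξ|/⟨ξ⟩²` of the curve it leaves
      -- `|ξ|² χ`, which is Schwartz, whereas `|ξ| χ` need not be.
      (T := {d | ∃ χ : 𝓢(E5, ℂ), d = fun ξ => (jb ξ : ℂ) ^ 2 * (‖ξ‖ : ℂ) * χ ξ}) ?_ ?_ ?_ t ht
    · rintro _ ⟨χ, rfl⟩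
      exact memLp_weight (by fun_prop) hjb' χ
    · intro x hx hd
      refine ae_eq_zero_of_weight (m := fun ξ => (jb ξ : ℂ) ^ 2 * (‖ξ‖ : ℂ)) (by fun_prop) hjb'
        (fun ξ hξ => ?_) hx fun χ => hd _ ⟨χ, rfl⟩
      exact mul_ne_zero (pow_ne_zero _ (hjc ξ)) (by exact_mod_cast (norm_pos_iff.2 hξ).ne')
    · rintro _ ⟨χ, rfl⟩ s hs
      have hm : (fun ξ : E5 => ((‖ξ‖ ^ 2 : ℝ) : ℂ)).HasTemperateGrowth := by fun_prop
      have eχ : ∀ ξ, SchwartzMap.smulLeftCLM ℂ (fun ξ : E5 => ((‖ξ‖ ^ 2 : ℝ) : ℂ)) χ ξ =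
          ((‖ξ‖ ^ 2 : ℝ) : ℂ) * χ ξ := fun ξ => by
        rw [SchwartzMap.smulLeftCLM_apply_apply hm, smul_eq_mul]
      refine ((h.weak_fourier hW.integrable_W (SchwartzMap.smulLeftCLM ℂ
        (fun ξ : E5 => ((‖ξ‖ ^ 2 : ℝ) : ℂ)) χ) s hs).2.congr (fun r hr => ?_) ?_).congr_deriv ?_
      · refine integral_congr_ae (ae_of_all _ fun ξ => ?_)
        have := hjc ξ
        simp only [max_eq_left (Set.mem_Ici.1 hr), eχ]; push_cast; field_simp
      · refine integral_congr_ae (ae_of_all _ fun ξ => ?_)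
        have := hjc ξ
        simp only [max_eq_left hs, eχ]; push_cast; field_simp
      · refine integral_congr_ae (ae_of_all _ fun ξ => ?_)
        have := hjc ξ
        simp only [max_eq_left hs, ratio, eχ]
        push_cast
        rw [mul_neg]
        field_simp
        ring

/-- For `w = Re β̂ - iσ(|ξ|/⟨ξ⟩) Im β̂` the equations combine to `w' = iσφ₁ w + iσ(|ξ|/⟨ξ⟩)√ρ₀
e^{-iX·ξ} Û`. Pairing with a test function that rotates with `e^{isσφ₁}` removes the first term, and
the rest is integrated from `0` to `t`. -/
lemma duhamel (h : IsSolution ρ₀ W X P β) (hW : IsPotential n V W) {σ : ℝ} (hσ : σ ^ 2 = 1)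
    (j : Fin 5) (t : ℝ) (ht : 0 ≤ t) :
    ∫ ξ, conj (Complex.I * (ξ j : ℂ) * FT (shifted W 0) ξ) *
      (Complex.exp (Complex.I * (inner ℝ (X t) ξ : ℝ)) *
        (reHat β t ξ - Complex.I * σ * ratio ξ * imHat β t ξ)) =
    (∫ ξ, conj (Complex.I * (ξ j : ℂ) * FT (shifted W 0) ξ) *
      (Complex.exp (Complex.I * ((σ * t * phi1 ξ + inner ℝ (X t) ξ : ℝ) : ℂ)) *
        (reHat β 0 ξ - Complex.I * σ * ratio ξ * imHat β 0 ξ))) +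
    Complex.I * σ * Real.sqrt ρ₀ * ∫ ξ, conj (Complex.I * (ξ j : ℂ) * FT (shifted W 0) ξ) *
      (ratio ξ * FT (shifted W 0) ξ * ∫ s in (0 : ℝ)..t,
        Complex.exp (Complex.I * ((inner ℝ (X t - X s) ξ + σ * (t - s) * phi1 ξ : ℝ) : ℂ))) := by
  obtain ⟨hU, hU', hV, hV', hd⟩ := h.duhamel_curves hW
  have hX := h.continuous_X
  have hφ := continuous_phi1
  have hjc := continuous_jb
  have hr := continuous_ratio
  have hσ1 : |σ| = 1 := by rw [← sq_eq_sq₀ (abs_nonneg _) zero_le_one, sq_abs, hσ, one_pow]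
  have hj0 : ∀ ξ, (jb ξ : ℂ) ≠ 0 := fun ξ => by exact_mod_cast (jb_pos ξ).ne'
  set ph : E5 → ℂ := fun ξ => Complex.exp (Complex.I * (-(σ * t * phi1 ξ + inner ℝ (X t) ξ) : ℝ))
    with hph
  have hphc : Continuous ph := by fun_prop
  have hjn : ∀ ξ, ‖(jb ξ : ℂ)‖ = jb ξ := fun ξ => by
    rw [Complex.norm_real, Real.norm_eq_abs, abs_of_pos (jb_pos ξ)]
  -- The factor `⟨ξ⟩` undoes the weights of `duhamel_curves`; `ph` freezes the phase at the final
  -- time `t`.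
  set K : E5 → ℂ := fun ξ => ph ξ * (jb ξ : ℂ) * (Complex.I * (ξ j : ℂ)) * FT (shifted W 0) ξ
    with hK
  have hKmem : MemLp K 2 := by
    refine hW.memLp_of_le (Continuous.aestronglyMeasurable (by fun_prop)) 1 fun ξ => ?_
    rw [norm_mul, norm_mul, hph, norm_exp_I, hjn, norm_mul, Complex.norm_I, Complex.norm_real,
      Real.norm_eq_abs, one_mul, one_mul, one_mul, ← jb_sq]
    have := (abs_coord_le ξ j).trans (norm_le_jb ξ)
    nlinarith [one_le_jb ξ, one_le_pow₀ (n := 2) (one_le_jb ξ), abs_nonneg (ξ j),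
      sq_nonneg (jb ξ ^ 2 - 1)]
  -- The multiplier `φ₁⟨ξ⟩|ξ_j|` grows like `⟨ξ⟩⁴`, which exhausts the regularity `W ∈ H⁴`.
  have hφK : MemLp (fun ξ => Complex.I * ((σ * phi1 ξ : ℝ) : ℂ) * K ξ) 2 := by
    have := hW.memLp_of_le (m := fun ξ => Complex.I * ((σ * phi1 ξ : ℝ) : ℂ) *
      (ph ξ * (jb ξ : ℂ) * (Complex.I * (ξ j : ℂ))))
      (Continuous.aestronglyMeasurable (by fun_prop)) 1 fun ξ => ?_
    · simpa only [hK, mul_assoc] using this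
    · rw [norm_mul, norm_mul, norm_mul, norm_mul, hph, norm_exp_I, hjn, norm_mul, Complex.norm_I,
        Complex.norm_real, Complex.norm_real, Real.norm_eq_abs, Real.norm_eq_abs, abs_mul, hσ1,
        abs_of_nonneg (phi1_nonneg ξ), one_mul, one_mul, one_mul, one_mul, one_mul, ← jb_sq,
        phi1_eq]
      have h1 := (abs_coord_le ξ j).trans (norm_le_jb ξ)
      have h2 := norm_le_jb ξ
      calc ‖ξ‖ * jb ξ * (jb ξ * |ξ j|) ≤ jb ξ * jb ξ * (jb ξ * jb ξ) := by
            have := (jb_pos ξ).le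
            gcongr
        _ = (jb ξ ^ 2) ^ 2 := by ring
  have hC : ContL2 fun s ξ => Complex.exp (Complex.I * ((s * (σ * phi1 ξ) : ℝ) : ℂ)) * K ξ :=
    ContL2.of_phase (θ := fun s ξ => s * (σ * phi1 ξ)) hKmem (fun s => by fun_prop)
      fun ξ => by fun_prop
  have hC' : ContL2 fun s ξ => Complex.exp (Complex.I * ((s * (σ * phi1 ξ) : ℝ) : ℂ)) *
      (Complex.I * ((σ * phi1 ξ : ℝ) : ℂ) * K ξ) :=
    ContL2.of_phase (θ := fun s ξ => s * (σ * phi1 ξ)) hφK (fun s => by fun_prop)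
      fun ξ => by fun_prop
  have hS := h.contL2_source hW
  set Q : ℝ → ℂ := fun s =>
    (∫ ξ, conj (Complex.exp (Complex.I * ((s * (σ * phi1 ξ) : ℝ) : ℂ)) * K ξ) *
      (((jb ξ : ℂ) ^ 2)⁻¹ * ((jb ξ : ℂ) * reHat β (max s 0) ξ))) + (-Complex.I * σ) *
    ∫ ξ, conj (Complex.exp (Complex.I * ((s * (σ * phi1 ξ) : ℝ) : ℂ)) * K ξ) *
      (((jb ξ : ℂ) ^ 2)⁻¹ * ((‖ξ‖ : ℂ) * imHat β (max s 0) ξ)) with hQ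
  set q : ℝ → ℂ := fun s => ∫ ξ, conj (Complex.exp (Complex.I * ((s * (σ * phi1 ξ) : ℝ) : ℂ)) *
      K ξ) * (Complex.exp (Complex.I * (-(inner ℝ (X (max s 0)) ξ) : ℝ)) *
        ((Real.sqrt ρ₀ : ℂ) * (‖ξ‖ : ℂ) * ((jb ξ : ℂ) ^ 2)⁻¹ * FT (shifted W 0) ξ)) with hq
  have hQc : Continuous Q := (hC.continuous_pairing hU).add
    (continuous_const.mul (hC.continuous_pairing hV))
  have hqc : Continuous q := hC.continuous_pairing hS
  -- The free terms cancel because `σ² = 1`; only the source survives.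
  have hQd : ∀ s, 0 ≤ s → HasDerivWithinAt Q (Complex.I * σ * q s) (Set.Ici 0) s := fun s hs => by
    have hK1 := hasDerivWithinAt_osc hφK hC hC' s hs
    have p1 := hC.hasDerivWithinAt_pairing hC' hU hU' hK1 (hd s hs).1
    have p2 := hC.hasDerivWithinAt_pairing hC' hV hV' hK1 (hd s hs).2
    refine (p1.add (p2.const_mul (-Complex.I * σ))).congr_deriv ?_
    have i1 := (memLp_conj (hC.memLp s)).integrable_mul (hU'.memLp s)
    have i2 := (memLp_conj (hC'.memLp s)).integrable_mul (hU.memLp s)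
    have i3 := (memLp_conj (hC.memLp s)).integrable_mul (hV'.memLp s)
    have i4 := (memLp_conj (hC'.memLp s)).integrable_mul (hV.memLp s)
    rw [← integral_const_mul]
    refine (congrArg₂ (· + ·) (integral_add i1 i2).symm ((congrArg _
      (integral_add i3 i4).symm).trans (integral_const_mul _ _).symm)).trans ?_
    refine (integral_add (i1.add i2) ((i3.add i4).const_mul (-Complex.I * σ))).symm.trans ?_
    refine integral_congr_ae (ae_of_all _ fun ξ => ?_)
    have hσc : (σ : ℂ) ^ 2 = 1 := by exact_mod_cast hσ
    have := hj0 ξ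
    simp only [Pi.add_apply, Pi.mul_apply, map_mul, Complex.conj_I, Complex.conj_ofReal, ratio,
      phi1_eq]
    push_cast
    field_simp
    ring_nf
    simp only [Complex.I_sq, hσc]
    ring
  have hftc : ∫ s in (0 : ℝ)..t, Complex.I * σ * q s = Q t - Q 0 := by
    refine intervalIntegral.integral_eq_sub_of_hasDeriv_right_of_le ht hQc.continuousOn
      (fun s hs => ?_) ?_
    · exact (hQd s hs.1.le).mono fun y hy => (hs.1.trans hy).le
    · exact Continuous.intervalIntegrable (by fun_prop) _ _
  set G : E5 → ℂ := fun ξ => conj (Complex.I * (ξ j : ℂ) * FT (shifted W 0) ξ) *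
    ((Real.sqrt ρ₀ * ratio ξ : ℂ) * FT (shifted W 0) ξ) with hG
  have hGi : Integrable G := hW.integrable_coord j (Continuous.aestronglyMeasurable (by fun_prop))
    (Real.sqrt ρ₀) fun ξ => by
      rw [norm_mul, Complex.norm_real, Real.norm_eq_abs, abs_of_nonneg (Real.sqrt_nonneg _)]
      refine mul_le_mul_of_nonneg_left ((norm_ratio_le ξ).trans ?_) (Real.sqrt_nonneg _)
      nlinarith [sq_nonneg ‖ξ‖, sq_nonneg (‖ξ‖ ^ 2)]
  have hqG : ∀ s, q s = ∫ ξ, Complex.exp (Complex.I *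
      ((inner ℝ (X t - X (max s 0)) ξ + σ * (t - s) * phi1 ξ : ℝ) : ℂ)) * G ξ := fun s => by
    refine integral_congr_ae (ae_of_all _ fun ξ => ?_)
    have := hj0 ξ
    have he : Complex.exp (Complex.I *
        ((inner ℝ (X t - X (max s 0)) ξ + σ * (t - s) * phi1 ξ : ℝ) : ℂ)) =
        conj (Complex.exp (Complex.I * ((s * (σ * phi1 ξ) : ℝ) : ℂ))) * conj (ph ξ) *
        Complex.exp (Complex.I * (-(inner ℝ (X (max s 0)) ξ) : ℝ)) := by
      rw [hph, ← Complex.exp_conj, ← Complex.exp_conj, ← Complex.exp_add, ← Complex.exp_add,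
        map_mul, map_mul, Complex.conj_I, Complex.conj_ofReal, Complex.conj_ofReal,
        inner_sub_left]
      congr 1
      push_cast
      ring
    simp only [he, hG, hK, map_mul, Complex.conj_ofReal, Complex.conj_I, ratio]
    push_cast
    field_simp
  have hswap : ∫ s in (0 : ℝ)..t, q s = ∫ ξ, ∫ s in (0 : ℝ)..t, Complex.exp (Complex.I *
      ((inner ℝ (X t - X (max s 0)) ξ + σ * (t - s) * phi1 ξ : ℝ) : ℂ)) * G ξ := by
    simp only [hqG]
    refine intervalIntegral_integral_swap ?_
    have : IsFiniteMeasure ((volume : Measure ℝ).restrict (Set.uIoc 0 t)) :=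
      ⟨by rw [Measure.restrict_apply_univ, Set.uIoc_of_le ht]; exact measure_Ioc_lt_top⟩
    refine (hGi.comp_snd ((volume : Measure ℝ).restrict (Set.uIoc 0 t))).bdd_mul (c := 1)
      (Continuous.aestronglyMeasurable ?_) (ae_of_all _ fun z => (norm_exp_I _).le)
    have h1 : Continuous fun z : ℝ × E5 => X (max z.1 0) := hX.comp continuous_fst
    have h2 : Continuous fun z : ℝ × E5 => inner ℝ (X t - X (max z.1 0)) z.2 :=
      (continuous_const.sub h1).inner continuous_snd
    have h3 : Continuous fun z : ℝ × E5 => phi1 z.2 := hφ.comp continuous_snd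
    fun_prop
  have hmid : ∀ ξ, ∫ s in (0 : ℝ)..t, Complex.exp (Complex.I *
      ((inner ℝ (X t - X (max s 0)) ξ + σ * (t - s) * phi1 ξ : ℝ) : ℂ)) * G ξ =
      (Real.sqrt ρ₀ : ℂ) * (conj (Complex.I * (ξ j : ℂ) * FT (shifted W 0) ξ) *
      (ratio ξ * FT (shifted W 0) ξ * ∫ s in (0 : ℝ)..t,
        Complex.exp (Complex.I *
          ((inner ℝ (X t - X s) ξ + σ * (t - s) * phi1 ξ : ℝ) : ℂ)))) := fun ξ => by
    rw [intervalIntegral.integral_mul_const, hG]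
    have : ∫ s in (0 : ℝ)..t, Complex.exp (Complex.I *
        ((inner ℝ (X t - X (max s 0)) ξ + σ * (t - s) * phi1 ξ : ℝ) : ℂ)) =
        ∫ s in (0 : ℝ)..t, Complex.exp (Complex.I *
          ((inner ℝ (X t - X s) ξ + σ * (t - s) * phi1 ξ : ℝ) : ℂ)) := by
      refine intervalIntegral.integral_congr fun s hs => ?_
      rw [Set.uIcc_of_le ht] at hs
      simp only [max_eq_left hs.1]
    rw [this]
    ring
  have hQval : ∀ s, 0 ≤ s → Q s = ∫ ξ, conj (Complex.I * (ξ j : ℂ) * FT (shifted W 0) ξ) *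
      (Complex.exp (Complex.I * ((σ * (t - s) * phi1 ξ + inner ℝ (X t) ξ : ℝ) : ℂ)) *
        (reHat β s ξ - Complex.I * σ * ratio ξ * imHat β s ξ)) := fun s hs => by
    have i1 := (memLp_conj (hC.memLp s)).integrable_mul (hU.memLp s)
    have i2 := (memLp_conj (hC.memLp s)).integrable_mul (hV.memLp s)
    simp only [hQ]
    rw [← integral_const_mul]
    refine (integral_add i1 (i2.const_mul _)).symm.trans
      (integral_congr_ae (ae_of_all _ fun ξ => ?_))
    have := hj0 ξ
    have he : Complex.exp (Complex.I *
        ((σ * (t - s) * phi1 ξ + inner ℝ (X t) ξ : ℝ) : ℂ)) =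
        conj (Complex.exp (Complex.I * ((s * (σ * phi1 ξ) : ℝ) : ℂ))) * conj (ph ξ) := by
      rw [hph, ← Complex.exp_conj, ← Complex.exp_conj, ← Complex.exp_add,
        map_mul, map_mul, Complex.conj_I, Complex.conj_ofReal, Complex.conj_ofReal]
      congr 1
      push_cast
      ring
    simp only [he, hK, map_mul, Complex.conj_ofReal, Complex.conj_I, ratio, max_eq_left hs,
      Pi.mul_apply]
    push_cast
    field_simp
    ring
  have e0 := hQval 0 le_rfl
  have et := hQval t ht
  simp only [sub_self, sub_zero, mul_zero, zero_mul, zero_add] at e0 et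
  rw [← e0, ← et, ← sub_eq_iff_eq_add', ← hftc, intervalIntegral.integral_const_mul, hswap]
  simp only [hmid]
  rw [integral_const_mul]
  ring

end IsSolution

/-! ### The equation of motion -/

/-- Multipliers of at most quadratic growth. -/
def QuadMultiplier (m : E5 → ℂ) : Prop :=
  AEStronglyMeasurable m volume ∧ ∃ C : ℝ, ∀ ξ, ‖m ξ‖ ≤ C * (1 + ‖ξ‖ ^ 2)

lemma QuadMultiplier.of_bound {m : E5 → ℂ} (hm : AEStronglyMeasurable m volume) (C : ℝ)
    (hC : ∀ ξ, ‖m ξ‖ ≤ C) : QuadMultiplier m :=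
  ⟨hm, C, fun ξ => (hC ξ).trans (le_mul_of_one_le_right ((norm_nonneg _).trans (hC ξ))
    (by nlinarith [sq_nonneg ‖ξ‖]))⟩

/-- Cauchy–Schwarz with `m` moved onto `ξ_j Û`. Quadratic growth is what `D1` needs, as its
numerator contains `φ₁ ≤ 1 + |ξ|²`. -/
lemma QuadMultiplier.integrable {n : ℝ} {V W : E5 → ℝ} (hW : IsPotential n V W) (j : Fin 5)
    {m a : E5 → ℂ} (hm : QuadMultiplier m) (ha : MemLp a 2) :
    Integrable fun ξ => conj (Complex.I * (ξ j : ℂ) * FT (shifted W 0) ξ) * (m ξ * a ξ) := by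
  obtain ⟨hm, C, hC⟩ := hm
  have h1 : MemLp (fun ξ => (conj (m ξ) * (Complex.I * (ξ j : ℂ))) * FT (shifted W 0) ξ) 2 := by
    refine hW.memLp_of_le ((Complex.continuous_conj.comp_aestronglyMeasurable hm).mul
      (Continuous.aestronglyMeasurable (by fun_prop))) C fun ξ => ?_
    rw [norm_mul, RCLike.norm_conj, norm_mul, Complex.norm_I, one_mul, Complex.norm_real,
      Real.norm_eq_abs, sq (1 + ‖ξ‖ ^ 2), ← mul_assoc]
    refine mul_le_mul (hC ξ) ((abs_coord_le ξ j).trans ?_) (abs_nonneg _)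
      ((norm_nonneg _).trans (hC ξ))
    nlinarith [sq_nonneg (‖ξ‖ - 1)]
  refine ((memLp_conj h1).integrable_mul ha).congr (ae_of_all _ fun ξ => ?_)
  simp only [Pi.mul_apply, map_mul, Complex.conj_conj]
  ring

/-- The two branches of `combine`. -/
def branch (a b : E5 → ℂ) (σ : ℝ) (ξ : E5) : ℂ := a ξ - Complex.I * σ * ratio ξ * b ξ

lemma combine_eq (a b : E5 → ℂ) (D : ℝ → E5 → ℂ) (ξ : E5) :
    combine a b D ξ = D 1 ξ * branch a b 1 ξ + D (-1) ξ * branch a b (-1) ξ := by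
  have h : b ξ * (‖ξ‖ : ℂ) / (Complex.I * (Real.sqrt (1 + ‖ξ‖ ^ 2) : ℂ)) =
      -(Complex.I * ratio ξ * b ξ) := by
    have h1 : (jb ξ : ℂ) ≠ 0 := by exact_mod_cast (jb_pos ξ).ne'
    rw [ratio]
    change b ξ * (‖ξ‖ : ℂ) / (Complex.I * (jb ξ : ℂ)) = _
    push_cast
    rw [div_eq_iff (mul_ne_zero Complex.I_ne_zero h1)]
    field_simp
    linear_combination (b ξ * (‖ξ‖ : ℂ)) * Complex.I_sq
  simp only [combine, h, branch]
  push_cast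
  ring

lemma memLp_branch {a b : E5 → ℂ} (ha : MemLp a 2) (hb : MemLp (fun ξ => (ratio ξ : ℂ) * b ξ) 2)
    (σ : ℝ) : MemLp (branch a b σ) 2 := by
  have := ha.sub (hb.const_mul (Complex.I * σ))
  refine (memLp_congr_ae (ae_of_all _ fun ξ => ?_)).1 this
  simp only [Pi.sub_apply, branch]; ring

lemma IsPotential.bracket_split {n : ℝ} {V W : E5 → ℝ} (hW : IsPotential n V W) (j : Fin 5)
    {a b : E5 → ℂ} (ha : MemLp a 2) (hb : MemLp (fun ξ => (ratio ξ : ℂ) * b ξ) 2)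
    {D : ℝ → E5 → ℂ} (hD : ∀ σ : ℝ, σ ^ 2 = 1 → QuadMultiplier (D σ)) :
    Integrable (bracketFun (shifted W 0) (combine a b D) j) ∧
    ∫ ξ, bracketFun (shifted W 0) (combine a b D) j ξ =
      (∫ ξ, conj (Complex.I * (ξ j : ℂ) * FT (shifted W 0) ξ) * (D 1 ξ * branch a b 1 ξ)) +
      ∫ ξ, conj (Complex.I * (ξ j : ℂ) * FT (shifted W 0) ξ) * (D (-1) ξ * branch a b (-1) ξ) := by
  have h1 := (hD 1 (by norm_num)).integrable hW j (memLp_branch ha hb 1)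
  have h2 := (hD (-1) (by norm_num)).integrable hW j (memLp_branch ha hb (-1))
  have e : ∀ ξ, bracketFun (shifted W 0) (combine a b D) j ξ =
      conj (Complex.I * (ξ j : ℂ) * FT (shifted W 0) ξ) * (D 1 ξ * branch a b 1 ξ) +
      conj (Complex.I * (ξ j : ℂ) * FT (shifted W 0) ξ) * (D (-1) ξ * branch a b (-1) ξ) :=
    fun ξ => by rw [bracketFun, combine_eq, mul_add]
  constructor
  · exact (h1.add h2).congr (ae_of_all _ fun ξ => (e ξ).symm)
  · rw [← integral_add h1 h2]
    exact integral_congr_ae (ae_of_all _ e)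

lemma IsPotential.integral_add_three {n : ℝ} {V W : E5 → ℝ} (hW : IsPotential n V W) (j : Fin 5)
    {a m₁ m₂ m₃ : E5 → ℂ} (ha : MemLp a 2) (h₁ : QuadMultiplier m₁) (h₂ : QuadMultiplier m₂)
    (h₃ : QuadMultiplier m₃) :
    (∫ ξ, conj (Complex.I * (ξ j : ℂ) * FT (shifted W 0) ξ) * (m₁ ξ * a ξ)) +
      (∫ ξ, conj (Complex.I * (ξ j : ℂ) * FT (shifted W 0) ξ) * (m₂ ξ * a ξ)) +
      (∫ ξ, conj (Complex.I * (ξ j : ℂ) * FT (shifted W 0) ξ) * (m₃ ξ * a ξ)) =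
    ∫ ξ, conj (Complex.I * (ξ j : ℂ) * FT (shifted W 0) ξ) * ((m₁ ξ + m₂ ξ + m₃ ξ) * a ξ) := by
  have i1 := h₁.integrable hW j ha
  have i2 := h₂.integrable hW j ha
  have i3 := h₃.integrable hW j ha
  rw [← integral_add i1 i2]
  refine (integral_add (i1.add i2) i3).symm.trans (integral_congr_ae (ae_of_all _ fun ξ => ?_))
  simp only [Pi.add_apply]; ring

/-! ### Bounds for the oscillating multipliers and their denominators -/

section den

variable {X P : ℝ → E5} {ε t σ : ℝ}

/-- The real part is the constant `-ε`, so resonances only affect the imaginary part. -/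
lemma den_norm_ge (hε : 0 < ε) (ξ : E5) : ε ≤ ‖den P ε t σ ξ‖ := by
  have h := Complex.abs_re_le_norm (den P ε t σ ξ)
  have : (den P ε t σ ξ).re = -ε := by
    simp only [den, Complex.sub_re, Complex.mul_re, Complex.I_re, Complex.I_im, Complex.ofReal_re,
      Complex.ofReal_im]
    ring
  rwa [this, abs_neg, abs_of_pos hε] at h

lemma den_ne (hε : 0 < ε) (ξ : E5) : den P ε t σ ξ ≠ 0 :=
  norm_pos_iff.1 (hε.trans_le (den_norm_ge hε ξ))

lemma continuous_den : Continuous (den P ε t σ) := by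
  have := continuous_phi1
  unfold den
  fun_prop

lemma continuous_osc : Continuous (osc X t σ) := by
  have := continuous_phi1
  unfold osc
  fun_prop

lemma norm_osc (ξ : E5) : ‖osc X t σ ξ‖ = 1 := norm_exp_I _

lemma continuous_osc_div (hε : 0 < ε) : Continuous fun ξ => osc X t σ ξ / den P ε t σ ξ :=
  continuous_osc.div continuous_den (den_ne hε)

lemma norm_osc_div_le (hε : 0 < ε) (ξ : E5) : ‖osc X t σ ξ / den P ε t σ ξ‖ ≤ 1 / ε := by
  rw [norm_div, norm_osc]
  exact one_div_le_one_div_of_le hε (den_norm_ge hε ξ)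

lemma quad_D4 (hε : 0 < ε) : QuadMultiplier (D4 X P ε t σ) :=
  .of_bound (continuous_osc_div hε).aestronglyMeasurable _ (norm_osc_div_le hε)

lemma quad_inv_den (hε : 0 < ε) : QuadMultiplier fun ξ => 1 / den P ε t σ ξ :=
  .of_bound (continuous_const.div continuous_den (den_ne hε)).aestronglyMeasurable (1 / ε)
    fun ξ => by
      rw [norm_div, norm_one]
      exact one_div_le_one_div_of_le hε (den_norm_ge hε ξ)

lemma QuadMultiplier.const_mul {m : E5 → ℂ} (hm : QuadMultiplier m) (c : ℂ) :
    QuadMultiplier fun ξ => c * m ξ := by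
  obtain ⟨h, C, hC⟩ := hm
  refine ⟨h.const_mul c, ‖c‖ * C, fun ξ => ?_⟩
  rw [norm_mul, mul_assoc]
  exact mul_le_mul_of_nonneg_left (hC ξ) (norm_nonneg _)

lemma QuadMultiplier.add {m m' : E5 → ℂ} (hm : QuadMultiplier m) (hm' : QuadMultiplier m') :
    QuadMultiplier fun ξ => m ξ + m' ξ := by
  obtain ⟨h, C, hC⟩ := hm
  obtain ⟨h', C', hC'⟩ := hm'
  refine ⟨h.add h', C + C', fun ξ => (norm_add_le _ _).trans ?_⟩
  rw [add_mul]
  exact add_le_add (hC ξ) (hC' ξ)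

lemma quad_DE1 (hε : 0 < ε) : QuadMultiplier (DE1 X P ε t σ) := (quad_D4 hε).const_mul _

lemma QuadMultiplier.mul_osc_div (hε : 0 < ε) {m : E5 → ℂ} (hm : QuadMultiplier m) :
    QuadMultiplier fun ξ => osc X t σ ξ / den P ε t σ ξ * m ξ := by
  obtain ⟨h, C, hC⟩ := hm
  refine ⟨(continuous_osc_div hε).aestronglyMeasurable.mul h, 1 / ε * C, fun ξ => ?_⟩
  rw [norm_mul, mul_assoc]
  exact mul_le_mul (norm_osc_div_le hε ξ) (hC ξ) (norm_nonneg _) (by positivity)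

lemma quad_inner (p : E5) : QuadMultiplier fun ξ => Complex.I * ((inner ℝ p ξ : ℝ) : ℂ) := by
  refine ⟨Continuous.aestronglyMeasurable (by fun_prop), ‖p‖, fun ξ => ?_⟩
  rw [norm_mul, Complex.norm_I, one_mul, Complex.norm_real]
  refine (norm_inner_le_norm _ _).trans (mul_le_mul_of_nonneg_left ?_ (norm_nonneg _))
  nlinarith [sq_nonneg (‖ξ‖ - 1)]

lemma quad_D1 (hε : 0 < ε) : QuadMultiplier (D1 X P ε t σ) := by
  have hφ := continuous_phi1
  have h1 : QuadMultiplier fun ξ => Complex.I * σ * (phi1 ξ : ℂ) :=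
    QuadMultiplier.const_mul ⟨Continuous.aestronglyMeasurable (by fun_prop), 1, fun ξ => by
      rw [Complex.norm_real, Real.norm_eq_abs, abs_of_nonneg (phi1_nonneg ξ), one_mul]
      exact phi1_le ξ⟩ _
  have h2 := (h1.add (quad_inner (P 0))).mul_osc_div (X := X) (P := P) (t := t) (σ := σ) hε
  convert h2 using 2 with ξ
  rw [D1]
  push_cast
  ring

end den

/-! ### Integration by parts in time and the equation of motion -/

/-- The integral `∫₀ᵗ exp(i (X(t) - X(s)) · ξ + i σ (t - s) φ₁(ξ)) ds`. -/
def phaseInt (X : ℝ → E5) (t σ : ℝ) (ξ : E5) : ℂ :=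
  ∫ s in (0 : ℝ)..t,
    Complex.exp (Complex.I * ((inner ℝ (X t - X s) ξ + σ * (t - s) * phi1 ξ : ℝ) : ℂ))

namespace IsSolution

variable {n ρ₀ : ℝ} {V W : E5 → ℝ} {X P : ℝ → E5} {β : ℝ → E5 → ℂ}

lemma contL2_reHat (h : IsSolution ρ₀ W X P β) : ContL2 fun s => reHat β (max s 0) := by
  have hj := continuous_jb
  have hj0 : ∀ ξ, (jb ξ : ℂ) ≠ 0 := fun ξ => by exact_mod_cast (jb_pos ξ).ne'
  have := h.contL2_aux.1.mul_bdd (m := fun ξ => ((jb ξ : ℂ))⁻¹) (C := 1)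
    (Continuous.aestronglyMeasurable (Continuous.inv₀ (by fun_prop) hj0)) fun ξ => by
      rw [norm_inv, Complex.norm_real, Real.norm_eq_abs, abs_of_pos (jb_pos ξ)]
      exact inv_le_one_of_one_le₀ (one_le_jb ξ)
  convert this using 3 with s ξ
  have := hj0 ξ
  field_simp

lemma force_eq (h : IsSolution ρ₀ W X P β) (hW : IsPotential n V W) (j : Fin 5) {t : ℝ}
    (ht : 0 ≤ t) :
    ∫ ξ, conj (Complex.exp (Complex.I * (-(inner ℝ (X t) ξ) : ℝ)) *
      (Complex.I * (ξ j : ℂ) * FT (shifted W 0) ξ)) * reHat β t ξ =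
    (((2 * Real.pi) ^ 5 * ∫ x, pderiv j (shifted W (X t)) x * (β t x).re : ℝ) : ℂ) := by
  obtain ⟨d1, d2⟩ := hW.pderiv_shifted (X t) j
  have key := d1.parseval (h.energy t ht).re_fourier.1 d2 (h.energy t ht).re_memLp
  simp only [Complex.conj_ofReal, ← Complex.ofReal_mul] at key
  rw [integral_complex_ofReal] at key
  push_cast
  rw [← key]
  refine integral_congr_ae (ae_of_all _ fun ξ => ?_)
  simp only [reHat]
  congr 2
  ring_nf

/-- By Parseval the force is a pairing of two continuous curves in L², so the acceleration is
continuous and the fundamental theorem of calculus applies to `P`. -/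
lemma exists_accel (h : IsSolution ρ₀ W X P β) (hW : IsPotential n V W) :
    ∃ Y : ℝ → E5, Continuous Y ∧ ∀ s, 0 ≤ s →
      HasDerivWithinAt P (Y s) (Set.Ici 0) s ∧ accel P s = Y s := by
  set Y : ℝ → E5 := fun s => Real.sqrt ρ₀ •
    (WithLp.toLp 2 fun j => ∫ x, pderiv j (shifted W (X (max s 0))) x * (β (max s 0) x).re : E5)
    with hY
  have hd : ∀ s, 0 ≤ s → HasDerivWithinAt P (Y s) (Set.Ici 0) s := fun s hs => by
    have := h.deriv_P s hs
    simpa only [hY, max_eq_left hs] using this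
  refine ⟨Y, ?_, fun s hs => ⟨hd s hs, (hd s hs).derivWithin (uniqueDiffOn_Ici 0 s hs)⟩⟩
  suffices hcoord : ∀ j, Continuous fun s =>
      ∫ x, pderiv j (shifted W (X (max s 0))) x * (β (max s 0) x).re from
    ((PiLp.continuous_toLp 2 fun _ : Fin 5 => ℝ).comp
      (continuous_pi hcoord)).const_smul (Real.sqrt ρ₀)
  intro j
  have hX := h.continuous_X
  have hc := ContL2.continuous_pairing (ContL2.of_phase
    (θ := fun s ξ => -(inner ℝ (X (max s 0)) ξ))
    (hW.memLp_of_le (m := fun ξ => Complex.I * (ξ j : ℂ))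
      (Continuous.aestronglyMeasurable (by fun_prop)) 1 fun ξ => by
        rw [norm_mul, Complex.norm_I, Complex.norm_real, Real.norm_eq_abs]
        nlinarith [abs_coord_le ξ j, norm_nonneg ξ, sq_nonneg (‖ξ‖ - 1), sq_nonneg (‖ξ‖ ^ 2)])
    (fun s => by fun_prop) (fun ξ => (hX.inner continuous_const).neg)) h.contL2_reHat
  simp only [h.force_eq hW j (le_max_right _ 0)] at hc
  have h2 := (Complex.continuous_re.comp hc).div_const ((2 * Real.pi) ^ 5)
  convert h2 using 2 with s
  simp only [Function.comp_apply, Complex.ofReal_re]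
  field_simp

lemma D2_eq (h : IsSolution ρ₀ W X P β) (hW : IsPotential n V W) {ε t σ : ℝ} (ht : 0 ≤ t) (ξ : E5) :
    D2 X P ε t σ ξ = osc X t σ ξ / den P ε t σ ξ *
      (Complex.I * ((inner ℝ (P t - P 0) ξ : ℝ) : ℂ)) := by
  obtain ⟨Y, hYc, hY⟩ := h.exists_accel hW
  have hP : ContinuousOn P (Set.Icc 0 t) := fun s hs =>
    (hY s hs.1).1.continuousWithinAt.mono Set.Icc_subset_Ici_self
  have : ∫ s in (0 : ℝ)..t, inner ℝ (accel P s) ξ = inner ℝ (P t - P 0) ξ := by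
    rw [inner_sub_left]
    have e : ∫ s in (0 : ℝ)..t, inner ℝ (accel P s) ξ = ∫ s in (0 : ℝ)..t, inner ℝ (Y s) ξ :=
      intervalIntegral.integral_congr fun s hs => by
        rw [Set.uIcc_of_le ht] at hs
        simp only [(hY s hs.1).2]
    rw [e]
    refine intervalIntegral.integral_eq_sub_of_hasDeriv_right_of_le
      (f := fun s => inner ℝ (P s) ξ) ht ?_ (fun s hs => ?_) ?_
    · exact hP.inner continuousOn_const
    · have := ((hY s hs.1.le).1.mono fun y hy => (hs.1.trans hy).le :
        HasDerivWithinAt P (Y s) (Set.Ioi s) s).inner ℝ (hasDerivWithinAt_const s _ ξ)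
      simpa using this
    · exact Continuous.intervalIntegrable (by fun_prop) _ _
  rw [D2, this]

lemma phase_eq {t σ : ℝ} (s : ℝ) (ξ : E5) :
    Complex.exp (Complex.I * ((inner ℝ (X t - X s) ξ + σ * (t - s) * phi1 ξ : ℝ) : ℂ)) =
      osc X t σ ξ * Complex.exp (-(Complex.I *
        ((σ * s * phi1 ξ + inner ℝ (X s - X 0) ξ : ℝ) : ℂ))) := by
  rw [osc, ← Complex.exp_add]
  congr 1
  simp only [inner_sub_left]
  push_cast
  ring

/-- Integration by parts shows that the double integral in `D3` is `e(t) + (den + ε) F(t) - 1`,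
where `F` is the primitive of the phase `e`. Multiplied by `osc/den`, the `-1` cancels `D4`, the `ε`
cancels `DE2`, and `osc · e(t) = 1` leaves `1/den`. -/
lemma D3_eq (h : IsSolution ρ₀ W X P β) (hW : IsPotential n V W) {ε t σ : ℝ} (hε : 0 < ε)
    (ht : 0 ≤ t) (ξ : E5) :
    D3 X P ε t σ ξ + D4 X P ε t σ ξ + DE2 X P ε t σ ξ =
      phaseInt X t σ ξ + 1 / den P ε t σ ξ := by
  obtain ⟨Y, hYc, hY⟩ := h.exists_accel hW
  have hX := h.continuous_X
  set e : ℝ → ℂ := fun s => Complex.exp (-(Complex.I *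
    ((σ * s * phi1 ξ + inner ℝ (X (max s 0) - X 0) ξ : ℝ) : ℂ))) with he
  have hX' : Continuous fun s => inner ℝ (X (max s 0) - X 0) ξ :=
    (hX.sub continuous_const).inner continuous_const
  have hec : Continuous e := by rw [he]; fun_prop
  have heq : ∀ s, 0 ≤ s → Complex.exp (-(Complex.I *
    ((σ * s * phi1 ξ + inner ℝ (X s - X 0) ξ : ℝ) : ℂ))) = e s := fun s hs => by
      simp only [he, max_eq_left hs]
  set F : ℝ → ℂ := fun s => ∫ τ in (0 : ℝ)..s, e τ with hF
  have hFd : ∀ s, HasDerivAt F (e s) s := fun s => (hec.integral_hasStrictDerivAt 0 s).hasDerivAt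
  have hFc : Continuous F := continuous_iff_continuousAt.2 fun s => (hFd s).continuousAt
  have hFeq : ∀ s, 0 ≤ s → ∫ τ in (0 : ℝ)..s, Complex.exp (-(Complex.I *
      ((σ * τ * phi1 ξ + inner ℝ (X τ - X 0) ξ : ℝ) : ℂ))) = F s := fun s hs =>
    intervalIntegral.integral_congr fun τ hτ => by
      rw [Set.uIcc_of_le hs] at hτ
      exact heq τ hτ.1
  have hphase : phaseInt X t σ ξ = osc X t σ ξ * F t := by
    rw [phaseInt, ← hFeq t ht, ← intervalIntegral.integral_const_mul]
    exact intervalIntegral.integral_congr fun s _ => phase_eq s ξ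
  have hed : ∀ s, 0 ≤ s → HasDerivWithinAt e
      (-(Complex.I * ((σ * phi1 ξ + inner ℝ (P s) ξ : ℝ) : ℂ)) * e s) (Set.Ici 0) s := fun s hs => by
    have h1 : HasDerivWithinAt (fun s => (σ * s * phi1 ξ + inner ℝ (X s - X 0) ξ : ℝ))
        (σ * phi1 ξ + inner ℝ (P s) ξ) (Set.Ici 0) s := by
      have a1 := (((h.deriv_X s hs).sub_const (X 0)).inner ℝ (hasDerivWithinAt_const s _ ξ))
      have a2 := (((hasDerivAt_id s).const_mul σ).mul_const (phi1 ξ)).hasDerivWithinAt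
        (s := Set.Ici 0)
      refine (a2.add a1).congr_deriv ?_
      simp
    have h2 := ((h1.ofReal_comp.const_mul Complex.I).neg).cexp
    refine (h2.congr (fun r hr => (heq r hr).symm) (heq s hs).symm).congr_deriv ?_
    rw [← heq s hs]; simp only [Pi.neg_apply]; ring
  -- The function `e + i(σφ₁ + P·ξ)F` is a primitive: `e'` cancels the term in which `F` is
  -- differentiated, leaving `i(Ṗ·ξ)F`.
  have hmain : ∫ s in (0 : ℝ)..t, (Complex.I * ((inner ℝ (Y s) ξ : ℝ) : ℂ)) * F s =
      (e t + Complex.I * ((σ * phi1 ξ + inner ℝ (P t) ξ : ℝ) : ℂ) * F t) -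
      (e 0 + Complex.I * ((σ * phi1 ξ + inner ℝ (P 0) ξ : ℝ) : ℂ) * F 0) := by
    have hd : ∀ s, 0 ≤ s → HasDerivWithinAt
        (fun s => e s + Complex.I * ((σ * phi1 ξ + inner ℝ (P s) ξ : ℝ) : ℂ) * F s)
        ((Complex.I * ((inner ℝ (Y s) ξ : ℝ) : ℂ)) * F s) (Set.Ici 0) s := fun s hs => by
      have h1 : HasDerivWithinAt (fun s => (σ * phi1 ξ + inner ℝ (P s) ξ : ℝ)) (inner ℝ (Y s) ξ)
          (Set.Ici 0) s := by
        have := ((hY s hs).1.inner ℝ (hasDerivWithinAt_const s _ ξ)).const_add (σ * phi1 ξ)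
        simpa using this
      refine ((hed s hs).add ((h1.ofReal_comp.const_mul Complex.I).mul
        (hFd s).hasDerivWithinAt)).congr_deriv ?_
      ring
    refine intervalIntegral.integral_eq_sub_of_hasDeriv_right_of_le
      (f := fun s => e s + Complex.I * ((σ * phi1 ξ + inner ℝ (P s) ξ : ℝ) : ℂ) * F s) ht
      (fun s hs => ?_) (fun s hs => ?_) ?_
    · exact (hd s hs.1).continuousWithinAt.mono Set.Icc_subset_Ici_self
    · exact (hd s hs.1.le).mono fun y hy => (hs.1.trans hy).le
    · exact Continuous.intervalIntegrable (by fun_prop) _ _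
  have hD3 : Complex.I * ∫ s in (0 : ℝ)..t, ∫ τ in (0 : ℝ)..s,
      ((inner ℝ (accel P s) ξ : ℝ) : ℂ) *
        Complex.exp (-(Complex.I * ((σ * τ * phi1 ξ + inner ℝ (X τ - X 0) ξ : ℝ) : ℂ))) =
      ∫ s in (0 : ℝ)..t, (Complex.I * ((inner ℝ (Y s) ξ : ℝ) : ℂ)) * F s := by
    rw [← intervalIntegral.integral_const_mul]
    refine intervalIntegral.integral_congr fun s hs => ?_
    rw [Set.uIcc_of_le ht] at hs
    simp only [intervalIntegral.integral_const_mul, hFeq s hs.1, (hY s hs.1).2]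
    ring
  have he0 : e 0 = 1 := by simp [he]
  have hF0 : F 0 = 0 := by simp [hF]
  have hoe : osc X t σ ξ * e t = 1 := by
    rw [← heq t ht, osc, ← Complex.exp_add]; simp
  have hd := den_ne (P := P) (t := t) (σ := σ) hε ξ
  have hden : Complex.I * ((σ * phi1 ξ + inner ℝ (P t) ξ : ℝ) : ℂ) = den P ε t σ ξ + ε := by
    rw [den]; ring
  rw [D3, D4, hD3, hmain, he0, hF0, hden,
    show DE2 X P ε t σ ξ = -(ε : ℂ) * (phaseInt X t σ ξ / den P ε t σ ξ) from rfl, hphase]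
  field_simp
  linear_combination hoe

lemma continuous_phaseInt (h : IsSolution ρ₀ W X P β) {t σ : ℝ} (ht : 0 ≤ t) :
    Continuous (phaseInt X t σ) := by
  have hX := h.continuous_X
  have hφ := continuous_phi1
  have e : phaseInt X t σ = fun ξ => ∫ s in (0 : ℝ)..t, Complex.exp (Complex.I *
      ((inner ℝ (X t - X (max s 0)) ξ + σ * (t - s) * phi1 ξ : ℝ) : ℂ)) := by
    ext ξ
    refine intervalIntegral.integral_congr fun s hs => ?_
    rw [Set.uIcc_of_le ht] at hs
    simp only [max_eq_left hs.1]
  rw [e]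
  refine intervalIntegral.continuous_parametric_intervalIntegral_of_continuous' ?_ 0 t
  have h1 : Continuous fun z : E5 × ℝ => X (max z.2 0) := hX.comp continuous_snd
  have h2 : Continuous fun z : E5 × ℝ => inner ℝ (X t - X (max z.2 0)) z.1 :=
    (continuous_const.sub h1).inner continuous_fst
  have h3 : Continuous fun z : E5 × ℝ => phi1 z.1 := hφ.comp continuous_fst
  simp only [Function.uncurry_def]
  fun_prop

lemma norm_phaseInt_le {t σ : ℝ} (ht : 0 ≤ t) (ξ : E5) : ‖phaseInt X t σ ξ‖ ≤ t := by
  have := intervalIntegral.norm_integral_le_of_norm_le_const (a := 0) (b := t) (C := 1)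
    (f := fun s => Complex.exp (Complex.I *
      ((inner ℝ (X t - X s) ξ + σ * (t - s) * phi1 ξ : ℝ) : ℂ))) fun s _ => (norm_exp_I _).le
  rwa [sub_zero, abs_of_nonneg ht, one_mul] at this

end IsSolution

lemma IsPotential.memLp_ratio {n : ℝ} {V W : E5 → ℝ} (hW : IsPotential n V W) :
    MemLp (fun ξ => (ratio ξ : ℂ) * FT (shifted W 0) ξ) 2 := by
  have := continuous_ratio
  refine hW.memLp_of_le (Continuous.aestronglyMeasurable (by fun_prop)) 1 fun ξ => ?_
  refine (norm_ratio_le ξ).trans ?_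
  nlinarith [sq_nonneg ‖ξ‖, sq_nonneg (‖ξ‖ ^ 2)]

/-- Partial fractions: the determinant is the product of the two denominators, their difference is
`2iφ₁`, and `(|ξ|/⟨ξ⟩) φ₁ = |ξ|²`. -/
lemma IsPotential.friction_eq_branch {n : ℝ} {V W : E5 → ℝ} (hW : IsPotential n V W) {ε : ℝ}
    (hε : 0 < ε) (ρ₀ : ℝ) (P : ℝ → E5) (t : ℝ) (j : Fin 5) :
    friction ρ₀ (shifted W 0) ε (P t) j = ρ₀ / (2 * (2 * Real.pi) ^ 5) *
      ((∫ ξ, conj (Complex.I * (ξ j : ℂ) * FT (shifted W 0) ξ) *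
        (1 / den P ε t 1 ξ * branch 0 (FT (shifted W 0)) 1 ξ)) +
      ∫ ξ, conj (Complex.I * (ξ j : ℂ) * FT (shifted W 0) ξ) *
        (1 / den P ε t (-1) ξ * branch 0 (FT (shifted W 0)) (-1) ξ)).re := by
  have hU2 := hW.memLp_ratio
  rw [hW.friction_apply hε, ← integral_add
    ((quad_inv_den hε).integrable hW j (memLp_branch .zero hU2 1))
    ((quad_inv_den hε).integrable hW j (memLp_branch .zero hU2 (-1)))]
  have e : ∀ ξ, conj (Complex.I * (ξ j : ℂ) * FT (shifted W 0) ξ) *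
        (1 / den P ε t 1 ξ * branch 0 (FT (shifted W 0)) 1 ξ) +
        conj (Complex.I * (ξ j : ℂ) * FT (shifted W 0) ξ) *
        (1 / den P ε t (-1) ξ * branch 0 (FT (shifted W 0)) (-1) ξ) =
      (2 : ℝ) * (conj (Complex.I * (ξ j : ℂ) * FT (shifted W 0) ξ) *
        (-((‖ξ‖ ^ 2 : ℝ) : ℂ) / detsym ε (P t) ξ * FT (shifted W 0) ξ)) := fun ξ => by
    have h1 := den_ne (P := P) (t := t) (σ := 1) hε ξ
    have h2 := den_ne (P := P) (t := t) (σ := -1) hε ξ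
    have h3 : detsym ε (P t) ξ = den P ε t 1 ξ * den P ε t (-1) ξ := by
      rw [detsym, zsym, den, den]
      push_cast
      linear_combination ((phi1 ξ : ℂ) ^ 2) * Complex.I_sq
    have h4 : (((‖ξ‖ ^ 2 : ℝ) : ℂ)) = ratio ξ * phi1 ξ := by
      rw [ratio, phi1_eq, ← Complex.ofReal_mul]
      congr 1
      have := (jb_pos ξ).ne'
      field_simp
    have h5 : den P ε t 1 ξ - den P ε t (-1) ξ = 2 * Complex.I * phi1 ξ := by
      rw [den, den]; push_cast; ring
    rw [h3, h4, branch, branch]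
    simp only [Pi.zero_apply]
    field_simp
    push_cast
    linear_combination (conj (Complex.I * (ξ j : ℂ) * FT (shifted W 0) ξ) *
      FT (shifted W 0) ξ * ratio ξ) * (Complex.I * h5 + 2 * phi1 ξ * Complex.I_sq)
  simp only [e]
  rw [integral_const_mul, Complex.re_ofReal_mul]
  ring

namespace IsSolution

variable {n ρ₀ : ℝ} {V W : E5 → ℝ} {X P : ℝ → E5} {β : ℝ → E5 → ℂ}

lemma hat_reField0 (h : IsSolution ρ₀ W X P β) : hat (reField0 X β) =ᵐ[volume]
    fun ξ => Complex.exp (Complex.I * (inner ℝ (X 0) ξ : ℝ)) * reHat β 0 ξ :=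
  ((h.energy 0 le_rfl).re_fourier.1.translate (X 0)).hat_ae

lemma hat_imField0 (h : IsSolution ρ₀ W X P β) : hat (imField0 X β) =ᵐ[volume]
    fun ξ => Complex.exp (Complex.I * (inner ℝ (X 0) ξ : ℝ)) * imHat β 0 ξ :=
  ((h.energy 0 le_rfl).im_fourier.1.translate (X 0)).hat_ae

lemma memLp_reHat (h : IsSolution ρ₀ W X P β) {t : ℝ} (ht : 0 ≤ t) : MemLp (reHat β t) 2 := by
  have := h.contL2_reHat.memLp t
  rwa [max_eq_left ht] at this

lemma memLp_imHat (h : IsSolution ρ₀ W X P β) {t : ℝ} (ht : 0 ≤ t) :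
    MemLp (fun ξ => (ratio ξ : ℂ) * imHat β t ξ) 2 := by
  obtain ⟨h1, h2⟩ := (h.energy t ht).im_fourier
  have hr := continuous_ratio
  refine h2.of_le ((Continuous.aestronglyMeasurable (by fun_prop)).mul
    h1.aestronglyMeasurable_right) (ae_of_all _ fun ξ => ?_)
  rw [norm_mul, norm_mul]
  refine mul_le_mul_of_nonneg_right ?_ (norm_nonneg _)
  rw [Complex.norm_real, Complex.norm_real, norm_norm, Real.norm_eq_abs,
    abs_of_nonneg (ratio_nonneg ξ)]
  exact div_le_self (norm_nonneg _) (one_le_jb ξ)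

lemma memLp_initial (h : IsSolution ρ₀ W X P β) : MemLp (hat (reField0 X β)) 2 ∧
    MemLp (fun ξ => (ratio ξ : ℂ) * hat (imField0 X β) ξ) 2 := by
  have hc : Continuous fun ξ => Complex.exp (Complex.I * (inner ℝ (X 0) ξ : ℝ)) := by fun_prop
  constructor
  · refine (memLp_congr_ae h.hat_reField0).2 ((h.memLp_reHat le_rfl).of_le
      (hc.aestronglyMeasurable.mul (h.memLp_reHat le_rfl).aestronglyMeasurable)
      (ae_of_all _ fun ξ => ?_))
    rw [norm_mul, norm_exp_I, one_mul]
  · have h2 := h.memLp_imHat le_rfl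
    refine (memLp_congr_ae (f := fun ξ => Complex.exp (Complex.I * (inner ℝ (X 0) ξ : ℝ)) *
      ((ratio ξ : ℂ) * imHat β 0 ξ)) ?_).1 (h2.of_le
      (hc.aestronglyMeasurable.mul h2.aestronglyMeasurable) (ae_of_all _ fun ξ => ?_))
    · filter_upwards [h.hat_imField0] with ξ hξ
      rw [hξ]; ring
    · rw [norm_mul, norm_exp_I, one_mul]

lemma quad_D2 (h : IsSolution ρ₀ W X P β) (hW : IsPotential n V W) {ε t σ : ℝ} (hε : 0 < ε)
    (ht : 0 ≤ t) : QuadMultiplier (D2 X P ε t σ) := by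
  have := (quad_inner (P t - P 0)).mul_osc_div (X := X) (P := P) (t := t) (σ := σ) hε
  convert this using 2 with ξ
  exact h.D2_eq hW ht ξ

lemma quad_phaseInt (h : IsSolution ρ₀ W X P β) {t σ : ℝ} (ht : 0 ≤ t) :
    QuadMultiplier (phaseInt X t σ) :=
  .of_bound (h.continuous_phaseInt ht).aestronglyMeasurable t (norm_phaseInt_le ht)

lemma quad_DE2 (h : IsSolution ρ₀ W X P β) {ε t σ : ℝ} (hε : 0 < ε)
    (ht : 0 ≤ t) : QuadMultiplier (DE2 X P ε t σ) := by
  have hc : Continuous fun ξ => phaseInt X t σ ξ / den P ε t σ ξ :=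
    (h.continuous_phaseInt ht).div continuous_den (den_ne hε)
  refine QuadMultiplier.const_mul (.of_bound hc.aestronglyMeasurable (t / ε) fun ξ => ?_) _
  rw [norm_div]
  exact div_le_div₀ ht (norm_phaseInt_le ht ξ) hε (den_norm_ge hε ξ)

/-- Solving `D3_eq` for `D3` avoids estimating the double time integral: all other terms are bounded
in `ξ`. -/
lemma quad_D3 (h : IsSolution ρ₀ W X P β) (hW : IsPotential n V W) {ε t σ : ℝ} (hε : 0 < ε)
    (ht : 0 ≤ t) : QuadMultiplier (D3 X P ε t σ) := by
  have := ((h.quad_phaseInt (σ := σ) ht).add (quad_inv_den (P := P) (t := t) (σ := σ) hε)).add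
    (((quad_D4 (X := X) (P := P) (t := t) (σ := σ) hε).add (h.quad_DE2 (σ := σ) hε ht)).const_mul
      (-1))
  convert this using 2 with ξ
  linear_combination h.D3_eq hW hε ht ξ (σ := σ)

/-- Duhamel's formula in terms of the integrals in the statement. -/
lemma force_branch (h : IsSolution ρ₀ W X P β) (hW : IsPotential n V W) {ε t σ : ℝ} (hε : 0 < ε)
    (ht : 0 ≤ t) (hσ : σ ^ 2 = 1) (j : Fin 5) :
    ∫ ξ, conj (Complex.I * (ξ j : ℂ) * FT (shifted W 0) ξ) *
      (Complex.exp (Complex.I * (inner ℝ (X t) ξ : ℝ)) *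
        (reHat β t ξ - Complex.I * σ * ratio ξ * imHat β t ξ)) =
    (∫ ξ, conj (Complex.I * (ξ j : ℂ) * FT (shifted W 0) ξ) *
      (D1 X P ε t σ ξ * branch (hat (reField0 X β)) (hat (imField0 X β)) σ ξ)) +
    (∫ ξ, conj (Complex.I * (ξ j : ℂ) * FT (shifted W 0) ξ) *
      (D2 X P ε t σ ξ * branch (hat (reField0 X β)) (hat (imField0 X β)) σ ξ)) +
    (∫ ξ, conj (Complex.I * (ξ j : ℂ) * FT (shifted W 0) ξ) *
      (DE1 X P ε t σ ξ * branch (hat (reField0 X β)) (hat (imField0 X β)) σ ξ)) -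
    Real.sqrt ρ₀ * ((∫ ξ, conj (Complex.I * (ξ j : ℂ) * FT (shifted W 0) ξ) *
      (D3 X P ε t σ ξ * branch 0 (FT (shifted W 0)) σ ξ)) +
    (∫ ξ, conj (Complex.I * (ξ j : ℂ) * FT (shifted W 0) ξ) *
      (D4 X P ε t σ ξ * branch 0 (FT (shifted W 0)) σ ξ)) +
    (∫ ξ, conj (Complex.I * (ξ j : ℂ) * FT (shifted W 0) ξ) *
      (DE2 X P ε t σ ξ * branch 0 (FT (shifted W 0)) σ ξ)) -
    (∫ ξ, conj (Complex.I * (ξ j : ℂ) * FT (shifted W 0) ξ) *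
      (1 / den P ε t σ ξ * branch 0 (FT (shifted W 0)) σ ξ))) := by
  have hU2 := hW.memLp_ratio
  have hB := memLp_branch (a := 0) .zero hU2 σ
  have hA := memLp_branch h.memLp_initial.1 h.memLp_initial.2 σ
  rw [hW.integral_add_three j hA (quad_D1 hε) (h.quad_D2 hW hε ht) (quad_DE1 hε),
    hW.integral_add_three j hB (h.quad_D3 hW hε ht) (quad_D4 hε) (h.quad_DE2 hε ht)]
  have hN := (quad_inv_den (P := P) (t := t) (σ := σ) hε).integrable hW j hB
  have hJ := (h.quad_phaseInt (σ := σ) ht).integrable hW j hB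
  -- The three numerators add up to the denominator, since `P(0) + (P(t) - P(0)) = P(t)`.
  have e1 : ∀ ξ, D1 X P ε t σ ξ + D2 X P ε t σ ξ + DE1 X P ε t σ ξ = osc X t σ ξ := fun ξ => by
    have hd := den_ne (P := P) (t := t) (σ := σ) hε ξ
    rw [h.D2_eq hW ht, D1, DE1]
    field_simp
    rw [den, inner_sub_left]
    push_cast
    ring
  simp only [e1, h.D3_eq hW hε ht]
  have e2 : ∫ ξ, conj (Complex.I * (ξ j : ℂ) * FT (shifted W 0) ξ) *
      ((phaseInt X t σ ξ + 1 / den P ε t σ ξ) * branch 0 (FT (shifted W 0)) σ ξ) =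
      (∫ ξ, conj (Complex.I * (ξ j : ℂ) * FT (shifted W 0) ξ) *
        (phaseInt X t σ ξ * branch 0 (FT (shifted W 0)) σ ξ)) +
      ∫ ξ, conj (Complex.I * (ξ j : ℂ) * FT (shifted W 0) ξ) *
        (1 / den P ε t σ ξ * branch 0 (FT (shifted W 0)) σ ξ) := by
    rw [← integral_add hJ hN]
    exact integral_congr_ae (ae_of_all _ fun ξ => by simp only; ring)
  rw [e2, add_sub_cancel_right, h.duhamel hW hσ j t ht, sub_eq_add_neg, ← neg_mul,
    ← integral_const_mul, ← integral_const_mul]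
  congr 1
  · refine integral_congr_ae ?_
    filter_upwards [h.hat_reField0, h.hat_imField0] with ξ h1 h2
    have h3 : Complex.exp (Complex.I * ((σ * t * phi1 ξ + inner ℝ (X t) ξ : ℝ) : ℂ)) =
        osc X t σ ξ * Complex.exp (Complex.I * (inner ℝ (X 0) ξ : ℝ)) := by
      rw [osc, ← Complex.exp_add, inner_sub_left]
      congr 1
      push_cast
      ring
    rw [branch, h1, h2, h3]
    ring
  · refine integral_congr_ae (ae_of_all _ fun ξ => ?_)
    simp only [branch, phaseInt, Pi.zero_apply]
    ring

lemma integrable_brackets (h : IsSolution ρ₀ W X P β) (hW : IsPotential n V W) {ε t : ℝ}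
    (hε : 0 < ε) (ht : 0 ≤ t) (j : Fin 5) :
    Integrable (bracketFun (shifted W 0) (gR1 X P β ε t) j) ∧
    Integrable (bracketFun (shifted W 0) (gR2 X P β ε t) j) ∧
    Integrable (bracketFun (shifted W 0) (gR3 (shifted W 0) X P ε t) j) ∧
    Integrable (bracketFun (shifted W 0) (gR4 (shifted W 0) X P ε t) j) ∧
    Integrable (bracketFun (shifted W 0) (gE1 X P β ε t) j) ∧
    Integrable (bracketFun (shifted W 0) (gE2 (shifted W 0) X P ε t) j) := by
  obtain ⟨ha, hb⟩ := h.memLp_initial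
  have hU2 := hW.memLp_ratio
  exact ⟨(hW.bracket_split j ha hb fun σ _ => quad_D1 hε).1,
    (hW.bracket_split j ha hb fun σ _ => h.quad_D2 hW hε ht).1,
    (hW.bracket_split j .zero hU2 fun σ _ => h.quad_D3 hW hε ht).1,
    (hW.bracket_split j .zero hU2 fun σ _ => quad_D4 hε).1,
    (hW.bracket_split j ha hb fun σ _ => quad_DE1 hε).1,
    (hW.bracket_split j .zero hU2 fun σ _ => h.quad_DE2 hε ht).1⟩

/-- The equation of motion with friction. -/
lemma motion (h : IsSolution ρ₀ W X P β) (hW : IsPotential n V W) (hρ : 0 ≤ ρ₀) {ε t : ℝ}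
    (hε : 0 < ε) (ht : 0 ≤ t) : HasDerivWithinAt P
      (friction ρ₀ (shifted W 0) ε (P t) +
        R1 ρ₀ (shifted W 0) X P β ε t + R2 ρ₀ (shifted W 0) X P β ε t +
        R3 ρ₀ (shifted W 0) X P ε t + R4 ρ₀ (shifted W 0) X P ε t +
        E1 ρ₀ (shifted W 0) X P β ε t + E2 ρ₀ (shifted W 0) X P ε t) (Set.Ici 0) t := by
  refine (h.deriv_P t ht).congr_deriv ?_
  ext j
  obtain ⟨ha, hb⟩ := h.memLp_initial
  have hU2 := hW.memLp_ratio
  have b1 := (hW.bracket_split j ha hb (D := D1 X P ε t) fun σ _ => quad_D1 hε).2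
  have b2 := (hW.bracket_split j ha hb (D := D2 X P ε t) fun σ _ => h.quad_D2 hW hε ht).2
  have b3 := (hW.bracket_split j .zero hU2 (D := D3 X P ε t) fun σ _ => h.quad_D3 hW hε ht).2
  have b4 := (hW.bracket_split j .zero hU2 (D := D4 X P ε t) fun σ _ => quad_D4 hε).2
  have b5 := (hW.bracket_split j ha hb (D := DE1 X P ε t) fun σ _ => quad_DE1 hε).2
  have b6 := (hW.bracket_split j .zero hU2 (D := DE2 X P ε t) fun σ _ => h.quad_DE2 hε ht).2
  have hfr := hW.friction_eq_branch hε ρ₀ P t j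
  have f1 := h.force_branch hW (σ := 1) hε ht (by norm_num) j
  have f2 := h.force_branch hW (σ := -1) hε ht (by norm_num) j
  have hexp : QuadMultiplier fun ξ => Complex.exp (Complex.I * (inner ℝ (X t) ξ : ℝ)) :=
    .of_bound (Continuous.aestronglyMeasurable (by fun_prop)) 1 fun ξ => (norm_exp_I _).le
  have hL : ∀ σ : ℝ, Integrable fun ξ => conj (Complex.I * (ξ j : ℂ) * FT (shifted W 0) ξ) *
      (Complex.exp (Complex.I * (inner ℝ (X t) ξ : ℝ)) *
        (reHat β t ξ - Complex.I * σ * ratio ξ * imHat β t ξ)) := fun σ =>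
    hexp.integrable hW j (memLp_branch (h.memLp_reHat ht) (h.memLp_imHat ht) σ)
  have hforce := h.force_eq hW j ht
  -- Adding the two branches removes the imaginary part of the field, which the force does not see;
  -- hence the factor 2 in the normalizing constants.
  have hsum : (∫ ξ, conj (Complex.I * (ξ j : ℂ) * FT (shifted W 0) ξ) *
      (Complex.exp (Complex.I * (inner ℝ (X t) ξ : ℝ)) *
        (reHat β t ξ - Complex.I * (1 : ℝ) * ratio ξ * imHat β t ξ))) +
      (∫ ξ, conj (Complex.I * (ξ j : ℂ) * FT (shifted W 0) ξ) *
      (Complex.exp (Complex.I * (inner ℝ (X t) ξ : ℝ)) *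
        (reHat β t ξ - Complex.I * (-1 : ℝ) * ratio ξ * imHat β t ξ))) =
      2 * ∫ ξ, conj (Complex.exp (Complex.I * (-(inner ℝ (X t) ξ) : ℝ)) *
      (Complex.I * (ξ j : ℂ) * FT (shifted W 0) ξ)) * reHat β t ξ := by
    rw [← integral_add (hL 1) (hL (-1)), ← integral_const_mul]
    refine integral_congr_ae (ae_of_all _ fun ξ => ?_)
    have : conj (Complex.exp (Complex.I * (-(inner ℝ (X t) ξ) : ℝ))) =
        Complex.exp (Complex.I * (inner ℝ (X t) ξ : ℝ)) := by
      rw [← Complex.exp_conj, map_mul, Complex.conj_I, Complex.conj_ofReal]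
      congr 1
      push_cast
      ring
    simp only [map_mul (starRingEnd ℂ) (Complex.exp _), this]
    push_cast
    ring
  rw [f1, f2, hforce] at hsum
  have hre := congrArg Complex.re hsum
  simp only [Complex.add_re, Complex.sub_re, Complex.re_ofReal_mul] at hre
  rw [show (2 : ℂ) = ((2 : ℝ) : ℂ) by norm_num, ← Complex.ofReal_mul, Complex.ofReal_re] at hre
  have hs := Real.mul_self_sqrt hρ
  have hπ : ((2 * Real.pi) ^ 5 : ℝ) ≠ 0 := by positivity
  simp only [PiLp.add_apply, PiLp.smul_apply, smul_eq_mul, R1, R2, R3, R4, E1, E2, bracket, hfr,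
    gR1, gR2, gR3, gR4, gE1, gE2, b1, b2, b3, b4, b5, b6, Complex.add_re]
  generalize (2 * Real.pi) ^ 5 = c at *
  generalize Real.sqrt ρ₀ = r at *
  generalize ∫ x, pderiv j (shifted W (X t)) x * (β t x).re = x at *
  rw [← hs]
  linear_combination (-(r / (2 * c))) * hre - r * x * mul_inv_cancel₀ hπ

end IsSolution

/-! ### The joint law of a coordinate and of the norm -/

/-- The space `ℝ⁴`. -/
abbrev E4 : Type := EuclideanSpace ℝ (Fin 4)

/-- The area of the unit sphere of `ℝ⁴`. -/
def sphereArea : ℝ := (volume : Measure E4).toSphere.real Set.univ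

lemma sphereArea_pos : 0 < sphereArea := by
  rw [sphereArea, measureReal_def]
  refine ENNReal.toReal_pos ?_ (measure_ne_top _ _)
  rw [Ne, Measure.measure_univ_eq_zero]
  exact Measure.toSphere_ne_zero _

lemma lintegral_norm_E4 {f : ℝ → ℝ≥0∞} (hf : Measurable f) :
    ∫⁻ y : E4, f ‖y‖ =
      ENNReal.ofReal sphereArea * ∫⁻ ρ in Set.Ioi (0 : ℝ), ENNReal.ofReal (ρ ^ 3) * f ρ := by
  have h1 : ∫⁻ y : E4, f ‖y‖ =
      ∫⁻ x : ({(0)}ᶜ : Set E4), f ‖x.1‖ ∂((volume : Measure E4).comap (↑)) := by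
    rw [lintegral_subtype_comap (measurableSet_singleton _).compl fun x : E4 => f ‖x‖,
      restrict_compl_singleton]
  have h2 := (volume : Measure E4).measurePreserving_homeomorphUnitSphereProd.lintegral_comp_emb
    (Homeomorph.measurableEmbedding _) (fun z => f z.2.1)
  simp only [homeomorphUnitSphereProd_apply_snd_coe] at h2
  have hd : Module.finrank ℝ E4 - 1 = 3 := by simp
  have hm : Measurable fun r : Set.Ioi (0 : ℝ) => f r.1 := hf.comp measurable_subtype_coe
  have hm2 : Measurable fun z : Metric.sphere (0 : E4) 1 × Set.Ioi (0 : ℝ) => f z.2.1 :=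
    hm.comp measurable_snd
  rw [h1, h2, hd, lintegral_prod _ hm2.aemeasurable]
  simp only [lintegral_const]
  rw [mul_comm, sphereArea, measureReal_def, ENNReal.ofReal_toReal (measure_ne_top _ _),
    Measure.volumeIoiPow, lintegral_withDensity_eq_lintegral_mul _ (by fun_prop) hm]
  congr 1
  exact lintegral_subtype_comap measurableSet_Ioi fun r : ℝ => ENNReal.ofReal (r ^ 3) * f r

lemma norm_toLp_cons (x : ℝ) (y : Fin 4 → ℝ) :
    ‖(WithLp.toLp 2 (Fin.cons x y : Fin 5 → ℝ) : E5)‖ =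
      Real.sqrt (x ^ 2 + ‖(WithLp.toLp 2 y : E4)‖ ^ 2) := by
  rw [EuclideanSpace.norm_sq_eq, EuclideanSpace.norm_eq, Fin.sum_univ_succ]
  simp

lemma lintegral_split {F : ℝ × ℝ → ℝ≥0∞} (hF : Measurable F) :
    ∫⁻ ξ : E5, F (ξ 0, ‖ξ‖) = ∫⁻ x : ℝ, ∫⁻ y : E4, F (x, Real.sqrt (x ^ 2 + ‖y‖ ^ 2)) := by
  have hm5 : Measurable fun ξ : E5 => F (ξ 0, ‖ξ‖) := hF.comp (by fun_prop)
  have hm5' : Measurable fun z : Fin 5 → ℝ =>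
      F ((WithLp.toLp 2 z : E5) 0, ‖(WithLp.toLp 2 z : E5)‖) :=
    hm5.comp (WithLp.measurable_toLp 2 _)
  have hp := (volume_preserving_piFinSuccAbove (fun _ : Fin 5 => ℝ) 0).symm
  rw [← (PiLp.volume_preserving_toLp (Fin 5)).lintegral_comp hm5]
  refine (hp.lintegral_comp hm5').symm.trans ?_
  refine (lintegral_prod _ (hm5'.comp (MeasurableEquiv.measurable _)).aemeasurable).trans ?_
  refine lintegral_congr fun x => ?_
  have hm4 : Measurable fun y : E4 => F (x, Real.sqrt (x ^ 2 + ‖y‖ ^ 2)) := hF.comp (by fun_prop)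
  rw [← (PiLp.volume_preserving_toLp (Fin 4)).lintegral_comp hm4]
  refine lintegral_congr fun y => ?_
  have e : (MeasurableEquiv.piFinSuccAbove (fun _ : Fin 5 => ℝ) 0).symm (x, y) =
      (Fin.cons x y : Fin 5 → ℝ) := by
    simp [MeasurableEquiv.piFinSuccAbove, Fin.insertNthEquiv]
  rw [Function.comp_apply, e, norm_toLp_cons]
  rfl

/-- Substitute `r = √(x² + ρ²)`, so that `ρ dρ = r dr` and the remaining `ρ²` is `r² - x²`. -/
lemma lintegral_radius (x : ℝ) (f : ℝ → ℝ≥0∞) :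
    ∫⁻ ρ in Set.Ioi (0 : ℝ), ENNReal.ofReal (ρ ^ 3) * f (Real.sqrt (x ^ 2 + ρ ^ 2)) =
      ∫⁻ r in Set.Ioi |x|, ENNReal.ofReal (r * (r ^ 2 - x ^ 2)) * f r := by
  have hpos : ∀ ρ ∈ Set.Ioi (0 : ℝ), 0 < x ^ 2 + ρ ^ 2 := fun ρ hρ => by
    have := Set.mem_Ioi.1 hρ
    positivity
  have himg : (fun ρ => Real.sqrt (x ^ 2 + ρ ^ 2)) '' Set.Ioi (0 : ℝ) = Set.Ioi |x| := by
    ext r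
    constructor
    · rintro ⟨ρ, hρ, rfl⟩
      rw [Set.mem_Ioi] at hρ ⊢
      rw [← Real.sqrt_sq_eq_abs]
      exact Real.sqrt_lt_sqrt (sq_nonneg x) (by nlinarith)
    · intro hr
      rw [Set.mem_Ioi] at hr
      have h1 : x ^ 2 < r ^ 2 := by
        rw [← sq_abs x]
        exact pow_lt_pow_left₀ hr (abs_nonneg x) two_ne_zero
      refine ⟨Real.sqrt (r ^ 2 - x ^ 2), Real.sqrt_pos.2 (by linarith), ?_⟩
      simp only
      rw [Real.sq_sqrt (by linarith), add_sub_cancel, Real.sqrt_sq ((abs_nonneg x).trans hr.le)]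
  rw [← himg, lintegral_image_eq_lintegral_abs_deriv_mul measurableSet_Ioi
    (f' := fun ρ => ρ / Real.sqrt (x ^ 2 + ρ ^ 2))]
  · refine setLIntegral_congr_fun measurableSet_Ioi fun ρ hρ => ?_
    have h1 := hpos ρ hρ
    have h2 : 0 < Real.sqrt (x ^ 2 + ρ ^ 2) := Real.sqrt_pos.2 h1
    have h3 := Set.mem_Ioi.1 hρ
    rw [← mul_assoc, ← ENNReal.ofReal_mul (abs_nonneg _), abs_of_nonneg (by positivity),
      Real.sq_sqrt h1.le, add_sub_cancel_left]
    congr 2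
    field_simp
  · intro ρ hρ
    have h1 := hpos ρ hρ
    have := (((hasDerivAt_pow 2 ρ).const_add (x ^ 2)).sqrt h1.ne').hasDerivWithinAt
      (s := Set.Ioi 0)
    refine this.congr_deriv ?_
    have h2 : Real.sqrt (x ^ 2 + ρ ^ 2) ≠ 0 := (Real.sqrt_pos.2 h1).ne'
    field_simp
    norm_num
  · intro ρ hρ ρ' hρ' h
    simp only at h
    rw [Real.sqrt_inj (hpos ρ hρ).le (hpos ρ' hρ').le] at h
    exact (pow_left_inj₀ (le_of_lt hρ) (le_of_lt hρ') two_ne_zero).1 (by linarith)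

/-- The density of the law of `(ξ₀, |ξ|)`. -/
def axisDensity (z : ℝ × ℝ) : ℝ :=
  sphereArea * ({z : ℝ × ℝ | |z.1| < z.2}.indicator (fun z => z.2 * (z.2 ^ 2 - z.1 ^ 2)) z)

lemma measurable_axisDensity : Measurable axisDensity := by
  refine measurable_const.mul (Measurable.indicator (by fun_prop) ?_)
  exact measurableSet_lt (by fun_prop) (by fun_prop)

lemma axisDensity_nonneg (z : ℝ × ℝ) : 0 ≤ axisDensity z := by
  refine mul_nonneg sphereArea_pos.le (Set.indicator_nonneg (fun z hz => ?_) z)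
  have h1 : |z.1| < z.2 := hz
  have h2 : z.1 ^ 2 ≤ z.2 ^ 2 := by
    rw [← sq_abs z.1]
    exact pow_le_pow_left₀ (abs_nonneg _) h1.le 2
  exact mul_nonneg ((abs_nonneg _).trans h1.le) (by linarith)

/-- Slice `ℝ⁵ = ℝ × ℝ⁴`, use polar coordinates in `ℝ⁴`, and pass from the radius in `ℝ⁴` to the full
norm. -/
lemma map_axis : (volume : Measure E5).map (fun ξ => (ξ 0, ‖ξ‖)) =
    (volume : Measure (ℝ × ℝ)).withDensity fun z => ENNReal.ofReal (axisDensity z) := by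
  refine Measure.ext_of_lintegral _ fun F hF => ?_
  rw [lintegral_map hF (by fun_prop), lintegral_split hF,
    lintegral_withDensity_eq_lintegral_mul _ measurable_axisDensity.ennreal_ofReal hF,
    Measure.volume_eq_prod, lintegral_prod _
      (measurable_axisDensity.ennreal_ofReal.mul hF).aemeasurable]
  refine lintegral_congr fun x => ?_
  rw [lintegral_norm_E4 (f := fun ρ => F (x, Real.sqrt (x ^ 2 + ρ ^ 2))) (hF.comp (by fun_prop)),
    lintegral_radius x fun r => F (x, r), ← lintegral_const_mul' _ _ ENNReal.ofReal_ne_top,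
    ← lintegral_indicator measurableSet_Ioi]
  refine lintegral_congr fun r => ?_
  simp only [Pi.mul_apply, axisDensity, Set.indicator_apply, Set.mem_Ioi, Set.mem_ofPred_eq]
  split_ifs
  · rw [ENNReal.ofReal_mul sphereArea_pos.le, mul_assoc]
  · simp

lemma integrable_axis {F : ℝ × ℝ → ℝ} (hF : Measurable F) :
    Integrable (fun ξ : E5 => F (ξ 0, ‖ξ‖)) ↔ Integrable fun z => axisDensity z * F z := by
  have h1 : Measurable fun ξ : E5 => (ξ 0, ‖ξ‖) := by fun_prop
  have h2 := integrable_map_measure (μ := (volume : Measure E5)) (g := F)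
    hF.aestronglyMeasurable h1.aemeasurable
  rw [Function.comp_def] at h2
  rw [← h2, map_axis, integrable_withDensity_iff_integrable_smul'
    measurable_axisDensity.ennreal_ofReal (ae_of_all _ fun z => ENNReal.ofReal_lt_top)]
  simp only [ENNReal.toReal_ofReal (axisDensity_nonneg _), smul_eq_mul]

lemma integral_axis {F : ℝ × ℝ → ℝ} (hF : Measurable F) :
    ∫ ξ : E5, F (ξ 0, ‖ξ‖) = ∫ z, axisDensity z * F z := by
  have h1 : Measurable fun ξ : E5 => (ξ 0, ‖ξ‖) := by fun_prop
  rw [← integral_map h1.aemeasurable hF.aestronglyMeasurable, map_axis,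
    integral_withDensity_eq_integral_toReal_smul measurable_axisDensity.ennreal_ofReal
      (ae_of_all _ fun z => ENNReal.ofReal_lt_top)]
  simp only [ENNReal.toReal_ofReal (axisDensity_nonneg _), smul_eq_mul]

/-! ### The friction term of a radial potential -/

/-- The dispersion relation as a function of the radius. -/
def radPhi (r : ℝ) : ℝ := r * Real.sqrt (1 + r ^ 2)

lemma radPhi_norm (ξ : E5) : radPhi ‖ξ‖ = phi1 ξ := rfl

lemma radPhi_pos {r : ℝ} (hr : 0 < r) : 0 < radPhi r := mul_pos hr (Real.sqrt_pos.2 (by positivity))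

lemma continuous_radPhi : Continuous radPhi := by unfold radPhi; fun_prop

lemma sq_le_radPhi {r : ℝ} (hr : 0 < r) : r ^ 2 ≤ radPhi r := by
  rw [radPhi, sq]
  refine mul_le_mul_of_nonneg_left (Real.le_sqrt_of_sq_le ?_) hr.le
  linarith

/-- The kernel of the friction term. -/
def frictionKernel (ε s r : ℝ) : ℝ :=
  2 * ε * s * r ^ 2 / (((radPhi r - s) ^ 2 + ε ^ 2) * ((radPhi r + s) ^ 2 + ε ^ 2))

/-- Only the imaginary part `-2ε p·ξ` of the determinant contributes to the real part of the
pairing, whence the factor `ε` in the kernel. -/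
lemma IsPotential.friction_integral {n : ℝ} {V W : E5 → ℝ} (h : IsPotential n V W) {ε : ℝ}
    (hε : 0 < ε) (ρ₀ : ℝ) (p : E5) (j : Fin 5) :
    Integrable (fun ξ : E5 => ξ j * (frictionKernel ε (inner ℝ p ξ) ‖ξ‖ *
      ‖FT (shifted W 0) ξ‖ ^ 2)) ∧
    friction ρ₀ (shifted W 0) ε p j = -(ρ₀ / (2 * Real.pi) ^ 5) *
      ∫ ξ : E5, ξ j * (frictionKernel ε (inner ℝ p ξ) ‖ξ‖ * ‖FT (shifted W 0) ξ‖ ^ 2) := by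
  have hi : Integrable fun ξ => conj (Complex.I * (ξ j : ℂ) * FT (shifted W 0) ξ) *
      (-((‖ξ‖ ^ 2 : ℝ) : ℂ) / detsym ε p ξ * FT (shifted W 0) ξ) :=
    (h.memLp_coord j).integrable_mul (h.memLp_hepsHat hε p 0)
  have e : ∀ ξ : E5, (conj (Complex.I * (ξ j : ℂ) * FT (shifted W 0) ξ) *
      (-((‖ξ‖ ^ 2 : ℝ) : ℂ) / detsym ε p ξ * FT (shifted W 0) ξ)).re =
      -(ξ j * (frictionKernel ε (inner ℝ p ξ) ‖ξ‖ * ‖FT (shifted W 0) ξ‖ ^ 2)) := fun ξ => by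
    have hd := detsym_ne hε p ξ
    have h1 : conj (Complex.I * (ξ j : ℂ) * FT (shifted W 0) ξ) *
        (-((‖ξ‖ ^ 2 : ℝ) : ℂ) / detsym ε p ξ * FT (shifted W 0) ξ) =
        ((ξ j * ‖ξ‖ ^ 2 * ‖FT (shifted W 0) ξ‖ ^ 2 : ℝ) : ℂ) * (Complex.I / detsym ε p ξ) := by
      have h2 : conj (FT (shifted W 0) ξ) * FT (shifted W 0) ξ =
          ((‖FT (shifted W 0) ξ‖ ^ 2 : ℝ) : ℂ) := by
        rw [mul_comm, Complex.mul_conj, Complex.normSq_eq_norm_sq]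
      rw [map_mul, map_mul, Complex.conj_I, Complex.conj_ofReal]
      rw [Complex.ofReal_mul, ← h2]
      push_cast
      field_simp
    have h3 : (detsym ε p ξ).im = -(2 * ε * inner ℝ p ξ) := by
      simp only [detsym, zsym, sq, Complex.add_im, Complex.mul_im, Complex.sub_re, Complex.sub_im,
        Complex.mul_re, Complex.I_re, Complex.I_im, Complex.ofReal_re, Complex.ofReal_im]
      ring
    rw [h1, Complex.re_ofReal_mul, Complex.div_re, Complex.I_re, Complex.I_im, h3,
      Complex.normSq_eq_norm_sq, norm_detsym_sq, frictionKernel, radPhi_norm]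
    ring
  have hr := hi.re
  simp only [RCLike.re_eq_complex_re, e] at hr
  refine ⟨by simpa using hr.neg, ?_⟩
  rw [h.friction_apply hε, neg_mul, ← mul_neg, ← integral_neg]
  congr 1
  refine (Complex.reCLM.integral_comp_comm hi).symm.trans ?_
  exact integral_congr_ae (ae_of_all _ e)

/-- Two reflections. The one that fixes the line of `p` averages `ξ_j` to its component along `p`;
the one that exchanges `p` with `|p| e₀` turns `p·ξ` into `|p| ξ₀`. -/
lemma integral_axis_reduction {G : ℝ → ℝ → ℝ} {p : E5} (hp : p ≠ 0)
    (hG : ∀ j, Integrable fun ξ : E5 => ξ j * G (inner ℝ p ξ) ‖ξ‖) (j : Fin 5) :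
    Integrable (fun ξ : E5 => ξ 0 * G (‖p‖ * ξ 0) ‖ξ‖) ∧
    ∫ ξ : E5, ξ j * G (inner ℝ p ξ) ‖ξ‖ =
      p j / ‖p‖ * ∫ ξ : E5, ξ 0 * G (‖p‖ * ξ 0) ‖ξ‖ := by
  have hp0 : ‖p‖ ≠ 0 := norm_ne_zero_iff.2 hp
  have hin : ∀ ξ : E5, inner ℝ p ξ = ∑ i, p i * ξ i := fun ξ => by
    rw [PiLp.inner_apply]
    exact Finset.sum_congr rfl fun i _ => by simp [mul_comm]
  have hI : Integrable fun ξ : E5 => inner ℝ p ξ * G (inner ℝ p ξ) ‖ξ‖ := by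
    have := integrable_finsetSum (μ := (volume : Measure E5)) Finset.univ
      fun i _ => (hG i).const_mul (p i)
    refine this.congr (ae_of_all _ fun ξ => ?_)
    simp only
    conv_rhs => rw [hin, Finset.sum_mul]
    rw [hin]
    exact Finset.sum_congr rfl fun i _ => by ring
  have h1 : ∫ ξ : E5, ξ j * G (inner ℝ p ξ) ‖ξ‖ =
      p j / ‖p‖ ^ 2 * ∫ ξ : E5, inner ℝ p ξ * G (inner ℝ p ξ) ‖ξ‖ := by
    set T := (Submodule.span ℝ {p}).reflection with hT
    have hTp : T p = p :=
      Submodule.reflection_mem_subspace_eq_self (Submodule.mem_span_singleton_self p)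
    have a1 : ∀ ξ, inner ℝ p (T ξ) = inner ℝ p ξ := fun ξ => by
      conv_lhs => rw [← hTp]
      exact T.inner_map_map p ξ
    have a2 : ∀ ξ, (T ξ) j = 2 * (inner ℝ p ξ / ‖p‖ ^ 2) * p j - ξ j := fun ξ => by
      rw [hT, Submodule.reflection_singleton_apply]
      simp
      ring
    have a3 := T.measurePreserving.integral_comp T.toHomeomorph.measurableEmbedding
      fun ξ : E5 => ξ j * G (inner ℝ p ξ) ‖ξ‖
    simp only [a1, a2, T.norm_map] at a3
    have a4 : ∫ ξ : E5, (2 * (inner ℝ p ξ / ‖p‖ ^ 2) * p j - ξ j) * G (inner ℝ p ξ) ‖ξ‖ =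
        2 * p j / ‖p‖ ^ 2 * (∫ ξ : E5, inner ℝ p ξ * G (inner ℝ p ξ) ‖ξ‖) -
        ∫ ξ : E5, ξ j * G (inner ℝ p ξ) ‖ξ‖ := by
      rw [← integral_const_mul, ← integral_sub (hI.const_mul _) (hG j)]
      exact integral_congr_ae (ae_of_all _ fun ξ => by simp only; ring)
    rw [a4] at a3
    linear_combination (-1 / 2) * a3
  have hn : ‖‖p‖ • basisVec 0‖ = ‖p‖ := by
    simp [norm_smul, basisVec]
  set S := (Submodule.span ℝ {‖p‖ • basisVec 0 - p})ᗮ.reflection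
  have hS : S (‖p‖ • basisVec 0) = p := Submodule.reflection_sub hn
  have b1 : ∀ ξ, inner ℝ p (S ξ) = ‖p‖ * ξ 0 := fun ξ => by
    conv_lhs => rw [← hS]
    rw [S.inner_map_map, inner_smul_left, basisVec, EuclideanSpace.inner_single_left]
    simp
  have b2 := S.measurePreserving.integral_comp S.toHomeomorph.measurableEmbedding
    fun ξ : E5 => inner ℝ p ξ * G (inner ℝ p ξ) ‖ξ‖
  have b3 := (S.measurePreserving.integrable_comp_emb S.toHomeomorph.measurableEmbedding).2 hI
  simp only [Function.comp_def, b1, S.norm_map, mul_assoc] at b2 b3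
  constructor
  · refine (b3.const_mul (‖p‖⁻¹)).congr (ae_of_all _ fun ξ => ?_)
    simp only
    field_simp
  · rw [h1, ← b2, integral_const_mul]
    field_simp

/-! ### Concentration on the resonance as `ε → 0` -/

/-- The rescaled Cauchy density. -/
def cauchyBump (c x₀ x : ℝ) : ℝ := c * (Real.pi⁻¹ * (1 + (c * (x₀ - x)) ^ 2)⁻¹)

lemma cauchyBump_nonneg {c : ℝ} (hc : 0 ≤ c) (x₀ x : ℝ) : 0 ≤ cauchyBump c x₀ x := by
  have := Real.pi_pos
  unfold cauchyBump
  positivity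

lemma integral_cauchyBump {c : ℝ} (hc : 0 < c) (x₀ : ℝ) :
    Integrable (cauchyBump c x₀) ∧ ∫ x, cauchyBump c x₀ x = 1 := by
  have h0 : Integrable fun y : ℝ => c * (Real.pi⁻¹ * (1 + (c * y) ^ 2)⁻¹) :=
    ((integrable_inv_one_add_sq.comp_mul_left' hc.ne').const_mul _).const_mul _
  refine ⟨h0.comp_sub_left x₀, ?_⟩
  have h1 := integral_sub_left_eq_self
    (fun y : ℝ => c * (Real.pi⁻¹ * (1 + (c * y) ^ 2)⁻¹)) volume x₀
  refine h1.trans ?_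
  rw [integral_const_mul, integral_const_mul,
    Measure.integral_comp_mul_left (fun y : ℝ => (1 + y ^ 2)⁻¹) c, integral_univ_inv_one_add_sq,
    abs_of_pos (inv_pos.2 hc), smul_eq_mul]
  have := Real.pi_pos.ne'
  field_simp

/-- The Cauchy density is `O(1/x²)`, just enough decay for an approximate identity acting on
integrable functions. -/
lemma tendsto_cauchyBump {g : ℝ → ℝ} {x₀ : ℝ} (hg : Integrable g) (hc : ContinuousAt g x₀) :
    Tendsto (fun c : ℝ => ∫ x, g x * cauchyBump c x₀ x) atTop (𝓝 (g x₀)) := by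
  have hπ := Real.pi_pos
  have := tendsto_integral_comp_smul_smul_of_integrable' (μ := (volume : Measure ℝ))
    (φ := fun y : ℝ => Real.pi⁻¹ * (1 + y ^ 2)⁻¹) (fun y => by positivity) ?_ ?_ hg hc
  · refine this.congr fun c => integral_congr_ae (ae_of_all _ fun x => ?_)
    simp only [Module.finrank_self, pow_one, smul_eq_mul, cauchyBump]
    ring
  · rw [integral_const_mul, integral_univ_inv_one_add_sq, inv_mul_cancel₀ hπ.ne']
  · have h1 : Tendsto (fun x : ℝ => ‖x‖⁻¹) (Bornology.cobounded ℝ) (𝓝 0) :=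
      tendsto_inv_atTop_zero.comp tendsto_norm_cobounded_atTop
    refine tendsto_of_tendsto_of_tendsto_of_le_of_le' tendsto_const_nhds h1
      (Eventually.of_forall fun x => by positivity) ?_
    have h2 : ∀ᶠ x : ℝ in Bornology.cobounded ℝ, 0 < ‖x‖ :=
      tendsto_norm_cobounded_atTop.eventually (eventually_gt_atTop 0)
    filter_upwards [h2] with x hx
    rw [Module.finrank_self, pow_one, ← sq_abs x, ← Real.norm_eq_abs, ← one_div ‖x‖, le_div_iff₀ hx]
    have h3 : Real.pi⁻¹ ≤ 1 := inv_le_one_of_one_le₀ (by linarith [Real.pi_gt_three])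
    have h4 : ‖x‖ ^ 2 / (1 + ‖x‖ ^ 2) ≤ 1 := div_le_one_of_le₀ (by linarith) (by positivity)
    calc ‖x‖ * (Real.pi⁻¹ * (1 + ‖x‖ ^ 2)⁻¹) * ‖x‖ = Real.pi⁻¹ * (‖x‖ ^ 2 / (1 + ‖x‖ ^ 2)) := by ring
      _ ≤ 1 := mul_le_one₀ h3 (by positivity) h4

/-- The profile `x (r² - x²) 1_{|x| < r}`. -/
def hump (r x : ℝ) : ℝ := {x : ℝ | |x| < r}.indicator (fun x => x * (r ^ 2 - x ^ 2)) x

lemma hump_of_lt {r x : ℝ} (h : |x| < r) : hump r x = x * (r ^ 2 - x ^ 2) :=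
  Set.indicator_of_mem (s := {x : ℝ | |x| < r}) h _

lemma hump_of_le {r x : ℝ} (h : r ≤ |x|) : hump r x = 0 :=
  Set.indicator_of_notMem (s := {x : ℝ | |x| < r}) (not_lt.2 h) _

lemma hump_neg (r x : ℝ) : hump r (-x) = -hump r x := by
  rcases lt_or_ge |x| r with h | h
  · rw [hump_of_lt h, hump_of_lt (by rwa [abs_neg])]; ring
  · rw [hump_of_le h, hump_of_le (by rwa [abs_neg]), neg_zero]

lemma abs_hump_le {r : ℝ} (hr : 0 < r) (x : ℝ) : |hump r x| ≤ r ^ 3 := by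
  rcases lt_or_ge |x| r with h | h
  · have h1 : x ^ 2 ≤ r ^ 2 := by rw [← sq_abs x]; exact pow_le_pow_left₀ (abs_nonneg _) h.le 2
    rw [hump_of_lt h, abs_mul, abs_of_nonneg (by linarith : 0 ≤ r ^ 2 - x ^ 2),
      show r ^ 3 = r * r ^ 2 by ring]
    exact mul_le_mul h.le (by linarith [sq_nonneg x]) (by linarith) hr.le
  · rw [hump_of_le h, abs_zero]; positivity

lemma continuous_hump {r : ℝ} (hr : 0 < r) : Continuous (hump r) := by
  have : hump r = fun x => x * max (r ^ 2 - x ^ 2) 0 := by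
    ext x
    rcases lt_or_ge |x| r with h | h
    · have h1 : x ^ 2 ≤ r ^ 2 := by rw [← sq_abs x]; exact pow_le_pow_left₀ (abs_nonneg _) h.le 2
      rw [hump_of_lt h, max_eq_left (by linarith)]
    · have h1 : r ^ 2 ≤ x ^ 2 := by rw [← sq_abs x]; exact pow_le_pow_left₀ hr.le h 2
      rw [hump_of_le h, max_eq_right (by linarith), mul_zero]
  rw [this]
  fun_prop

lemma integrable_hump {r : ℝ} (hr : 0 < r) : Integrable (hump r) := by
  refine (continuous_hump hr).integrable_of_hasCompactSupport
    (HasCompactSupport.intro (isCompact_Icc (a := -r) (b := r)) fun x hx => hump_of_le ?_)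
  by_contra h
  exact hx (abs_le.1 (not_le.1 h).le)

/-- The inner integral of the friction term. -/
def humpBump (c a r : ℝ) : ℝ := ∫ x, hump r x * (cauchyBump c a x - cauchyBump c (-a) x)

lemma integrable_hump_mul {r c : ℝ} (hr : 0 < r) (hc : 0 < c) (a : ℝ) :
    Integrable fun x => hump r x * cauchyBump c a x :=
  (integral_cauchyBump hc a).1.bdd_mul (c := r ^ 3) (continuous_hump hr).aestronglyMeasurable
    (ae_of_all _ (abs_hump_le hr))

lemma humpBump_eq {r c : ℝ} (hr : 0 < r) (hc : 0 < c) (a : ℝ) :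
    humpBump c a r = (∫ x, hump r x * cauchyBump c a x) - ∫ x, hump r x * cauchyBump c (-a) x := by
  rw [← integral_sub (integrable_hump_mul hr hc a) (integrable_hump_mul hr hc (-a))]
  exact integral_congr_ae (ae_of_all _ fun x => mul_sub _ _ _)

lemma abs_humpBump_le {r c : ℝ} (hr : 0 < r) (hc : 0 < c) (a : ℝ) :
    |humpBump c a r| ≤ 2 * r ^ 3 := by
  have h : ∀ b, |∫ x, hump r x * cauchyBump c b x| ≤ r ^ 3 := fun b => by
    have := norm_integral_le_of_norm_le (f := fun x => hump r x * cauchyBump c b x)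
      ((integral_cauchyBump hc b).1.const_mul (r ^ 3)) (ae_of_all _ fun x => by
        rw [norm_mul, Real.norm_eq_abs, Real.norm_eq_abs,
          abs_of_nonneg (cauchyBump_nonneg hc.le b x)]
        exact mul_le_mul_of_nonneg_right (abs_hump_le hr x) (cauchyBump_nonneg hc.le b x))
    rwa [integral_const_mul, (integral_cauchyBump hc b).2, mul_one] at this
  rw [humpBump_eq hr hc]
  refine (abs_sub _ _).trans ?_
  linarith [h a, h (-a)]

/-- The profile is odd, so the two opposite point masses add up instead of cancelling. -/
lemma tendsto_humpBump {r : ℝ} (hr : 0 < r) (a : ℝ) :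
    Tendsto (fun c => humpBump c a r) atTop (𝓝 (2 * hump r a)) := by
  have h1 := (tendsto_cauchyBump (integrable_hump hr) (continuous_hump hr).continuousAt
    (x₀ := a)).sub (tendsto_cauchyBump (integrable_hump hr) (continuous_hump hr).continuousAt
    (x₀ := -a))
  rw [hump_neg, sub_neg_eq_add, ← two_mul] at h1
  refine h1.congr' ?_
  filter_upwards [eventually_gt_atTop 0] with c hc
  exact (humpBump_eq hr hc a).symm

/-- The Lorentzians centred at `s = ±φ₁` differ by `4φ₁s` over the product of their denominators, so
the kernel is `εr²/(2φ₁)` times their difference. With `s = Rx` they are Cauchy densities in `x` of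
width `ε/R`. -/
lemma axis_kernel {ε R : ℝ} (hε : 0 < ε) (hR : 0 < R) (r x : ℝ) :
    axisDensity (x, r) * (x * frictionKernel ε (R * x) r) =
      sphereArea * (Real.pi / (2 * R)) * (r ^ 3 / radPhi r) *
        (hump r x * (cauchyBump (R / ε) (radPhi r / R) x - cauchyBump (R / ε) (-(radPhi r / R)) x)) := by
  rcases lt_or_ge |x| r with h | h
  · have hr : 0 < r := (abs_nonneg x).trans_lt h
    have hφ := radPhi_pos hr
    have h1 : axisDensity (x, r) = sphereArea * (r * (r ^ 2 - x ^ 2)) := by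
      rw [axisDensity, Set.indicator_of_mem (show (x, r) ∈ {z : ℝ × ℝ | |z.1| < z.2} from h)]
    have hπ := Real.pi_pos
    have h2 : cauchyBump (R / ε) (radPhi r / R) x =
        R * ε / (Real.pi * ((radPhi r - R * x) ^ 2 + ε ^ 2)) := by
      have : 0 < (radPhi r - R * x) ^ 2 + ε ^ 2 := by positivity
      rw [cauchyBump]
      field_simp
      ring
    have h3 : cauchyBump (R / ε) (-(radPhi r / R)) x =
        R * ε / (Real.pi * ((radPhi r + R * x) ^ 2 + ε ^ 2)) := by
      have : 0 < (radPhi r + R * x) ^ 2 + ε ^ 2 := by positivity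
      rw [cauchyBump]
      field_simp
      ring
    rw [h1, h2, h3, hump_of_lt h, frictionKernel]
    have h4 : 0 < (radPhi r - R * x) ^ 2 + ε ^ 2 := by positivity
    have h5 : 0 < (radPhi r + R * x) ^ 2 + ε ^ 2 := by positivity
    field_simp
    ring
  · have h1 : axisDensity (x, r) = 0 := by
      rw [axisDensity, Set.indicator_of_notMem
        (show (x, r) ∉ {z : ℝ × ℝ | |z.1| < z.2} from not_lt.2 h), mul_zero]
    rw [h1, hump_of_le h]
    ring

/-- Integrate in `x` first, where the Cauchy densities concentrate, then use dominated convergence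
in `r`. -/
lemma tendsto_axis_integral {w : ℝ → ℝ} (hw : Measurable w) {R : ℝ} (hR : 0 < R)
    (hw4 : IntegrableOn (fun r => r ^ 4 * w r) (Set.Ioi 0))
    (hi : ∀ ε, 0 < ε → Integrable fun ξ : E5 => ξ 0 * (frictionKernel ε (R * ξ 0) ‖ξ‖ * w ‖ξ‖)) :
    Tendsto (fun ε => ∫ ξ : E5, ξ 0 * (frictionKernel ε (R * ξ 0) ‖ξ‖ * w ‖ξ‖)) (𝓝[>] 0)
      (𝓝 (sphereArea * Real.pi * (R ^ 4)⁻¹ * ∫ r in Set.Ioo 0 (Real.sqrt (R ^ 2 - 1)),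
        r ^ 5 * w r * (R ^ 2 - 1 - r ^ 2))) := by
  set c₀ : ℝ := sphereArea * (Real.pi / (2 * R)) with hc₀
  have hc₀pos : 0 < c₀ := mul_pos sphereArea_pos (div_pos Real.pi_pos (by positivity))
  have hmeas : ∀ ε : ℝ, Measurable fun z : ℝ × ℝ => z.1 * (frictionKernel ε (R * z.1) z.2 * w z.2) :=
    fun ε => by
      have := continuous_radPhi.measurable
      unfold frictionKernel
      fun_prop
  have hprod : ∀ ε, 0 < ε → ∀ r x, axisDensity (x, r) * (x * (frictionKernel ε (R * x) r * w r)) =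
      c₀ * (r ^ 3 / radPhi r) * w r * (hump r x * (cauchyBump (R / ε) (radPhi r / R) x -
        cauchyBump (R / ε) (-(radPhi r / R)) x)) := fun ε hε r x => by
    linear_combination w r * axis_kernel hε hR r x
  have hint : ∀ ε, 0 < ε → Integrable fun z : ℝ × ℝ =>
      axisDensity z * (z.1 * (frictionKernel ε (R * z.1) z.2 * w z.2)) := fun ε hε =>
    (integrable_axis (hmeas ε)).1 (hi ε hε)
  have hval : ∀ ε, 0 < ε → ∫ ξ : E5, ξ 0 * (frictionKernel ε (R * ξ 0) ‖ξ‖ * w ‖ξ‖) =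
      ∫ r, c₀ * (r ^ 3 / radPhi r) * w r * humpBump (R / ε) (radPhi r / R) r := fun ε hε => by
    rw [integral_axis (hmeas ε), Measure.volume_eq_prod, integral_prod_symm _ (hint ε hε)]
    refine integral_congr_ae (ae_of_all _ fun r => ?_)
    simp only [hprod ε hε]
    rw [integral_const_mul, humpBump]
  have hsm : ∀ ε, 0 < ε → AEStronglyMeasurable (fun r => c₀ * (r ^ 3 / radPhi r) * w r *
      humpBump (R / ε) (radPhi r / R) r) volume := fun ε hε => by
    have := (hint ε hε).integral_prod_right.aestronglyMeasurable
    refine this.congr (ae_of_all _ fun r => ?_)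
    simp only [hprod ε hε]
    rw [integral_const_mul, humpBump]
  have hneg : ∀ r ≤ 0, ∀ c a, humpBump c a r = 0 := fun r hr c a => by
    simp only [humpBump, hump_of_le (hr.trans (abs_nonneg _)), zero_mul, integral_zero]
  have hlim := tendsto_integral_filter_of_dominated_convergence (μ := (volume : Measure ℝ))
    (l := 𝓝[>] (0 : ℝ))
    (F := fun ε r => c₀ * (r ^ 3 / radPhi r) * w r * humpBump (R / ε) (radPhi r / R) r)
    (f := fun r => (Set.Ioi (0 : ℝ)).indicator
      (fun r => c₀ * (r ^ 3 / radPhi r) * w r * (2 * hump r (radPhi r / R))) r)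
    ((Set.Ioi (0 : ℝ)).indicator fun r => 2 * c₀ * ‖r ^ 4 * w r‖) ?_ ?_ ?_ ?_
  · refine (hlim.congr' ?_).trans (le_of_eq ?_)
    · filter_upwards [self_mem_nhdsWithin] with ε hε
      exact (hval ε hε).symm
    · congr 1
      rw [integral_indicator measurableSet_Ioi, ← integral_const_mul,
        ← integral_indicator measurableSet_Ioo, ← integral_indicator measurableSet_Ioi]
      refine integral_congr_ae (ae_of_all _ fun r => ?_)
      rcases le_or_gt r 0 with hr | hr
      · simp only
        rw [Set.indicator_of_notMem (show r ∉ Set.Ioi (0 : ℝ) from not_lt.2 hr),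
          Set.indicator_of_notMem (fun h => not_lt.2 hr h.1)]
      · have hφ := radPhi_pos hr
        have hs : Real.sqrt (1 + r ^ 2) ^ 2 = 1 + r ^ 2 := Real.sq_sqrt (by positivity)
        have hs0 : 0 < Real.sqrt (1 + r ^ 2) := Real.sqrt_pos.2 (by positivity)
        have hφd : radPhi r / R = r * (Real.sqrt (1 + r ^ 2) / R) := by rw [radPhi]; ring
        have habs : |radPhi r / R| = r * (Real.sqrt (1 + r ^ 2) / R) := by
          rw [abs_of_pos (div_pos hφ hR), hφd]
        simp only
        rw [Set.indicator_of_mem (show r ∈ Set.Ioi (0 : ℝ) from hr)]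
        -- This is the resonance condition: the point `φ₁/R` lies inside `|x| < r` exactly when `√(1
        -- + r²) < R`.
        by_cases hlt : r < Real.sqrt (R ^ 2 - 1)
        · rw [Set.indicator_of_mem (show r ∈ Set.Ioo 0 _ from ⟨hr, hlt⟩)]
          have h1 : r ^ 2 < R ^ 2 - 1 := (Real.lt_sqrt hr.le).1 hlt
          have h2 : Real.sqrt (1 + r ^ 2) < R := (Real.sqrt_lt' hR).2 (by linarith)
          rw [hump_of_lt (by
            rw [habs]
            exact mul_lt_of_lt_one_right hr ((div_lt_one hR).2 h2)), hc₀, radPhi]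
          field_simp
          rw [hs]
          ring
        · rw [Set.indicator_of_notMem (fun h => hlt h.2)]
          have h1 : R ^ 2 - 1 ≤ r ^ 2 := by
            by_contra h
            exact hlt ((Real.lt_sqrt hr.le).2 (not_le.1 h))
          have h2 : R ≤ Real.sqrt (1 + r ^ 2) := Real.le_sqrt_of_sq_le (by linarith)
          rw [hump_of_le (by
            rw [habs]
            exact le_mul_of_one_le_right hr.le ((one_le_div hR).2 h2))]
          ring
  · filter_upwards [self_mem_nhdsWithin] with ε hε
    exact hsm ε hε
  · filter_upwards [self_mem_nhdsWithin] with ε hε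
    refine ae_of_all _ fun r => ?_
    rcases le_or_gt r 0 with hr | hr
    · rw [hneg r hr, mul_zero, norm_zero]
      exact Set.indicator_nonneg (fun _ _ => by positivity) r
    · rw [Set.indicator_of_mem (show r ∈ Set.Ioi (0 : ℝ) from hr)]
      have hφ := radPhi_pos hr
      have hb := abs_humpBump_le hr (div_pos hR hε) (radPhi r / R)
      rw [norm_mul, norm_mul, norm_mul, Real.norm_eq_abs (humpBump _ _ _), Real.norm_of_nonneg hc₀pos.le,
        Real.norm_of_nonneg (by positivity : 0 ≤ r ^ 3 / radPhi r), norm_mul,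
        Real.norm_of_nonneg (by positivity : 0 ≤ r ^ 4)]
      -- The bound `φ₁ ≥ r²` reduces the majorant to `r⁴|w|`, which is integrable by assumption.
      have h3 : r ^ 3 / radPhi r * r ^ 3 ≤ r ^ 4 := by
        rw [div_mul_eq_mul_div, div_le_iff₀ hφ]
        have := sq_le_radPhi hr
        nlinarith [pow_pos hr 4]
      calc c₀ * (r ^ 3 / radPhi r) * ‖w r‖ * |humpBump (R / ε) (radPhi r / R) r|
          ≤ c₀ * (r ^ 3 / radPhi r) * ‖w r‖ * (2 * r ^ 3) :=
            mul_le_mul_of_nonneg_left hb (by positivity)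
        _ = 2 * c₀ * ‖w r‖ * (r ^ 3 / radPhi r * r ^ 3) := by ring
        _ ≤ 2 * c₀ * ‖w r‖ * r ^ 4 := mul_le_mul_of_nonneg_left h3 (by positivity)
        _ = _ := by ring
  · exact (integrable_indicator_iff measurableSet_Ioi).2 (hw4.norm.const_mul _)
  · refine ae_of_all _ fun r => ?_
    rcases le_or_gt r 0 with hr | hr
    · simp only [hneg r hr, mul_zero]
      rw [Set.indicator_of_notMem (show r ∉ Set.Ioi (0 : ℝ) from not_lt.2 hr)]
      exact tendsto_const_nhds
    · rw [Set.indicator_of_mem (show r ∈ Set.Ioi (0 : ℝ) from hr)]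
      refine ((tendsto_humpBump hr (radPhi r / R)).comp ?_).const_mul _
      have h1 : Tendsto (fun ε : ℝ => ε⁻¹) (𝓝[>] 0) atTop := tendsto_inv_nhdsGT_zero
      exact (h1.const_mul_atTop hR).congr fun ε => (div_eq_mul_inv R ε).symm

/-! ### Radial potentials and the friction coefficient -/

lemma FT_isometry {f : E5 → ℝ} (T : E5 ≃ₗᵢ[ℝ] E5) (hf : ∀ x, f (T x) = f x) (ξ : E5) :
    FT f (T ξ) = FT f ξ := by
  unfold FT
  have := T.measurePreserving.integral_comp T.toHomeomorph.measurableEmbedding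
    fun x : E5 => Complex.exp (-(Complex.I * (inner ℝ x (T ξ) : ℝ))) * (f x : ℂ)
  simp only [T.inner_map_map, hf] at this
  exact this.symm

lemma norm_smul_basisVec (r : ℝ) : ‖r • basisVec 0‖ = |r| := by
  simp [norm_smul, basisVec]

lemma FT_radial {f : E5 → ℝ} (hf : ∀ x y : E5, ‖x‖ = ‖y‖ → f x = f y) (ξ : E5) :
    FT f ξ = FT f (‖ξ‖ • basisVec 0) := by
  have hn : ‖‖ξ‖ • basisVec 0‖ = ‖ξ‖ := by rw [norm_smul_basisVec, abs_norm]
  have hS := Submodule.reflection_sub hn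
  conv_lhs => rw [← hS]
  exact FT_isometry _ (fun x => hf _ _ (LinearIsometryEquiv.norm_map _ _)) _

/-- The function `|V̂|²` along an axis. -/
def axisWeight (V : E5 → ℝ) (r : ℝ) : ℝ := ‖FT V (r • basisVec 0)‖ ^ 2

lemma axisWeight_nonneg (V : E5 → ℝ) (r : ℝ) : 0 ≤ axisWeight V r := sq_nonneg _

lemma pow_five_mul_rpow {n : ℝ} (hn : 1 / 4 < n) {u : ℝ} (hu : 0 ≤ u) :
    u ^ 5 * (u ^ (2 * n)) ^ 2 = u ^ (5 + 4 * n) := by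
  rcases hu.eq_or_lt with rfl | hu
  · have h1 : 5 + 4 * n ≠ 0 := (by linarith : 0 < 5 + 4 * n).ne'
    rw [Real.zero_rpow h1]; simp
  · rw [← Real.rpow_natCast u 5, ← Real.rpow_natCast _ 2, ← Real.rpow_mul hu.le,
      ← Real.rpow_add hu]
    congr 1
    push_cast
    ring

/-- The integral `∫₀¹ u^{5+4n} (1 - u²) |V̂(δ u)|² du`. -/
def dragProfile (n : ℝ) (V : E5 → ℝ) (δ : ℝ) : ℝ :=
  ∫ u in (0 : ℝ)..1, u ^ (5 + 4 * n) * (1 - u ^ 2) * axisWeight V (δ * u)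

/-- The quotient `Λ(r) / (r - 1)`. -/
def dragQuotient (n : ℝ) (V : E5 → ℝ) (r : ℝ) : ℝ :=
  sphereArea * Real.pi / (2 * Real.pi) ^ 5 * (r ^ 4)⁻¹ * (r + 1) ^ (4 + 2 * n) *
    dragProfile n V (Real.sqrt (r ^ 2 - 1))

open Classical in
/-- The friction coefficient `Λ`. -/
def dragCoeff (n : ℝ) (V : E5 → ℝ) (r : ℝ) : ℝ :=
  if 1 < r then dragQuotient n V r * (r - 1) else 0

/-- The base point `0` may lie outside `s`: only continuity of `g` is needed along the way. -/
lemma contDiffOn_primitive {k : ℕ∞} {g : ℝ → ℝ} (hg : Continuous g) {s : Set ℝ} (hs : IsOpen s)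
    (h : ContDiffOn ℝ k g s) : ContDiffOn ℝ k (fun x => ∫ t in (0 : ℝ)..x, g t) s := by
  have hd : ∀ x, HasDerivAt (fun x => ∫ t in (0 : ℝ)..x, g t) (g x) x := fun x =>
    (hg.integral_hasStrictDerivAt 0 x).hasDerivAt
  have h1 : ContDiffOn ℝ ((k : WithTop ℕ∞) + 1) (fun x => ∫ t in (0 : ℝ)..x, g t) s := by
    refine (contDiffOn_succ_iff_deriv_of_isOpen hs).2
      ⟨fun x _ => (hd x).differentiableAt.differentiableWithinAt, fun hk => ?_, ?_⟩
    · exact absurd hk (by simp)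
    · exact h.congr fun x _ => (hd x).deriv
  exact h1.of_le le_self_add

namespace IsPotential

variable {n : ℝ} {V W : E5 → ℝ}

lemma continuous_axisWeight (h : IsPotential n V W) : Continuous (axisWeight V) := by
  have := continuous_FT h.integrable_V
  unfold axisWeight
  fun_prop

lemma axisWeight_zero (h : IsPotential n V W) : axisWeight V 0 = 1 := by
  rw [axisWeight, zero_smul, h.normalized, one_pow]

/-- Only `Ŵ` is known to be radial, so the frequency is moved to the axis before `V̂` is introduced.
-/
lemma norm_FT_sq (h : IsPotential n V W) (hr : ∀ x y : E5, ‖x‖ = ‖y‖ → W x = W y) (ξ : E5) :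
    ‖FT (shifted W 0) ξ‖ ^ 2 = (‖ξ‖ ^ (2 * n)) ^ 2 * axisWeight V ‖ξ‖ := by
  rw [FT_reflect, RCLike.norm_conj, FT_radial hr, h.fourier_eq, norm_mul, mul_pow, axisWeight,
    norm_smul_basisVec, abs_norm, Complex.norm_real, Real.norm_eq_abs, sq_abs]

lemma continuous_dragProfile (h : IsPotential n V W) (hn : 1 / 4 < n) :
    Continuous (dragProfile n V) := by
  have h1 := h.continuous_axisWeight
  have h2 : Continuous fun u : ℝ => u ^ (5 + 4 * n) := Real.continuous_rpow_const (by linarith)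
  refine intervalIntegral.continuous_parametric_intervalIntegral_of_continuous' ?_ 0 1
  simp only [Function.uncurry_def]
  exact ((h2.comp continuous_snd).mul (by fun_prop)).mul (h1.comp (by fun_prop))

/-- The integrand is nonnegative, and positive for small `u > 0` because `|V̂(0)| = 1`; this also
covers the threshold `δ = 0`. -/
lemma dragProfile_pos (h : IsPotential n V W) (hn : 1 / 4 < n) (δ : ℝ) :
    0 < dragProfile n V δ := by
  have h1 := h.continuous_axisWeight
  have h2 : Continuous fun u : ℝ => u ^ (5 + 4 * n) := Real.continuous_rpow_const (by linarith)
  have h3 : ∀ᶠ u in 𝓝 (0 : ℝ), 0 < axisWeight V (δ * u) := by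
    have : Continuous fun u => axisWeight V (δ * u) := by fun_prop
    refine this.continuousAt.eventually (lt_mem_nhds ?_)
    simp [h.axisWeight_zero]
  have h4 : ∀ᶠ u in 𝓝[>] (0 : ℝ), 0 < axisWeight V (δ * u) := h3.filter_mono nhdsWithin_le_nhds
  have h5 : ∀ᶠ u in 𝓝[>] (0 : ℝ), u ∈ Set.Ioo (0 : ℝ) 1 := Ioo_mem_nhdsGT one_pos
  obtain ⟨u, hu, hu'⟩ := (h4.and h5).exists
  refine intervalIntegral.integral_pos one_pos (by fun_prop) (fun x hx => ?_)
    ⟨u, Set.Ioo_subset_Icc_self hu', ?_⟩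
  · have : x ^ 2 ≤ 1 := pow_le_one₀ hx.1.le hx.2
    exact mul_nonneg (mul_nonneg (Real.rpow_nonneg hx.1.le _) (by linarith))
      (axisWeight_nonneg V _)
  · have : u ^ 2 < 1 := pow_lt_one₀ hu'.1.le hu'.2 two_ne_zero
    exact mul_pos (mul_pos (Real.rpow_pos_of_pos hu'.1 _) (by linarith)) hu

lemma continuousOn_dragQuotient (h : IsPotential n V W) (hn : 1 / 4 < n) :
    ContinuousOn (dragQuotient n V) (Set.Ici 1) := by
  have h1 := h.continuous_dragProfile hn
  have h2 : Continuous fun u : ℝ => u ^ (4 + 2 * n) := Real.continuous_rpow_const (by linarith)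
  have h3 : Continuous fun r : ℝ => (r + 1) ^ (4 + 2 * n) := h2.comp (by fun_prop)
  unfold dragQuotient
  refine ContinuousOn.mul (ContinuousOn.mul (continuousOn_const.mul ?_) h3.continuousOn)
    (Continuous.continuousOn (by fun_prop))
  refine ContinuousOn.inv₀ (by fun_prop) fun r hr => ?_
  have : (1 : ℝ) ≤ r := hr
  positivity

lemma dragQuotient_pos (h : IsPotential n V W) (hn : 1 / 4 < n) {r : ℝ} (hr : 1 ≤ r) :
    0 < dragQuotient n V r := by
  have h1 := h.dragProfile_pos hn (Real.sqrt (r ^ 2 - 1))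
  have h2 : 0 < (r + 1) ^ (4 + 2 * n) := Real.rpow_pos_of_pos (by linarith) _
  have h3 := sphereArea_pos
  have h4 := Real.pi_pos
  unfold dragQuotient
  positivity

/-- The quotient `Λ(r)/(r - 1)` extends to a continuous positive function on the compact interval
`[1, K]`, and `C₀` is its minimum. -/
lemma dragCoeff_lower (h : IsPotential n V W) (hn : 1 / 4 < n) (K : ℝ) :
    ∃ C₀ : ℝ, 0 < C₀ ∧ ∀ r, 1 < r → r ≤ K → C₀ * (r - 1) ≤ dragCoeff n V r := by
  rcases lt_or_ge K 1 with hK | hK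
  · exact ⟨1, one_pos, fun r h1 h2 => absurd (h1.trans_le h2) (not_lt.2 hK.le)⟩
  obtain ⟨r₀, hr₀, hmin⟩ := isCompact_Icc.exists_isMinOn (Set.nonempty_Icc.2 hK)
    ((h.continuousOn_dragQuotient hn).mono Set.Icc_subset_Ici_self)
  refine ⟨dragQuotient n V r₀, h.dragQuotient_pos hn hr₀.1, fun r h1 h2 => ?_⟩
  rw [dragCoeff, if_pos h1]
  exact mul_le_mul_of_nonneg_right (hmin ⟨h1.le, h2⟩) (by linarith)

lemma tendsto_dragCoeff (h : IsPotential n V W) (hn : 1 / 4 < n) :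
    Tendsto (fun r => dragCoeff n V r / (r - 1)) (𝓝[>] 1) (𝓝 (dragQuotient n V 1)) := by
  have h1 : Tendsto (dragQuotient n V) (𝓝[>] 1) (𝓝 (dragQuotient n V 1)) :=
    ((h.continuousOn_dragQuotient hn) 1 Set.self_mem_Ici).mono_left
      (nhdsWithin_mono _ Set.Ioi_subset_Ici_self)
  refine h1.congr' ?_
  filter_upwards [self_mem_nhdsWithin] with r hr
  have h2 : r - 1 ≠ 0 := (sub_pos.2 hr).ne'
  rw [dragCoeff, if_pos (Set.mem_Ioi.1 hr), mul_div_cancel_right₀ _ h2]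

/-- Scaling `r = δu`: the powers of `δ` are `5 + 4n` from the weight, 2 from `δ² - r²` and 1 from
the measure. -/
lemma integral_drag (hn : 1 / 4 < n) {δ : ℝ} (hδ : 0 < δ) :
    ∫ r in (0 : ℝ)..δ, r ^ 5 * ((r ^ (2 * n)) ^ 2 * axisWeight V r) * (δ ^ 2 - r ^ 2) =
      δ ^ (8 + 4 * n) * dragProfile n V δ := by
  have h1 := intervalIntegral.integral_comp_mul_left (a := 0) (b := 1)
    (fun r => r ^ 5 * ((r ^ (2 * n)) ^ 2 * axisWeight V r) * (δ ^ 2 - r ^ 2)) hδ.ne'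
  rw [mul_zero, mul_one, smul_eq_mul, eq_inv_mul_iff_mul_eq₀ hδ.ne'] at h1
  rw [← h1, dragProfile, ← intervalIntegral.integral_const_mul,
    ← intervalIntegral.integral_const_mul]
  refine intervalIntegral.integral_congr fun u hu => ?_
  rw [Set.uIcc_of_le zero_le_one] at hu
  have h2 : δ ^ (8 + 4 * n) = δ ^ 3 * δ ^ (5 + 4 * n) := by
    rw [← Real.rpow_natCast δ 3, ← Real.rpow_add hδ]
    congr 1
    push_cast
    ring
  rw [h2, ← pow_five_mul_rpow hn hδ.le, ← pow_five_mul_rpow hn hu.1, Real.mul_rpow hδ.le hu.1]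
  ring

lemma rpow_drag (hn : 1 / 4 < n) {r : ℝ} (hr : 1 < r) :
    Real.sqrt (r ^ 2 - 1) ^ (8 + 4 * n) =
      (r + 1) ^ (4 + 2 * n) * ((r - 1) * (r - 1) ^ (3 + 2 * n)) := by
  have h1 : 0 < r - 1 := by linarith
  have h2 : 0 < r + 1 := by linarith
  have h3 : (r - 1) * (r - 1) ^ (3 + 2 * n) = (r - 1) ^ (4 + 2 * n) := by
    rw [← Real.rpow_one_add' h1.le (by linarith : 0 < 1 + (3 + 2 * n)).ne']
    congr 1
    ring
  rw [h3, ← Real.mul_rpow h2.le h1.le, Real.sqrt_eq_rpow, ← Real.rpow_mul (by nlinarith)]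
  congr 1 <;> ring

/-- Differentiating `dragProfile` under the integral would require control of `V̂` near the origin.
Undoing the scaling puts the parameter into the upper limit: `δ² ∫₀^δ g₀ - ∫₀^δ g₁` is `C^k` in `δ >
0` as soon as the integrands are `C^k` off the origin. -/
lemma contDiffOn_dragCoeff (h : IsPotential n V W) (hn : 1 / 4 < n) (k : ℕ∞)
    (hV : ContDiffOn ℝ k (FT V) {0}ᶜ) : ContDiffOn ℝ k (dragCoeff n V) {1}ᶜ := by
  have hw := h.continuous_axisWeight
  have hp : Continuous fun u : ℝ => u ^ (2 * n) := Real.continuous_rpow_const (by linarith)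
  set g₀ : ℝ → ℝ := fun r => r ^ 5 * ((r ^ (2 * n)) ^ 2 * axisWeight V r) with hg₀
  set g₁ : ℝ → ℝ := fun r => r ^ 2 * g₀ r with hg₁
  have hg₀c : Continuous g₀ := by fun_prop
  have hg₁c : Continuous g₁ := by fun_prop
  have hpk : ContDiffOn ℝ k (fun u : ℝ => u ^ (2 * n)) (Set.Ioi 0) := fun u hu =>
    (contDiffAt_id.rpow_const_of_ne (ne_of_gt hu)).contDiffWithinAt
  have hwk : ContDiffOn ℝ k (axisWeight V) (Set.Ioi 0) := by
    refine ContDiffOn.norm_sq ℝ (hV.comp (t := {0}ᶜ) (f := fun r : ℝ => r • basisVec 0)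
      (by fun_prop) fun r hr => ?_)
    have : (0 : ℝ) < r := hr
    rw [Set.mem_compl_singleton_iff, ← norm_pos_iff, norm_smul_basisVec]
    exact abs_pos.2 this.ne'
  have hg₀k : ContDiffOn ℝ k g₀ (Set.Ioi 0) := by fun_prop
  have hg₁k : ContDiffOn ℝ k g₁ (Set.Ioi 0) := by fun_prop
  have hG₀ := contDiffOn_primitive hg₀c isOpen_Ioi hg₀k
  have hG₁ := contDiffOn_primitive hg₁c isOpen_Ioi hg₁k
  have hsq : ∀ r ∈ Set.Ioi (1 : ℝ), 0 < r ^ 2 - 1 := fun r hr => by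
    have : (1 : ℝ) < r := hr
    nlinarith
  have hδ : ContDiffOn ℝ k (fun r : ℝ => Real.sqrt (r ^ 2 - 1)) (Set.Ioi 1) :=
    ContDiffOn.sqrt (by fun_prop) fun r hr => (hsq r hr).ne'
  have hδm : Set.MapsTo (fun r : ℝ => Real.sqrt (r ^ 2 - 1)) (Set.Ioi 1) (Set.Ioi 0) :=
    fun r hr => Real.sqrt_pos.2 (hsq r hr)
  have hmain : ContDiffOn ℝ k (fun r : ℝ => sphereArea * Real.pi / (2 * Real.pi) ^ 5 * (r ^ 4)⁻¹ *
      ((r - 1) ^ (3 + 2 * n))⁻¹ * ((r ^ 2 - 1) * (∫ t in (0 : ℝ)..Real.sqrt (r ^ 2 - 1), g₀ t) -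
        ∫ t in (0 : ℝ)..Real.sqrt (r ^ 2 - 1), g₁ t)) (Set.Ioi 1) := by
    have c0 := hG₀.comp hδ hδm
    have c1 := hG₁.comp hδ hδm
    have c2 : ContDiffOn ℝ k (fun r : ℝ => (r ^ 4)⁻¹) (Set.Ioi 1) :=
      ContDiffOn.inv (by fun_prop) fun r hr => by
        have : (1 : ℝ) < r := hr
        positivity
    have c3 : ContDiffOn ℝ k (fun r : ℝ => ((r - 1) ^ (3 + 2 * n))⁻¹) (Set.Ioi 1) :=
      ContDiffOn.inv (fun r hr => (ContDiffAt.rpow_const_of_ne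
        (contDiffAt_id.sub contDiffAt_const) (sub_pos.2 hr).ne').contDiffWithinAt) fun r hr =>
          (Real.rpow_pos_of_pos (sub_pos.2 hr) _).ne'
    have c4 : ContDiffOn ℝ k (fun r : ℝ => r ^ 2 - 1) (Set.Ioi 1) := by fun_prop
    exact ((contDiffOn_const.mul c2).mul c3).mul ((c4.mul c0).sub c1)
  have heq : ∀ r ∈ Set.Ioi (1 : ℝ), dragCoeff n V r =
      sphereArea * Real.pi / (2 * Real.pi) ^ 5 * (r ^ 4)⁻¹ *
      ((r - 1) ^ (3 + 2 * n))⁻¹ * ((r ^ 2 - 1) * (∫ t in (0 : ℝ)..Real.sqrt (r ^ 2 - 1), g₀ t) -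
        ∫ t in (0 : ℝ)..Real.sqrt (r ^ 2 - 1), g₁ t) := fun r hr => by
    have h1 : 0 < Real.sqrt (r ^ 2 - 1) := hδm hr
    have h2 := integral_drag (V := V) hn h1
    have h3 : ∫ t in (0 : ℝ)..Real.sqrt (r ^ 2 - 1), t ^ 5 * ((t ^ (2 * n)) ^ 2 * axisWeight V t) *
        (Real.sqrt (r ^ 2 - 1) ^ 2 - t ^ 2) =
        (r ^ 2 - 1) * (∫ t in (0 : ℝ)..Real.sqrt (r ^ 2 - 1), g₀ t) -
        ∫ t in (0 : ℝ)..Real.sqrt (r ^ 2 - 1), g₁ t := by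
      rw [← intervalIntegral.integral_const_mul, ← intervalIntegral.integral_sub
        ((hg₀c.const_mul _).intervalIntegrable _ _) (hg₁c.intervalIntegrable _ _),
        Real.sq_sqrt (hsq r hr).le]
      refine intervalIntegral.integral_congr fun t _ => ?_
      simp only [hg₁, hg₀]
      ring
    have h4 : 0 < (r - 1) ^ (3 + 2 * n) := Real.rpow_pos_of_pos (sub_pos.2 hr) _
    rw [← h3, h2, rpow_drag hn hr, dragCoeff, if_pos (Set.mem_Ioi.1 hr), dragQuotient]
    field_simp
  intro r hr
  refine ContDiffAt.contDiffWithinAt ?_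
  rcases lt_or_gt_of_ne (Set.mem_compl_singleton_iff.1 hr) with h1 | h1
  · refine (contDiffAt_const (c := (0 : ℝ))).congr_of_eventuallyEq ?_
    filter_upwards [Iio_mem_nhds h1] with x hx
    rw [dragCoeff, if_neg (not_lt.2 (le_of_lt hx))]
  · refine ((hmain.contDiffAt (Ioi_mem_nhds h1))).congr_of_eventuallyEq ?_
    filter_upwards [Ioi_mem_nhds h1] with x hx using heq x hx

lemma tendsto_friction (h : IsPotential n V W) (hn : 1 / 4 < n)
    (hr : ∀ x y : E5, ‖x‖ = ‖y‖ → W x = W y) (ρ₀ : ℝ) (p : E5) :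
    Tendsto (fun ε => friction ρ₀ (shifted W 0) ε p) (𝓝[>] 0)
      (𝓝 (-(ρ₀ • golden (dragCoeff n V) n p))) := by
  suffices hcoord : ∀ j, Tendsto (fun ε => friction ρ₀ (shifted W 0) ε p j) (𝓝[>] 0)
      (𝓝 ((-(ρ₀ • golden (dragCoeff n V) n p)) j)) from
    ((PiLp.continuous_toLp 2 fun _ : Fin 5 => ℝ).tendsto _).comp (tendsto_pi_nhds.2 hcoord)
  intro j
  -- At zero velocity there is no axis to rotate to, but the kernel vanishes identically.
  rcases eq_or_ne p 0 with rfl | hp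
  · have h0 : golden (dragCoeff n V) n 0 = 0 :=
      Set.indicator_of_notMem (by simp) _
    rw [h0, smul_zero, neg_zero]
    refine tendsto_const_nhds.congr' ?_
    filter_upwards [self_mem_nhdsWithin] with ε hε
    rw [(h.friction_integral hε ρ₀ 0 j).2]
    simp [frictionKernel]
  have hp0 : 0 < ‖p‖ := norm_pos_iff.2 hp
  set w : ℝ → ℝ := fun r => (r ^ (2 * n)) ^ 2 * axisWeight V r with hw
  have hwc : Continuous w := by
    have h1 := h.continuous_axisWeight
    have h2 : Continuous fun u : ℝ => u ^ (2 * n) := Real.continuous_rpow_const (by linarith)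
    fun_prop
  have hwξ : ∀ ξ : E5, ‖FT (shifted W 0) ξ‖ ^ 2 = w ‖ξ‖ := h.norm_FT_sq hr
  -- This is `Û ∈ L²(ℝ⁵)` in polar coordinates.
  have hw4 : IntegrableOn (fun r => r ^ 4 * w r) (Set.Ioi 0) := by
    have h1 : MemLp (FT (shifted W 0)) 2 := by
      have := h.memLp_of_le (m := fun _ => 1) aestronglyMeasurable_const 1 fun ξ => by
        rw [norm_one, one_mul]
        nlinarith [sq_nonneg ‖ξ‖, sq_nonneg (‖ξ‖ ^ 2)]
      simpa using this
    have h2 := (memLp_two_iff_integrable_sq_norm h1.aestronglyMeasurable).1 h1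
    simp only [hwξ] at h2
    have h3 := (integrable_fun_norm_addHaar (volume : Measure E5) (f := w)).1 h2
    simpa using h3
  have hfi := fun ε (hε : 0 < ε) j => h.friction_integral hε ρ₀ p j
  simp only [hwξ] at hfi
  have hax := fun ε (hε : 0 < ε) => integral_axis_reduction
    (G := fun s r => frictionKernel ε s r * w r) hp (fun i => (hfi ε hε i).1) j
  have hlim := tendsto_axis_integral hwc.measurable hp0 hw4 fun ε hε => (hax ε hε).1
  have hlim' := (hlim.const_mul (p j / ‖p‖)).const_mul (-(ρ₀ / (2 * Real.pi) ^ 5))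
  have hcong : ∀ᶠ ε in 𝓝[>] (0 : ℝ), -(ρ₀ / (2 * Real.pi) ^ 5) * (p j / ‖p‖ *
      ∫ ξ : E5, ξ 0 * (frictionKernel ε (‖p‖ * ξ 0) ‖ξ‖ * w ‖ξ‖)) =
      friction ρ₀ (shifted W 0) ε p j := by
    filter_upwards [self_mem_nhdsWithin] with ε hε
    rw [(hfi ε hε j).2, (hax ε hε).2]
  refine (hlim'.congr' hcong).trans (le_of_eq (congrArg 𝓝 ?_))
  rw [PiLp.neg_apply, PiLp.smul_apply, smul_eq_mul]
  rcases lt_or_ge 1 ‖p‖ with hR | hR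
  · have hδ : 0 < Real.sqrt (‖p‖ ^ 2 - 1) := Real.sqrt_pos.2 (by nlinarith)
    have h1 := integral_drag (V := V) hn hδ
    rw [intervalIntegral.integral_of_le hδ.le, integral_Ioc_eq_integral_Ioo,
      Real.sq_sqrt (by nlinarith), rpow_drag hn hR] at h1
    rw [h1, golden, Set.indicator_of_mem (show p ∈ {q : E5 | 1 < ‖q‖} from hR), dragCoeff,
      if_pos hR, dragQuotient]
    simp only [PiLp.smul_apply, smul_eq_mul]
    field_simp
  · have h1 : Real.sqrt (‖p‖ ^ 2 - 1) = 0 := Real.sqrt_eq_zero'.2 (by nlinarith)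
    rw [h1, golden, Set.indicator_of_notMem (show p ∉ {q : E5 | 1 < ‖q‖} from not_lt.2 hR)]
    simp

end IsPotential

end ParticleBose

end

/-! ### The theorem -/

open ParticleBose MeasureTheory Filter Topology in
theorem lemma2p3 (n : ℝ) (hn : 1 / 4 < n) (V W : E5 → ℝ) (hW : IsPotential n V W) :
    (∀ ε : ℝ, 0 < ε → ∀ p : E5,
      (∃ u, IsHepsInv ε p (secondOnly (shifted W 0)) u) ∧
      (∀ u v, IsHepsInv ε p (secondOnly (shifted W 0)) u →
        IsHepsInv ε p (secondOnly (shifted W 0)) v → ∀ k, u k =ᵐ[volume] v k)) ∧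
    (∀ (ρ₀ : ℝ) (X P : ℝ → E5) (β : ℝ → E5 → ℂ), 0 ≤ ρ₀ → IsSolution ρ₀ W X P β →
      ∀ ε : ℝ, 0 < ε → ∀ t : ℝ, 0 ≤ t →
        (∀ j : Fin 5,
          Integrable (bracketFun (shifted W 0) (gR1 X P β ε t) j) ∧
          Integrable (bracketFun (shifted W 0) (gR2 X P β ε t) j) ∧
          Integrable (bracketFun (shifted W 0) (gR3 (shifted W 0) X P ε t) j) ∧
          Integrable (bracketFun (shifted W 0) (gR4 (shifted W 0) X P ε t) j) ∧
          Integrable (bracketFun (shifted W 0) (gE1 X P β ε t) j) ∧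
          Integrable (bracketFun (shifted W 0) (gE2 (shifted W 0) X P ε t) j)) ∧
        HasDerivWithinAt P
          (friction ρ₀ (shifted W 0) ε (P t) +
            R1 ρ₀ (shifted W 0) X P β ε t + R2 ρ₀ (shifted W 0) X P β ε t +
            R3 ρ₀ (shifted W 0) X P ε t + R4 ρ₀ (shifted W 0) X P ε t +
            E1 ρ₀ (shifted W 0) X P β ε t + E2 ρ₀ (shifted W 0) X P ε t)
          (Set.Ici 0) t) ∧
    ((∀ x y : E5, ‖x‖ = ‖y‖ → W x = W y) →
      ∃ Λ : ℝ → ℝ,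
        (∀ r, r ≤ 1 → Λ r = 0) ∧
        (∀ K : ℝ, ∃ C₀ : ℝ, 0 < C₀ ∧ ∀ r, 1 < r → r ≤ K → C₀ * (r - 1) ≤ Λ r) ∧
        (∃ c : ℝ, 0 < c ∧ Tendsto (fun r => Λ r / (r - 1)) (𝓝[>] 1) (𝓝 c)) ∧
        (∀ k : ℕ∞, ContDiffOn ℝ k (FT V) {0}ᶜ → ContDiffOn ℝ k Λ {1}ᶜ) ∧
        (∀ (ρ₀ : ℝ) (p : E5), 0 ≤ ρ₀ →
          Tendsto (fun ε => friction ρ₀ (shifted W 0) ε p) (𝓝[>] 0)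
            (𝓝 (-(ρ₀ • golden Λ n p)))) ∧
        (∀ (ρ₀ : ℝ) (X P : ℝ → E5) (β : ℝ → E5 → ℂ), 0 ≤ ρ₀ → IsSolution ρ₀ W X P β →
          ∀ t : ℝ, 0 ≤ t →
            (∀ ε : ℝ, 0 < ε →
              HasDerivWithinAt P
                (-(ρ₀ • golden Λ n (P t)) +
                  R1 ρ₀ (shifted W 0) X P β ε t + R2 ρ₀ (shifted W 0) X P β ε t +
                  R3 ρ₀ (shifted W 0) X P ε t + R4 ρ₀ (shifted W 0) X P ε t +
                  E1 ρ₀ (shifted W 0) X P β ε t + E2 ρ₀ (shifted W 0) X P ε t +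
                  Reps ρ₀ (shifted W 0) Λ n ε (P t))
                (Set.Ici 0) t) ∧
            Tendsto (fun ε => Reps ρ₀ (shifted W 0) Λ n ε (P t)) (𝓝[>] 0) (𝓝 0))) := by
  refine ⟨fun ε hε p => ⟨hW.exists_isHepsInv hε p, fun u v hu hv k => hW.isHepsInv_unique hε hu hv k⟩,
    fun ρ₀ X P β hρ h ε hε t ht => ⟨fun j => h.integrable_brackets hW hε ht j,
      h.motion hW hρ hε ht⟩, fun hr => ⟨dragCoeff n V, fun r hr => if_neg (not_lt.2 hr),
      hW.dragCoeff_lower hn, ⟨_, hW.dragQuotient_pos hn le_rfl, hW.tendsto_dragCoeff hn⟩,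
      fun k => hW.contDiffOn_dragCoeff hn k, fun ρ₀ p _ => hW.tendsto_friction hn hr ρ₀ p,
      fun ρ₀ X P β hρ h t ht => ⟨fun ε hε => ?_, ?_⟩⟩⟩
  · refine (h.motion hW hρ hε ht).congr_deriv ?_
    rw [Reps]
    abel
  · have := (hW.tendsto_friction hn hr ρ₀ (P t)).const_add (ρ₀ • golden (dragCoeff n V) n (P t))
    rwa [add_neg_cancel] at this
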